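/- **Conventions.** Matrices have entries in a field $F$. For an $n\times n$ matrix $A$: - the *left triangular part* $\mathrm{Left}(A)$ keeps the entries $A_{i,j}$ with $i+j\le n$ and replaces the others by $0$; - the *left quasiseparable order* of $A$ is $s=\max_{1\le k\le n-1}\operatorname{rank}(A_{1..k,\,1..n-k})$ (it depends only on $\mathrm{Left}(A)$, and is $0$ if $n\le 1$); - the *quasiseparable orders* of $M$ are $r_L=\max_{1\le k\le n-1}\operatorname{rank}(M_{k+1..n,\,1..k})$ and $r_U=\max_{1\le k\le n-1}\operatorname{rank}(M_{1..k,\,k+1..n})$; - the *rank profile matrix* $\mathcal R_A$ of an $m\times n$ matrix $A$ of rank $r$ is the unique $m\times n$ matrix with exactly $r$ non-zero entries, all equal to one and on distinct rows and columns, each of whose leading submatrices has the same rank as the corresponding leading submatrix of $A$; - a *PLUQ decomposition* of an $m\times n$ matrix $A$ of rank $r$ is $A=PLUQ$ with permutation matrices $P,Q$, an $m\times r$ unit lower triangular $L$ and an $r\times n$ upper triangular $U$; it *reveals the rank profile matrix* if $\mathcal R_A=P\begin{bmatrix}I_r&0\\0&0\end{bmatrix}Q$; - $J_n$ is the $n\times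 n$ unit antidiagonal matrix. **Cost model.** Algorithms are algebraic computation trees over a base field $k$. They may use constants of $k$ and run over any field $F\supseteq k$. Each arithmetic operation and each test "$x=0$?" counts as one field operation. Constants, copies, permutations and index manipulations are free. **Algorithm LT-RPM** (input: an $n\times n$ matrix $A$). If $n\le 1$, return the zero matrix. Otherwise split $A=\begin{bmatrix}A_1&A_2\\A_3&*\end{bmatrix}$ with $A_3$ of size $\lfloor n/2\rfloor\times\lfloor n/2\rfloor$. Compute a PLUQ decomposition $A_1=P_1\begin{bmatrix}L_1\\M_1\end{bmatrix}\begin{bmatrix}U_1&V_1\end{bmatrix}Q_1$ revealing the rank profile matrix, with $L_1,U_1$ of size $r_1=\operatorname{rank}A_1$, and set $\mathcal R_1=P_1\begin{bmatrix}I_{r_1}&0\\0&0\end{bmatrix}Q_1$. Set $$\begin{bmatrix}B_1\\B_2\end{bmatrix}=P_1^TA_2,\quad \begin{bmatrix}C_1&C_2\end{bmatrix}=A_3Q_1^T,\quad D=L_1^{-1}B_1,\quad E=C_1U_1^{-1},\quad F=B_2-M_1D,\quad G=C_2-EV_1,$$ $$H=P_1\begin{bmatrix}0\\F\end{bmatrix},\qquad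 I=\begin{bmatrix}0&G\end{bmatrix}Q_1 .$$ Call the algorithm on $H$ and $I$, obtaining $\mathcal R_2$ and $\mathcal R_3$, and return $\begin{bmatrix}\mathcal R_1&\mathcal R_2\\\mathcal R_3&0\end{bmatrix}$, given as the list of the positions of its ones. The algorithm calls four subroutines: the PLUQ decomposition, the solvers $L_1^{-1}B_1$ and $C_1U_1^{-1}$, and the product-subtraction $B-XY$. **Algorithm QS-order** (input: an $n\times n$ matrix $A$). Run LT-RPM on $A$. For every position $(i,j)$ returned, mark row $i$ and column $j$. Start from $s=r=0$; for $i=1,\dots,n-1$: if row $i$ is marked, increase $r$ by $1$; if column $n-i+1$ is marked, decrease $r$ by $1$; then replace $s$ by $\max(s,r)$. Return $s$. **Theorem.** Let $k$ be a field and $2<\omega\le 3$, and assume that two $n\times n$ matrices can be multiplied in $O(n^\omega)$ field operations (by algorithms over $k$, valid over every field containing $k$, with one constant in the $O$). 1. *(Correctness.)* With any correct subroutines over a field $F\supseteq k$, for every $n\times n$ matrix $A$ over $F$ the rank profile matrix $\mathcal R_A$ exists and is unique, and LT-RPM returns $\mathrm{Left}(\mathcal R_A)$. 2. *(Cost.)*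 Suppose the subroutines are correct and have, for some constant $c$, the following costs: - at most $c\,mn\max(1,r)^{\omega-2}$ for the PLUQ decomposition of an $m\times n$ matrix of rank $r$; - at most $c\max(r,m)\,r^{\omega-1}$ for solving an $r\times r$ triangular system with $m$ right-hand sides; - at most $c\,(m+r)(n+r)\max(1,r)^{\omega-2}$ for $B-XY$ with $X$ of size $m\times r$ and $Y$ of size $r\times n$. Then LT-RPM uses at most $C\,n^2\max(1,s)^{\omega-2}$ field operations on every $n\times n$ matrix $A$ of left quasiseparable order $s$, that is $O(n^2s^{\omega-2})$ for $s\ge 1$. Here $C$ depends only on $c$, $\omega$ and $k$. In particular the bound depends on $s$ and not on $\operatorname{rank}A$. 3. *(Subroutines.)* Correct subroutines with these costs exist, with one constant $c$ valid over all fields $F\supseteq k$. 4. *(QS-order.)* With any correct subroutines, QS-order returns the left quasiseparable order of its input; after the call of LT-RPM it performs no field operation and $O(n)$ elementary steps. 5. *(Quasiseparable orders.)* Let $M$ be a dense $n\times n$ matrix, and let $L$ and $U$ be its lower and upper triangular parts (with or without the diagonal). With any correct subroutines, QS-order run on $J_nL$ and on $UJ_n$ returns $r_L$ and $r_U$ respectively.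 The left quasiseparable orders of $J_nL$ and $UJ_n$ are $r_L$ and $r_U$, so that these orders govern the costs in item 2. -/

import Mathlib

universe u

/-! ## Leading ranks, quasiseparable orders, rank profile matrix

Rows and columns are indexed from `0` in the code. -/

/-- Rank of the leading `a × b` submatrix (first `a` rows, first `b` columns). -/
noncomputable def leadingRank {F : Type u} [Field F] {m n : ℕ}
    (A : Matrix (Fin m) (Fin n) F) (a b : ℕ) : ℕ :=
  (A.submatrix (fun x : {x : Fin m // x.1 < a} => x.1)
    (fun y : {y : Fin n // y.1 < b} => y.1)).rank

/-- Left quasiseparable order: the maximal rank of a leading `p × (n - p)` submatrix,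
`1 ≤ p ≤ n - 1`. -/
noncomputable def leftQSOrder {F : Type u} [Field F] {n : ℕ}
    (A : Matrix (Fin n) (Fin n) F) : ℕ :=
  (Finset.Icc 1 (n - 1)).sup fun p => leadingRank A p (n - p)

/-- Lower quasiseparable order `r_L`: the maximal rank of the blocks with rows `p+1, …, n` and
columns `1, …, p` (numbered from `1`), `1 ≤ p ≤ n - 1`. -/
noncomputable def lowerQSOrder {F : Type u} [Field F] {n : ℕ}
    (M : Matrix (Fin n) (Fin n) F) : ℕ :=
  (Finset.Icc 1 (n - 1)).sup fun p =>
    (M.submatrix (fun x : {x : Fin n // p ≤ x.1} => x.1)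
      (fun y : {y : Fin n // y.1 < p} => y.1)).rank

/-- Upper quasiseparable order `r_U`: the maximal rank of the blocks with rows `1, …, p` and
columns `p+1, …, n` (numbered from `1`), `1 ≤ p ≤ n - 1`. -/
noncomputable def upperQSOrder {F : Type u} [Field F] {n : ℕ}
    (M : Matrix (Fin n) (Fin n) F) : ℕ :=
  (Finset.Icc 1 (n - 1)).sup fun p =>
    (M.submatrix (fun x : {x : Fin n // x.1 < p} => x.1)
      (fun y : {y : Fin n // p ≤ y.1} => y.1)).rank

/-- The left triangular part: numbered from `1`, the entries with `i + j ≤ n` are kept. -/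
def leftPart {F : Type u} [Field F] {n : ℕ} (A : Matrix (Fin n) (Fin n) F) :
    Matrix (Fin n) (Fin n) F :=
  Matrix.of fun i j => if (i.1 + 1) + (j.1 + 1) ≤ n then A i j else 0

/-- The unit antidiagonal matrix `J_n`. -/
def antidiag (F : Type u) [Field F] (n : ℕ) : Matrix (Fin n) (Fin n) F :=
  Matrix.of fun i j => if j = Fin.rev i then 1 else 0

/-- `R` is the rank profile matrix of `A`: it has `rank A` non-zero entries, all equal to one, on
distinct rows and columns, and its leading submatrices have the same ranks as those of `A`. -/
structure IsRankProfileMatrix {F : Type u} [Field F] {m n : ℕ}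
    (A R : Matrix (Fin m) (Fin n) F) : Prop where
  zero_or_one : ∀ i j, R i j = 0 ∨ R i j = 1
  distinct_cols : ∀ i j j', R i j ≠ 0 → R i j' ≠ 0 → j = j'
  distinct_rows : ∀ i i' j, R i j ≠ 0 → R i' j ≠ 0 → i = i'
  card_eq : {p : Fin m × Fin n | R p.1 p.2 ≠ 0}.ncard = A.rank
  leading_eq : ∀ a b, a ≤ m → b ≤ n → leadingRank R a b = leadingRank A a b

/-- The compact form of a 0-1 matrix: the list, without repetition, of the positions of its
ones. -/
def IsPivotList {F : Type u} [Field F] {m n : ℕ} (l : List (ℕ × ℕ))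
    (R : Matrix (Fin m) (Fin n) F) : Prop :=
  l.Nodup ∧ (∀ p ∈ l, p.1 < m ∧ p.2 < n) ∧
    ∀ (i : Fin m) (j : Fin n), R i j = if (i.1, j.1) ∈ l then 1 else 0

/-! ## The computation model

Algebraic computation trees.  A program never sees a field element: it only handles addresses of
memory cells.  It may load a constant of the base field `k`, apply an arithmetic operation to two
cells (the result goes to a new cell, whose address is passed on), and branch on whether a cell is
zero.  Programs can be run over every field `F` that contains `k`. -/

inductive FieldOp
  | add | sub | mul | div

def FieldOp.eval {F : Type u} [Field F] : FieldOp → F → F → F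
  | .add, x, y => x + y
  | .sub, x, y => x - y
  | .mul, x, y => x * y
  | .div, x, y => x / y

inductive Prog (k : Type u) (α : Type) : Type u
  | ret (a : α) : Prog k α
  | lit (c : k) (next : ℕ → Prog k α) : Prog k α
  | op (o : FieldOp) (x y : ℕ) (next : ℕ → Prog k α) : Prog k α
  | test (x : ℕ) (next : Bool → Prog k α) : Prog k α

namespace Prog

def bind {k : Type u} {α β : Type} : Prog k α → (α → Prog k β) → Prog k β
  | ret a, f => f a
  | lit c next, f => lit c fun x => (next x).bind f
  | op o x y next, f => op o x y fun z => (next z).bind f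
  | test x next, f => test x fun b => (next b).bind f

instance {k : Type u} : Monad (Prog k) where
  pure := ret
  bind := bind

/-- Load a constant into a new cell and return its address. -/
def const {k : Type u} (c : k) : Prog k ℕ := lit c ret

open Classical in
/-- Run a program on a memory; the outcome is the returned data and the final memory.
New cells are appended at the end of the memory. -/
noncomputable def exec {k F : Type u} [Field k] [Field F] [Algebra k F] {α : Type} :
    Prog k α → List F → α × List F
  | ret a, μ => (a, μ)
  | lit c next, μ => (next μ.length).exec (μ ++ [algebraMap k F c])
  | op o x y next, μ => (next μ.length).exec (μ ++ [o.eval (μ.getD x 0) (μ.getD y 0)])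
  | test x next, μ => (next (decide (μ.getD x 0 = 0))).exec μ

open Classical in
/-- The number of field operations of a run: every arithmetic operation and every zero test
costs one. -/
noncomputable def cost {k F : Type u} [Field k] [Field F] [Algebra k F] {α : Type} :
    Prog k α → List F → ℕ
  | ret _, _ => 0
  | lit c next, μ => (next μ.length).cost (μ ++ [algebraMap k F c])
  | op o x y next, μ => (next μ.length).cost (μ ++ [o.eval (μ.getD x 0) (μ.getD y 0)]) + 1
  | test x next, μ => (next (decide (μ.getD x 0 = 0))).cost μ + 1

/-- The data returned by a run. -/
noncomputable def val {k F : Type u} [Field k] [Field F] [Algebra k F] {α : Type}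
    (p : Prog k α) (μ : List F) : α := (p.exec μ).1

/-- The memory after a run. -/
noncomputable def mem {k F : Type u} [Field k] [Field F] [Algebra k F] {α : Type}
    (p : Prog k α) (μ : List F) : List F := (p.exec μ).2

end Prog

/-- A matrix stored in memory: the addresses of its entries. -/
abbrev AddrMatrix (m n : ℕ) : Type := Matrix (Fin m) (Fin n) ℕ

namespace AddrMatrix

/-- All addresses lie in the memory. -/
def Valid {F : Type u} {m n : ℕ} (X : AddrMatrix m n) (μ : List F) : Prop :=
  ∀ i j, X i j < μ.length

/-- The matrix of field elements that is stored at the given addresses. -/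
def load {F : Type u} [Field F] {m n : ℕ} (X : AddrMatrix m n) (μ : List F) :
    Matrix (Fin m) (Fin n) F :=
  Matrix.of fun i j => μ.getD (X i j) 0

end AddrMatrix

/-- Two `n × n` matrices can be multiplied in `O(n ^ ω)` field operations, by algorithms with
constants in `k` that work over every field containing `k`. -/
def MatMulExponent (k : Type u) [Field k] (ω : ℝ) : Prop :=
  ∃ (C : ℝ) (mm : ∀ n : ℕ, AddrMatrix n n → AddrMatrix n n → Prog k (AddrMatrix n n)),
    ∀ (F : Type u) [Field F] [Algebra k F] (n : ℕ) (X Y : AddrMatrix n n) (μ : List F),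
      X.Valid μ → Y.Valid μ →
        ((mm n X Y).val μ).Valid ((mm n X Y).mem μ) ∧
        ((mm n X Y).val μ).load ((mm n X Y).mem μ) = X.load μ * Y.load μ ∧
        ((mm n X Y).cost μ : ℝ) ≤ C * (n : ℝ) ^ ω

/-! ## The subroutines of the algorithm -/

/-- The output `(r, P, L, U, Q)` of a PLUQ decomposition routine. -/
structure PLUQ (m n : ℕ) where
  r : ℕ
  r_le_rows : r ≤ m
  r_le_cols : r ≤ n
  P : Equiv.Perm (Fin m)
  Q : Equiv.Perm (Fin n)
  L : AddrMatrix m r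
  U : AddrMatrix r n

/-- The `m × n` matrix with the identity of order `r` as its top left block, zero elsewhere. -/
def idBlock (F : Type u) [Field F] (m n r : ℕ) : Matrix (Fin m) (Fin n) F :=
  Matrix.of fun i j => if i.1 = j.1 ∧ i.1 < r then 1 else 0

/-- `f`, read in the memory `μ`, is a PLUQ decomposition of `A` that reveals its rank profile
matrix. -/
structure PLUQ.Decomposes {F : Type u} [Field F] {m n : ℕ} (f : PLUQ m n) (μ : List F)
    (A : Matrix (Fin m) (Fin n) F) : Prop where
  valid_L : f.L.Valid μ
  valid_U : f.U.Valid μ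
  r_eq_rank : f.r = A.rank
  L_diag : ∀ (i : Fin m) (t : Fin f.r), i.1 = t.1 → f.L.load μ i t = 1
  L_upper : ∀ (i : Fin m) (t : Fin f.r), i.1 < t.1 → f.L.load μ i t = 0
  U_lower : ∀ (t : Fin f.r) (j : Fin n), j.1 < t.1 → f.U.load μ t j = 0
  eq_mul : A = f.P.permMatrix F * f.L.load μ * f.U.load μ * f.Q.permMatrix F
  reveals : IsRankProfileMatrix A (f.P.permMatrix F * idBlock F m n f.r * f.Q.permMatrix F)

/-- Routines for: a PLUQ decomposition; `L⁻¹ * B`; `C * U⁻¹`; `B - X * Y`. -/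
structure Subroutines (k : Type u) where
  pluq : ∀ m n : ℕ, AddrMatrix m n → Prog k (PLUQ m n)
  lowerSolve : ∀ r n : ℕ, AddrMatrix r r → AddrMatrix r n → Prog k (AddrMatrix r n)
  upperSolve : ∀ m r : ℕ, AddrMatrix m r → AddrMatrix r r → Prog k (AddrMatrix m r)
  subMul : ∀ m r n : ℕ, AddrMatrix m n → AddrMatrix m r → AddrMatrix r n →
    Prog k (AddrMatrix m n)

namespace Subroutines

/-- The routines meet their specifications over the field `F`. -/
structure CorrectOver {k : Type u} [Field k] (S : Subroutines k) (F : Type u) [Field F]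
    [Algebra k F] : Prop where
  pluq_spec : ∀ (m n : ℕ) (A : AddrMatrix m n) (μ : List F), A.Valid μ →
    ((S.pluq m n A).val μ).Decomposes ((S.pluq m n A).mem μ) (A.load μ)
  lowerSolve_spec : ∀ (r n : ℕ) (L : AddrMatrix r r) (B : AddrMatrix r n) (μ : List F),
    L.Valid μ → B.Valid μ →
    (∀ i, L.load μ i i = 1) → (∀ i j, i < j → L.load μ i j = 0) →
      ((S.lowerSolve r n L B).val μ).Valid ((S.lowerSolve r n L B).mem μ) ∧
      ((S.lowerSolve r n L B).val μ).load ((S.lowerSolve r n L B).mem μ) =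
        (L.load μ)⁻¹ * B.load μ
  upperSolve_spec : ∀ (m r : ℕ) (C : AddrMatrix m r) (U : AddrMatrix r r) (μ : List F),
    C.Valid μ → U.Valid μ →
    (∀ i, U.load μ i i ≠ 0) → (∀ i j, j < i → U.load μ i j = 0) →
      ((S.upperSolve m r C U).val μ).Valid ((S.upperSolve m r C U).mem μ) ∧
      ((S.upperSolve m r C U).val μ).load ((S.upperSolve m r C U).mem μ) =
        C.load μ * (U.load μ)⁻¹
  subMul_spec : ∀ (m r n : ℕ) (B : AddrMatrix m n) (X : AddrMatrix m r) (Y : AddrMatrix r n)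
    (μ : List F), B.Valid μ → X.Valid μ → Y.Valid μ →
      ((S.subMul m r n B X Y).val μ).Valid ((S.subMul m r n B X Y).mem μ) ∧
      ((S.subMul m r n B X Y).val μ).load ((S.subMul m r n B X Y).mem μ) =
        B.load μ - X.load μ * Y.load μ

/-- The routines run over `F` within the costs of fast rank-sensitive elimination, with constant
`c`: `m n r^(ω-2)` for the PLUQ decomposition of an `m × n` matrix of rank `r` (read as `m n` if
`r = 0`, since the zero tests are counted), and the corresponding costs for triangular solving and
for the product. -/
structure CostOver {k : Type u} [Field k] (S : Subroutines k) (F : Type u) [Field F]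
    [Algebra k F] (ω c : ℝ) : Prop where
  pluq_cost : ∀ (m n : ℕ) (A : AddrMatrix m n) (μ : List F), A.Valid μ →
    ((S.pluq m n A).cost μ : ℝ) ≤
      c * m * n * (max 1 ((A.load μ).rank : ℝ)) ^ (ω - 2)
  lowerSolve_cost : ∀ (r n : ℕ) (L : AddrMatrix r r) (B : AddrMatrix r n) (μ : List F),
    L.Valid μ → B.Valid μ →
    (∀ i, L.load μ i i = 1) → (∀ i j, i < j → L.load μ i j = 0) →
      ((S.lowerSolve r n L B).cost μ : ℝ) ≤ c * max (r : ℝ) n * (r : ℝ) ^ (ω - 1)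
  upperSolve_cost : ∀ (m r : ℕ) (C : AddrMatrix m r) (U : AddrMatrix r r) (μ : List F),
    C.Valid μ → U.Valid μ →
    (∀ i, U.load μ i i ≠ 0) → (∀ i j, j < i → U.load μ i j = 0) →
      ((S.upperSolve m r C U).cost μ : ℝ) ≤ c * max (r : ℝ) m * (r : ℝ) ^ (ω - 1)
  subMul_cost : ∀ (m r n : ℕ) (B : AddrMatrix m n) (X : AddrMatrix m r) (Y : AddrMatrix r n)
    (μ : List F), B.Valid μ → X.Valid μ → Y.Valid μ →
      ((S.subMul m r n B X Y).cost μ : ℝ) ≤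
        c * (m + r) * (n + r) * (max 1 (r : ℝ)) ^ (ω - 2)

end Subroutines

/-! ## Algorithm LT-RPM -/

/-- Algorithm LT-RPM.  The matrix is split into `[A₁ A₂; A₃ *]` with `A₃` of size
`⌊n/2⌋ × ⌊n/2⌋`; `A₁` is decomposed, the other two blocks are updated, and the algorithm calls
itself on `H` and `I`.  The 0-1 matrix that it computes is returned in compact form. -/
def ltRPM {k : Type u} [Field k] (S : Subroutines k) (n : ℕ) (A : AddrMatrix n n) :
    Prog k (List (ℕ × ℕ)) :=
  if hn : n ≤ 1 then pure []
  else do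
    let A₁ : AddrMatrix (n - n / 2) (n / 2) :=
      fun i j => A ⟨i.1, by omega⟩ ⟨j.1, by omega⟩
    let A₂ : AddrMatrix (n - n / 2) (n - n / 2) :=
      fun i j => A ⟨i.1, by omega⟩ ⟨n / 2 + j.1, by omega⟩
    let A₃ : AddrMatrix (n / 2) (n / 2) :=
      fun i j => A ⟨(n - n / 2) + i.1, by omega⟩ ⟨j.1, by omega⟩
    let f ← S.pluq (n - n / 2) (n / 2) A₁
    have hr := f.r_le_rows
    have hc := f.r_le_cols
    let L₁ : AddrMatrix f.r f.r := fun i j => f.L ⟨i.1, by omega⟩ j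
    let M₁ : AddrMatrix (n - n / 2 - f.r) f.r := fun i j => f.L ⟨f.r + i.1, by omega⟩ j
    let U₁ : AddrMatrix f.r f.r := fun i j => f.U i ⟨j.1, by omega⟩
    let V₁ : AddrMatrix f.r (n / 2 - f.r) := fun i j => f.U i ⟨f.r + j.1, by omega⟩
    let R₁ : List (ℕ × ℕ) := List.ofFn fun t : Fin f.r =>
      ((f.P.symm ⟨t.1, by omega⟩).1, (f.Q ⟨t.1, by omega⟩).1)
    -- `[B₁; B₂] = P₁ᵀ A₂` and `[C₁ C₂] = A₃ Q₁ᵀ`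
    let B₁ : AddrMatrix f.r (n - n / 2) := fun t j => A₂ (f.P.symm ⟨t.1, by omega⟩) j
    let B₂ : AddrMatrix (n - n / 2 - f.r) (n - n / 2) :=
      fun t j => A₂ (f.P.symm ⟨f.r + t.1, by omega⟩) j
    let C₁ : AddrMatrix (n / 2) f.r := fun i t => A₃ i (f.Q ⟨t.1, by omega⟩)
    let C₂ : AddrMatrix (n / 2) (n / 2 - f.r) := fun i t => A₃ i (f.Q ⟨f.r + t.1, by omega⟩)
    let D ← S.lowerSolve f.r (n - n / 2) L₁ B₁
    let E ← S.upperSolve (n / 2) f.r C₁ U₁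
    let F ← S.subMul (n - n / 2 - f.r) f.r (n - n / 2) B₂ M₁ D
    let G ← S.subMul (n / 2) f.r (n / 2 - f.r) C₂ E V₁
    let z ← Prog.const 0
    -- `H = P₁ [0; F]` and `I = [0 G] Q₁`
    let H : AddrMatrix (n - n / 2) (n - n / 2) := fun i j =>
      if h : f.r ≤ (f.P i).1 then F ⟨(f.P i).1 - f.r, by omega⟩ j else z
    let I : AddrMatrix (n / 2) (n / 2) := fun i j =>
      if h : f.r ≤ (f.Q.symm j).1 then G i ⟨(f.Q.symm j).1 - f.r, by omega⟩ else z
    let R₂ ← ltRPM S (n - n / 2) H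
    let R₃ ← ltRPM S (n / 2) I
    pure (R₁ ++ R₂.map (fun p => (p.1, n / 2 + p.2)) ++
      R₃.map (fun p => ((n - n / 2) + p.1, p.2)))
termination_by n
decreasing_by all_goals omega

/-! ## Algorithm QS-order -/

/-- The state of the scan: the two Boolean arrays, the two counters, and the number of
elementary steps made so far. -/
structure ScanState where
  rows : ℕ → Bool
  cols : ℕ → Bool
  s : ℤ
  r : ℤ
  steps : ℕ

/-- Initialization: two arrays of length `n` and two counters. -/
def scanInit (n : ℕ) : ScanState :=
  { rows := fun _ => false, cols := fun _ => false, s := 0, r := 0, steps := 2 * n + 2 }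

/-- Body of the first loop, for the pivot `p`: two assignments. -/
def scanMark (st : ScanState) (p : ℕ × ℕ) : ScanState :=
  { st with
    rows := Function.update st.rows p.1 true
    cols := Function.update st.cols p.2 true
    steps := st.steps + 2 }

/-- Body of the second loop, for the row `i` (numbered from `0`): two tests, at most two updates
of `r`, one update of `s`. -/
def scanStep (n : ℕ) (st : ScanState) (i : ℕ) : ScanState :=
  let r₁ := if st.rows i then st.r + 1 else st.r
  let r₂ := if st.cols (n - 1 - i) then r₁ - 1 else r₁
  { st with s := max st.s r₂, r := r₂, steps := st.steps + 5 }

/-- The scan of a list of pivots. -/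
def scan (n : ℕ) (l : List (ℕ × ℕ)) : ScanState :=
  (List.range (n - 1)).foldl (scanStep n) (l.foldl scanMark (scanInit n))

/-- Algorithm QS-order: LT-RPM followed by the scan.  Returns the computed order and the number of
steps of the scan. -/
def qsOrder {k : Type u} [Field k] (S : Subroutines k) (n : ℕ) (A : AddrMatrix n n) :
    Prog k (ℤ × ℕ) := do
  let l ← ltRPM S n A
  pure ((scan n l).s, (scan n l).steps)

/-! Everything rests on the leading ranks `lrk` of a matrix. A position is a pivot (`PivotAt`) when
the second difference of the leading ranks there is one. The ones of any rank profile matrix are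
exactly the pivots (`IsRankProfileMatrix.ne_zero_iff`), whence uniqueness; existence comes from the
specification of the PLUQ routine.

Correctness of LT-RPM. Let `A₁` be `m × d` with `m + d = n`. Since its decomposition reveals the
rank profile, every row of `A₁` is a combination of pivot rows that are not below it
(`exists_row_combination`). Elimination in `[A₁ A₂]` thus never brings in a row from further down,
and for all `a` and `b` the leading rank of `[A₁ A₂]` at `(a, d + b)` is that of `A₁` at `(a, d)`
plus that of `H` at `(a, b)` (`lrk_schur`, `lrk_eliminate`). The first summand does not depend on
`b` and drops out of second differences, so the pivots of `A` in the block of `A₂` are the pivots of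
`H`. The block `I` is the transposed case. The antidiagonal condition on positions of `A` restricts
to the same condition on `H` and on `I`.

Cost of LT-RPM. The same rank identity bounds the left orders of `H` and `I` by `s`, and `A₁` is one
of the blocks that define `s`, so `r₁ ≤ s`. One level therefore costs `O(n² max(1, s)^(ω-2))`. The
squares of the sizes of the two recursive calls add up to at most `2n²/3`, so the levels form a
geometric sum.

Subroutines. Products are cut into square blocks of the inner dimension and triangular systems are
halved. The PLUQ decomposition comes from a factorization `a = c * u` in echelon form, built by
halving the set of rows. Its pivots lie in distinct rows and columns, and leading ranks count them
(`lrk_of_echelon`), so moving them to the front gives a PLUQ decomposition that reveals the rank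
profile matrix. The costs contract by `(2/3)^(ω-2) < 1` at each level; for the elimination, where
the rank is split between the halves in an unknown way, this uses the concavity of `x^(ω-2)`
(`weighted_rpow_le`).

QS-order. The counter of the scan is the number of pivots in the current leading `p × (n - p)`
block, which is the rank of that block. Reversing rows or columns turns the off-diagonal blocks of
`M` into such leading blocks. -/

/-! ## Ranks of products and of block matrices -/

/-- A matrix whose columns have distinct leading rows acts injectively on vectors. -/
theorem mulVec_eq_zero_of_leading {F : Type u} [Field F] {ι τ : Type*} [LinearOrder ι] [Fintype τ]
    (C : Matrix ι τ F) (ρ : τ → ι) (hρ : Function.Injective ρ)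
    (h0 : ∀ i t, i < ρ t → C i t = 0) (h1 : ∀ t, C (ρ t) t ≠ 0) (x : τ → F)
    (hx : C.mulVec x = 0) : x = 0 := by
  classical
  by_contra hne
  obtain ⟨t₀, ht₀⟩ := Function.ne_iff.mp hne
  -- At the smallest leading row over the support of `x`, a single term of the product survives.
  obtain ⟨t, ht, hmin⟩ := Finset.exists_min_image (Finset.univ.filter fun t => x t ≠ 0) ρ
    ⟨t₀, by simpa using ht₀⟩
  have h := congrFun hx (ρ t)
  rw [Matrix.mulVec, dotProduct, Finset.sum_eq_single t] at h
  · exact (mul_ne_zero (h1 t) (by simpa using ht)) (by simpa using h)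
  · intro s _ hs
    by_cases hxs : x s = 0
    · rw [hxs, mul_zero]
    · rw [h0 _ _ (lt_of_le_of_ne (hmin s (by simpa using hxs)) fun h => hs (hρ h).symm), zero_mul]
  · simp

/-- An injective left factor preserves the rank of `U`, and injectivity of the transpose of `U` says
that `U` has full row rank. -/
theorem rank_mul_eq_card {F : Type u} [Field F] {ι κ τ : Type*} [Fintype ι] [Fintype κ]
    [Fintype τ] (C : Matrix ι τ F) (U : Matrix τ κ F) (hC : ∀ x, C.mulVec x = 0 → x = 0)
    (hU : ∀ x, U.transpose.mulVec x = 0 → x = 0) : (C * U).rank = Fintype.card τ := by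
  have hC' : Function.Injective C.mulVecLin :=
    (injective_iff_map_eq_zero C.mulVecLin).mpr fun x hx => hC x (by simpa using hx)
  have hU' : Function.Injective U.transpose.mulVecLin :=
    (injective_iff_map_eq_zero U.transpose.mulVecLin).mpr fun x hx => hU x hx
  have hUr : U.rank = Fintype.card τ := by
    rw [← Matrix.rank_transpose, Matrix.rank, LinearMap.finrank_range_of_inj hU',
      Module.finrank_fintype_fun_eq_card]
  rw [Matrix.rank, Matrix.mulVecLin_mul, LinearMap.range_comp,
    ← LinearEquiv.finrank_eq (Submodule.equivMapOfInjective _ hC' _)]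
  exact hUr

theorem rank_fromBlocks_one_zero_zero {F : Type u} [Field F] {τ ι κ : Type*} [Fintype τ]
    [DecidableEq τ] [Fintype ι] [Fintype κ] (h : Matrix ι κ F) :
    (Matrix.fromBlocks (1 : Matrix τ τ F) 0 0 h).rank = Fintype.card τ + h.rank := by
  have h1 := LinearMap.finrank_range_add_finrank_ker
    (Matrix.fromBlocks (1 : Matrix τ τ F) 0 0 h).mulVecLin
  have h2 := LinearMap.finrank_range_add_finrank_ker h.mulVecLin
  have e : LinearMap.ker (Matrix.fromBlocks (1 : Matrix τ τ F) 0 0 h).mulVecLin ≃ₗ[F]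
      LinearMap.ker h.mulVecLin :=
    { toFun := fun x => ⟨x.1 ∘ Sum.inr, by
        have hx := x.2
        rw [LinearMap.mem_ker, Matrix.mulVecLin_apply, Matrix.fromBlocks_mulVec] at hx
        rw [LinearMap.mem_ker, Matrix.mulVecLin_apply]
        funext i
        simpa using congrFun hx (Sum.inr i)⟩
      invFun := fun y => ⟨Sum.elim 0 y.1, by
        have hy := y.2
        rw [LinearMap.mem_ker, Matrix.mulVecLin_apply] at hy
        rw [LinearMap.mem_ker, Matrix.mulVecLin_apply, Matrix.fromBlocks_mulVec]
        funext i
        rcases i with i | i <;> simp [hy]⟩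
      map_add' := fun _ _ => rfl
      map_smul' := fun _ _ => rfl
      left_inv := fun x => by
        have hx := x.2
        rw [LinearMap.mem_ker, Matrix.mulVecLin_apply, Matrix.fromBlocks_mulVec] at hx
        apply Subtype.ext
        funext i
        rcases i with i | i
        · simpa using (congrFun hx (Sum.inl i)).symm
        · simp
      right_inv := fun y => Subtype.ext (by simp) }
  rw [LinearEquiv.finrank_eq e, Module.finrank_fintype_fun_eq_card, Fintype.card_sum] at h1
  rw [Module.finrank_fintype_fun_eq_card] at h2
  unfold Matrix.rank
  omega

/-- A right inverse `Y` of `A` clears both `A` and `B` by column operations, which leaves the block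
diagonal matrix with blocks `1` and `h`. -/
theorem rank_fromBlocks_of_linearIndependent {F : Type u} [Field F] {τ ν ι κ : Type*} [Fintype τ]
    [Fintype ν] [Fintype ι] [Fintype κ] (A : Matrix τ ν F) (B : Matrix τ κ F) (h : Matrix ι κ F)
    (hA : LinearIndependent F A.row) :
    (Matrix.fromBlocks A B 0 h).rank = Fintype.card τ + h.rank := by
  classical
  obtain ⟨Y, hY⟩ : ∃ Y : Matrix ν τ F, A * Y = 1 := by
    rw [← Matrix.mulVec_surjective_iff_exists_right_inverse]
    have hr : LinearMap.range A.mulVecLin = ⊤ := by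
      apply Submodule.eq_top_of_finrank_eq
      rw [Module.finrank_fintype_fun_eq_card]
      exact hA.rank_matrix
    exact LinearMap.range_eq_top.mp hr
  rw [← rank_fromBlocks_one_zero_zero]
  apply le_antisymm
  · have : Matrix.fromBlocks A B 0 h =
        Matrix.fromBlocks (1 : Matrix τ τ F) 0 0 h *
          Matrix.fromBlocks A B (0 : Matrix κ ν F) (1 : Matrix κ κ F) := by
      rw [Matrix.fromBlocks_multiply]
      simp
    rw [this]
    exact Matrix.rank_mul_le_left _ _
  · have : Matrix.fromBlocks (1 : Matrix τ τ F) 0 0 h =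
        Matrix.fromBlocks A B 0 h *
          Matrix.fromBlocks Y (-(Y * B)) (0 : Matrix κ τ F) (1 : Matrix κ κ F) := by
      rw [Matrix.fromBlocks_multiply]
      simp [hY, ← Matrix.mul_assoc]
    rw [this]
    exact Matrix.rank_mul_le_left _ _

/-! ## Leading ranks of doubly indexed families -/

/-- The rank of the leading `a × b` block of a doubly infinite array. -/
noncomputable def lrk {F : Type u} [Field F] (f : ℕ → ℕ → F) (a b : ℕ) : ℕ :=
  (Matrix.of fun (i : Fin a) (j : Fin b) => f i j).rank

section lrk

variable {F : Type u} [Field F]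

theorem lrk_congr {f g : ℕ → ℕ → F} {a b : ℕ} (h : ∀ i < a, ∀ j < b, f i j = g i j) :
    lrk f a b = lrk g a b := by
  unfold lrk
  congr 1
  ext i j
  exact h i i.2 j j.2

theorem lrk_swap (f : ℕ → ℕ → F) (a b : ℕ) : lrk (fun i j => f j i) a b = lrk f b a := by
  unfold lrk
  rw [← Matrix.rank_transpose]
  rfl

/-- Leading ranks of a product in echelon form: the pivots in the leading block are counted. -/
theorem lrk_of_echelon {τ : Type*} [Fintype τ] {f : ℕ → ℕ → F} {m n : ℕ}
    (c : ℕ → τ → F) (u : τ → ℕ → F) (ρ γ : τ → ℕ) (hρ : Function.Injective ρ)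
    (hγ : Function.Injective γ) (c0 : ∀ i t, i < ρ t → c i t = 0) (c1 : ∀ t, c (ρ t) t ≠ 0)
    (u0 : ∀ t j, j < γ t → u t j = 0) (u1 : ∀ t, u t (γ t) ≠ 0)
    (hf : ∀ i < m, ∀ j < n, f i j = ∑ t, c i t * u t j) (a b : ℕ) (ha : a ≤ m) (hb : b ≤ n) :
    lrk f a b = Nat.card {t // ρ t < a ∧ γ t < b} := by
  classical
  -- The terms with `a ≤ ρ t` or `b ≤ γ t` vanish on the leading block. The inner dimension of what
  -- remains is the number of pivots inside the block, and both remaining factors have full rank.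
  have : (Matrix.of fun (i : Fin a) (j : Fin b) => f i j) =
      (Matrix.of fun (i : Fin a) (t : {t // ρ t < a ∧ γ t < b}) => c i t.1) *
      (Matrix.of fun (t : {t // ρ t < a ∧ γ t < b}) (j : Fin b) => u t.1 j) := by
    ext i j
    rw [Matrix.of_apply, hf i (by omega) j (by omega), Matrix.mul_apply]
    simp only [Matrix.of_apply]
    rw [← Finset.sum_subtype (Finset.univ.filter fun t => ρ t < a ∧ γ t < b) (by simp)
      (fun t => c i t * u t j), Finset.sum_filter_of_ne]
    intro t _ ht
    by_contra hlt
    rw [not_and_or, not_lt, not_lt] at hlt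
    rcases hlt with hlt | hlt
    · exact ht (by rw [c0 _ _ (by omega), zero_mul])
    · exact ht (by rw [u0 _ _ (by omega), mul_zero])
  rw [lrk, this, rank_mul_eq_card, Nat.card_eq_fintype_card]
  · exact mulVec_eq_zero_of_leading (Matrix.of fun (i : Fin a)
        (t : {t // ρ t < a ∧ γ t < b}) => c i t.1) (fun t => (⟨ρ t.1, t.2.1⟩ : Fin a))
      (fun s t h => Subtype.ext (hρ (by simpa using h))) (fun i t h => c0 _ _ h)
      (fun t => c1 _)
  · exact mulVec_eq_zero_of_leading (Matrix.of fun (t : {t // ρ t < a ∧ γ t < b})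
        (j : Fin b) => u t.1 j).transpose (fun t => (⟨γ t.1, t.2.2⟩ : Fin b))
      (fun s t h => Subtype.ext (hγ (by simpa using h))) (fun i t h => u0 _ _ h)
      (fun t => u1 _)

end lrk

/-! ### Row spans, Schur complements and pivots. -/

section lrk

variable {F : Type u} [Field F]

theorem lrk_eq_finrank_span (f : ℕ → ℕ → F) (a n : ℕ) :
    lrk f a n = Module.finrank F
      (Submodule.span F ((fun i (j : Fin n) => f i j) '' {i | i < a})) := by
  rw [lrk, Matrix.rank_eq_finrank_span_row]
  have : Set.range (Matrix.of fun (i : Fin a) (j : Fin n) => f i j).row =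
      (fun i (j : Fin n) => f i j) '' {i | i < a} := ?_
  · rw [this]
  ext x
  constructor
  · rintro ⟨i, rfl⟩
    exact ⟨i, i.2, rfl⟩
  · rintro ⟨i, hi, rfl⟩
    exact ⟨⟨i, hi⟩, rfl⟩

/-- If the rank of the leading rows only grows at `r` rows, `r` being the full rank, then these
rows are linearly independent and every row is a combination of those above it. -/
theorem exists_row_combination {f : ℕ → ℕ → F} {m n r : ℕ} (ρ : Fin r → ℕ) (hρ : ∀ t, ρ t < m)
    (hr : lrk f m n = r) (hf : ∀ i < m, (∀ t, ρ t ≠ i) → lrk f (i + 1) n = lrk f i n) :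
    LinearIndependent F (fun (t : Fin r) (j : Fin n) => f (ρ t) j) ∧
    ∀ i < m, ∃ w : Fin r → F, (∀ t, i < ρ t → w t = 0) ∧
      ∀ j < n, f i j = ∑ t, w t * f (ρ t) j := by
  set row : ℕ → Fin n → F := fun i j => f i j with hrow
  -- The first `a` rows are already spanned by the pivot rows among them. Keeping track of `a` is
  -- what later gives coefficients supported on pivot rows that are not below the given row.
  have hV : ∀ a ≤ m, Submodule.span F (row '' {i | i < a}) ≤
      Submodule.span F ((fun t => row (ρ t)) '' {t | ρ t < a}) := by
    intro a
    induction a with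
    | zero => intro _; simp
    | succ a ih =>
      intro ha
      have hWW : Submodule.span F ((fun t => row (ρ t)) '' {t | ρ t < a}) ≤
          Submodule.span F ((fun t => row (ρ t)) '' {t | ρ t < a + 1}) :=
        Submodule.span_mono (Set.image_mono fun t (ht : ρ t < a) => Nat.lt_succ_of_lt ht)
      have hins : row '' {i | i < a + 1} = insert (row a) (row '' {i | i < a}) := by
        rw [← Set.image_insert_eq]
        congr 1
        ext i
        simp only [Set.mem_ofPred_eq, Set.mem_insert_iff]
        omega
      rw [hins, Submodule.span_insert, sup_le_iff]
      refine ⟨?_, (ih (by omega)).trans hWW⟩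
      rw [Submodule.span_singleton_le_iff_mem]
      by_cases hex : ∃ t, ρ t = a
      · obtain ⟨t, rfl⟩ := hex
        exact Submodule.subset_span ⟨t, Nat.lt_succ_self _, rfl⟩
      · have h := hf a (by omega) (fun t ht => hex ⟨t, ht⟩)
        rw [lrk_eq_finrank_span, lrk_eq_finrank_span] at h
        -- The rank does not grow at row `a`, so neither does the span, and row `a` lies in the span
        -- of the rows before it.
        have heq : Submodule.span F (row '' {i | i < a}) =
            Submodule.span F (row '' {i | i < a + 1}) :=
          Submodule.eq_of_le_of_finrank_eq (Submodule.span_mono (Set.image_mono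
            fun i (hi : i < a) => Nat.lt_succ_of_lt hi)) h.symm
        apply (ih (by omega)).trans hWW
        rw [heq]
        exact Submodule.subset_span ⟨a, Nat.lt_succ_self _, rfl⟩
  constructor
  · have hspan : Submodule.span F (row '' {i | i < m}) =
        Submodule.span F (Set.range fun t => row (ρ t)) := by
      apply le_antisymm
      · exact (hV m le_rfl).trans (Submodule.span_mono (Set.image_subset_range _ _))
      · exact Submodule.span_mono (by rintro _ ⟨t, rfl⟩; exact ⟨ρ t, hρ t, rfl⟩)
    rw [linearIndependent_iff_card_eq_finrank_span, Fintype.card_fin, Set.finrank]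
    exact hr.symm.trans ((lrk_eq_finrank_span f m n).trans (by rw [hspan]))
  · intro i hi
    have hmem := hV (i + 1) hi (Submodule.subset_span ⟨i, Nat.lt_succ_self i, rfl⟩)
    obtain ⟨l, hl, hlx⟩ := (Finsupp.mem_span_image_iff_linearCombination F).mp hmem
    refine ⟨l, fun t ht => ?_, fun j hj => ?_⟩
    · by_contra hne
      have := hl (Finsupp.mem_support_iff.mpr hne)
      simp only [Set.mem_ofPred_eq] at this
      omega
    · have h := congrFun hlx ⟨j, hj⟩
      rw [Finsupp.linearCombination_apply, Finsupp.sum_fintype _ _ (by simp)] at h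
      simpa [hrow] using h.symm

/-- Elimination of independent rows: the rank of `[A₁ A₂]` is that of `A₁` plus that of the
Schur complement, for all leading blocks at once. -/
theorem lrk_schur {f h : ℕ → ℕ → F} {d r a b : ℕ} (ρ : Fin r → ℕ) (c : ℕ → Fin r → F)
    (hli : LinearIndependent F (fun (t : Fin r) (j : Fin d) => f (ρ t) j))
    (hc : ∀ i < a, ∀ t, i < ρ t → c i t = 0)
    (h1 : ∀ i < a, ∀ j < d, f i j = ∑ t, c i t * f (ρ t) j)
    (h2 : ∀ i < a, ∀ j < b, f i (d + j) = ∑ t, c i t * f (ρ t) (d + j) + h i j) :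
    lrk f a (d + b) = Nat.card {t // ρ t < a} + lrk h a b := by
  classical
  let M : Matrix (Fin a) (Fin d ⊕ Fin b) F :=
    Matrix.of fun i j => f i (Sum.elim (fun j : Fin d => (j : ℕ)) (fun j : Fin b => d + j) j)
  let g : {t // ρ t < a} → Fin a := fun t => ⟨ρ t.1, t.2⟩
  let C : Matrix (Fin a) {t // ρ t < a} F := Matrix.of fun i t => c i t.1
  have hM : lrk f a (d + b) = M.rank := by
    rw [lrk, ← Matrix.rank_submatrix _ (Equiv.refl _) (finSumFinEquiv (m := d) (n := b))]
    congr 1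
    ext i j
    rcases j with j | j <;> simp [M]
  -- The condition `hc` makes the first `a` rows depend only on pivot rows among them, so the
  -- elimination takes place inside the leading block.
  have hsum : ∀ i < a, ∀ j, ∑ t, c i t * f (ρ t) j =
      ∑ t : {t // ρ t < a}, c i t.1 * f (ρ t.1) j := by
    intro i hi j
    rw [← Finset.sum_subtype (Finset.univ.filter fun t => ρ t < a) (by simp)
      (fun t => c i t * f (ρ t) j), Finset.sum_filter_of_ne]
    intro t _ ht
    by_contra hlt
    exact ht (by rw [hc i hi t (by omega), zero_mul])
  have hblocks : Matrix.fromRows (M.submatrix g id) (M - C * M.submatrix g id) =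
      Matrix.fromBlocks (Matrix.of fun (t : {t // ρ t < a}) (j : Fin d) => f (ρ t.1) j)
        (Matrix.of fun (t : {t // ρ t < a}) (j : Fin b) => f (ρ t.1) (d + j)) 0
        (Matrix.of fun (i : Fin a) (j : Fin b) => h i j) := by
    ext i j
    rcases i with i | i <;> rcases j with j | j
    · simp [M, g]
    · simp [M, g]
    · simp only [Matrix.fromRows_apply_inr, Matrix.sub_apply, Matrix.mul_apply, M, g, C,
        Matrix.of_apply, Matrix.submatrix_apply, id, Sum.elim_inl, Matrix.fromBlocks_apply₂₁,
        Matrix.zero_apply]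
      rw [← hsum i i.2, ← h1 i i.2 j j.2, sub_self]
    · simp only [Matrix.fromRows_apply_inr, Matrix.sub_apply, Matrix.mul_apply, M, g, C,
        Matrix.of_apply, Matrix.submatrix_apply, id, Sum.elim_inr, Matrix.fromBlocks_apply₂₂]
      rw [← hsum i i.2, h2 i i.2 j j.2, add_sub_cancel_left]
  have hS : (1 : Matrix (Fin a) (Fin a) F).submatrix g id * M = M.submatrix g id :=
    Matrix.one_submatrix_mul g (Equiv.refl (Fin a)) M
  -- Stacking the pivot rows on the reduced rows is reversible by left multiplications, in both
  -- directions, so the rank is unchanged although rows have been added.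
  have hle : M.rank ≤ (Matrix.fromRows (M.submatrix g id) (M - C * M.submatrix g id)).rank := by
    have : M = Matrix.fromCols C (1 : Matrix (Fin a) (Fin a) F) *
        Matrix.fromRows (M.submatrix g id) (M - C * M.submatrix g id) := by
      rw [Matrix.fromCols_mul_fromRows, Matrix.one_mul, add_sub_cancel]
    conv_lhs => rw [this]
    exact Matrix.rank_mul_le_right _ _
  have hge : (Matrix.fromRows (M.submatrix g id) (M - C * M.submatrix g id)).rank ≤ M.rank := by
    have : Matrix.fromRows (M.submatrix g id) (M - C * M.submatrix g id) =
        Matrix.fromRows ((1 : Matrix (Fin a) (Fin a) F).submatrix g id)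
          (1 - C * (1 : Matrix (Fin a) (Fin a) F).submatrix g id) * M := by
      rw [Matrix.fromRows_mul, Matrix.sub_mul, Matrix.one_mul, Matrix.mul_assoc, hS]
    rw [this]
    exact Matrix.rank_mul_le_right _ _
  rw [hM, le_antisymm hle hge, hblocks, rank_fromBlocks_of_linearIndependent,
    Nat.card_eq_fintype_card, lrk]
  exact hli.comp (fun t : {t // ρ t < a} => t.1) Subtype.val_injective

theorem lrk_zero_right (f : ℕ → ℕ → F) (a : ℕ) : lrk f a 0 = 0 :=
  Nat.le_zero.mp (Matrix.rank_le_width _)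

/-! ## Pivots -/

/-- The position `(i, j)` is a pivot: the second difference of the leading ranks is one. -/
def PivotAt (f : ℕ → ℕ → F) (i j : ℕ) : Prop :=
  lrk f (i + 1) (j + 1) + lrk f i j = lrk f i (j + 1) + lrk f (i + 1) j + 1

theorem pivotAt_swap {f : ℕ → ℕ → F} {i j : ℕ} :
    PivotAt (fun i j => f j i) i j ↔ PivotAt f j i := by
  unfold PivotAt
  simp only [lrk_swap]
  omega

/-- The second difference of a counting function counts the points exactly at `(i, j)`, and
injectivity of `ρ` allows at most one. -/
theorem pivotAt_iff_of_card {τ : Type*} [Fintype τ] {f : ℕ → ℕ → F} {m n : ℕ} (ρ γ : τ → ℕ)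
    (hρ : Function.Injective ρ)
    (hf : ∀ a ≤ m, ∀ b ≤ n, lrk f a b = Nat.card {t // ρ t < a ∧ γ t < b}) {i j : ℕ} (hi : i < m)
    (hj : j < n) : PivotAt f i j ↔ ∃ t, ρ t = i ∧ γ t = j := by
  classical
  have hN : ∀ a ≤ m, ∀ b ≤ n, lrk f a b = ∑ t, if ρ t < a ∧ γ t < b then 1 else 0 := by
    intro a ha b hb
    rw [hf a ha b hb, Nat.card_eq_fintype_card, Fintype.card_subtype, Finset.card_filter]
  have hsum : lrk f (i + 1) (j + 1) + lrk f i j = lrk f i (j + 1) + lrk f (i + 1) j +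
      ∑ t, if ρ t = i ∧ γ t = j then 1 else 0 := by
    rw [hN _ hi _ hj, hN _ hi.le _ hj.le, hN _ hi.le _ hj, hN _ hi _ hj.le,
      ← Finset.sum_add_distrib, ← Finset.sum_add_distrib, ← Finset.sum_add_distrib]
    refine Finset.sum_congr rfl fun t _ => ?_
    split_ifs <;> omega
  unfold PivotAt
  rw [hsum]
  constructor
  · intro h
    by_contra hne
    rw [Finset.sum_eq_zero] at h
    · omega
    · exact fun t _ => if_neg fun ht => hne ⟨t, ht⟩
  · rintro ⟨t, ht⟩
    rw [Finset.sum_eq_single t, if_pos ht]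
    · intro s _ hs
      exact if_neg fun h => hs (hρ (h.1.trans ht.1.symm))
    · simp

/-! ## Leading ranks and rank profile matrices -/

/-- A matrix, extended by zero to a doubly infinite array. -/
def extendZero {m n : ℕ} (A : Matrix (Fin m) (Fin n) F) : ℕ → ℕ → F := fun i j =>
  if h : i < m ∧ j < n then A ⟨i, h.1⟩ ⟨j, h.2⟩ else 0

theorem extendZero_apply {m n : ℕ} (A : Matrix (Fin m) (Fin n) F) {i j : ℕ} (hi : i < m)
    (hj : j < n) : extendZero A i j = A ⟨i, hi⟩ ⟨j, hj⟩ := dif_pos ⟨hi, hj⟩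

theorem leadingRank_eq_lrk {m n : ℕ} (A : Matrix (Fin m) (Fin n) F) {a b : ℕ} (ha : a ≤ m)
    (hb : b ≤ n) : leadingRank A a b = lrk (extendZero A) a b := by
  let e : ∀ {p q : ℕ}, p ≤ q → Fin p ≃ {x : Fin q // x.1 < p} := fun {p q} h =>
    { toFun := fun i => ⟨⟨i.1, by omega⟩, i.2⟩
      invFun := fun x => ⟨x.1.1, x.2⟩
      left_inv := fun _ => rfl
      right_inv := fun _ => rfl }
  rw [leadingRank, lrk, ← Matrix.rank_submatrix _ (e ha) (e hb)]
  congr 1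
  ext i j
  exact (extendZero_apply A _ _).symm

theorem rank_eq_lrk {m n : ℕ} (A : Matrix (Fin m) (Fin n) F) :
    A.rank = lrk (extendZero A) m n := by
  rw [lrk]
  congr 1
  ext i j
  exact (extendZero_apply A i.2 j.2).symm

/-- `R` is in echelon form by itself: it is a sum of matrix units, one for each nonzero entry, in
distinct rows and columns. -/
theorem IsRankProfileMatrix.lrk_eq_card {m n : ℕ} {A R : Matrix (Fin m) (Fin n) F}
    (h : IsRankProfileMatrix A R) (a : ℕ) (ha : a ≤ m) (b : ℕ) (hb : b ≤ n) :
    lrk (extendZero A) a b = Nat.card {t : {p : Fin m × Fin n // R p.1 p.2 ≠ 0} //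
      t.1.1.1 < a ∧ t.1.2.1 < b} := by
  classical
  rw [← leadingRank_eq_lrk A ha hb, ← h.leading_eq a b ha hb, leadingRank_eq_lrk R ha hb]
  refine lrk_of_echelon (τ := {p : Fin m × Fin n // R p.1 p.2 ≠ 0}) (m := m) (n := n) (fun i t => if i = t.1.1.1 then 1 else 0)
    (fun t j => if j = t.1.2.1 then 1 else 0) (fun t => t.1.1.1) (fun t => t.1.2.1)
    ?_ ?_ ?_ ?_ ?_ ?_ ?_ a b ha hb
  · rintro ⟨⟨i, j⟩, ht⟩ ⟨⟨i', j'⟩, ht'⟩ heq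
    obtain rfl : i = i' := Fin.ext heq
    obtain rfl := h.distinct_cols i j j' ht ht'
    rfl
  · rintro ⟨⟨i, j⟩, ht⟩ ⟨⟨i', j'⟩, ht'⟩ heq
    obtain rfl : j = j' := Fin.ext heq
    obtain rfl := h.distinct_rows i i' j ht ht'
    rfl
  · exact fun i t hi => if_neg (by omega)
  · simp
  · exact fun t j hj => if_neg (by omega)
  · simp
  · intro i hi j hj
    rw [extendZero_apply R hi hj]
    by_cases hR : R ⟨i, hi⟩ ⟨j, hj⟩ = 0
    · rw [hR, Finset.sum_eq_zero]
      rintro ⟨⟨i', j'⟩, ht⟩ _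
      by_cases hi' : i = i'.1
      · by_cases hj' : j = j'.1
        · subst hi' hj'
          exact absurd hR ht
        · simp [hj']
      · simp [hi']
    · rw [Finset.sum_eq_single ⟨(⟨i, hi⟩, ⟨j, hj⟩), hR⟩]
      · simpa using (h.zero_or_one ⟨i, hi⟩ ⟨j, hj⟩).resolve_left hR
      · rintro ⟨⟨i', j'⟩, ht⟩ _ hne
        by_cases hi' : i = i'.1
        · subst hi'
          obtain rfl := h.distinct_cols _ _ _ hR ht
          exact absurd rfl hne
        · simp [hi']
      · simp

/-- The right-hand side mentions only leading ranks of `A`, so `R` is determined by `A`. -/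
theorem IsRankProfileMatrix.ne_zero_iff {m n : ℕ} {A R : Matrix (Fin m) (Fin n) F}
    (h : IsRankProfileMatrix A R) (i : Fin m) (j : Fin n) :
    R i j ≠ 0 ↔ PivotAt (extendZero A) i j := by
  classical
  rw [pivotAt_iff_of_card (τ := {p : Fin m × Fin n // R p.1 p.2 ≠ 0}) (fun t => t.1.1.1)
    (fun t => t.1.2.1) ?_ h.lrk_eq_card i.2 j.2]
  · constructor
    · exact fun hR => ⟨⟨(i, j), hR⟩, rfl, rfl⟩
    · rintro ⟨⟨⟨i', j'⟩, ht⟩, hi, hj⟩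
      obtain rfl := Fin.ext hi
      obtain rfl := Fin.ext hj
      exact ht
  · rintro ⟨⟨i, j⟩, ht⟩ ⟨⟨i', j'⟩, ht'⟩ heq
    obtain rfl : i = i' := Fin.ext heq
    obtain rfl := h.distinct_cols i j j' ht ht'
    rfl

open Classical in
theorem IsRankProfileMatrix.apply_eq {m n : ℕ} {A R : Matrix (Fin m) (Fin n) F}
    (h : IsRankProfileMatrix A R) (i : Fin m) (j : Fin n) :
    R i j = if PivotAt (extendZero A) i j then 1 else 0 := by
  split_ifs with hp
  · exact (h.zero_or_one i j).resolve_left ((h.ne_zero_iff i j).mpr hp)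
  · exact not_not.mp fun hR => hp ((h.ne_zero_iff i j).mp hR)

theorem IsRankProfileMatrix.unique {m n : ℕ} {A R R' : Matrix (Fin m) (Fin n) F}
    (h : IsRankProfileMatrix A R) (h' : IsRankProfileMatrix A R') : R' = R := by
  ext i j
  rw [h.apply_eq, h'.apply_eq]

end lrk

/-! ## Reasoning about programs -/

namespace Prog

theorem getElem?_of_prefix {F : Type u} {μ ν : List F} (h : μ <+: ν) {i : ℕ} {x : F}
    (hx : μ[i]? = some x) : ν[i]? = some x := by
  obtain ⟨τ, rfl⟩ := h
  rw [List.getElem?_append_left (List.getElem?_eq_some_iff.mp hx).1, hx]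

variable {k F : Type u} [Field k] [Field F] [Algebra k F] {α β : Type}

theorem exec_bind (p : Prog k α) (f : α → Prog k β) (μ : List F) :
    (p >>= f).exec μ = (f (p.val μ)).exec (p.mem μ) := by
  change (p.bind f).exec μ = _
  unfold val mem
  induction p generalizing μ with
  | ret a => rfl
  | lit c next ih => exact ih _ _
  | op o x y next ih => exact ih _ _
  | test x next ih => exact ih _ _

theorem cost_bind (p : Prog k α) (f : α → Prog k β) (μ : List F) :
    (p >>= f).cost μ = p.cost μ + (f (p.val μ)).cost (p.mem μ) := by
  change (p.bind f).cost μ = _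
  unfold val mem
  induction p generalizing μ with
  | ret a => exact (Nat.zero_add _).symm
  | lit c next ih => exact ih _ _
  | op o x y next ih =>
    simp only [bind, cost, exec]
    rw [ih]
    omega
  | test x next ih =>
    simp only [bind, cost, exec]
    rw [ih]
    omega

/-- Memory is only ever extended, so a stored matrix keeps its addresses and its value through all
later computations. -/
theorem prefix_mem (p : Prog k α) (μ : List F) : μ <+: p.mem μ := by
  unfold mem
  induction p generalizing μ with
  | ret a => exact List.prefix_rfl
  | lit c next ih => exact (List.prefix_append _ _).trans (ih _ _)
  | op o x y next ih => exact (List.prefix_append _ _).trans (ih _ _)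
  | test x next ih => exact ih _ _

/-- The outcome, the final memory and the cost of a run satisfy `Q`. -/
def Runs (p : Prog k α) (μ : List F) (Q : α → List F → ℕ → Prop) : Prop :=
  Q (p.val μ) (p.mem μ) (p.cost μ)

theorem Runs.mono {p : Prog k α} {μ : List F} {Q Q' : α → List F → ℕ → Prop} (h : p.Runs μ Q)
    (hQ : ∀ a ν c, μ <+: ν → Q a ν c → Q' a ν c) : p.Runs μ Q' :=
  hQ _ _ _ (p.prefix_mem μ) h

theorem runs_pure {a : α} {μ : List F} {Q : α → List F → ℕ → Prop} (h : Q a μ 0) :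
    (pure a : Prog k α).Runs μ Q := h

theorem Runs.bind {p : Prog k α} {f : α → Prog k β} {μ : List F} {Q : α → List F → ℕ → Prop}
    {Q' : β → List F → ℕ → Prop} (h : p.Runs μ Q)
    (hf : ∀ a ν c, μ <+: ν → Q a ν c → (f a).Runs ν fun b ν' c' => Q' b ν' (c + c')) :
    (p >>= f).Runs μ Q' := by
  have := hf _ _ _ (p.prefix_mem μ) h
  unfold Runs at this ⊢
  rw [cost_bind]
  unfold val mem at this ⊢
  rw [exec_bind]
  exact this

theorem runs_const (c : k) (μ : List F) :
    (const c).Runs μ fun a ν t => ν[a]? = some (algebraMap k F c) ∧ t = 0 :=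
  ⟨List.getElem?_concat_length, rfl⟩

theorem runs_op (o : FieldOp) {μ : List F} {x y : ℕ} {a b : F} (hx : μ[x]? = some a)
    (hy : μ[y]? = some b) :
    (op o x y pure : Prog k ℕ).Runs μ fun z ν t => ν[z]? = some (o.eval a b) ∧ t = 1 := by
  have : o.eval a b = o.eval (μ.getD x 0) (μ.getD y 0) := by
    rw [List.getD_eq_getElem?_getD, List.getD_eq_getElem?_getD, hx, hy]
    rfl
  rw [this]
  exact ⟨List.getElem?_concat_length, rfl⟩

/-- Run `p 0, …, p (n - 1)` and collect the results. -/
def forRange [Inhabited α] (p : ℕ → Prog k α) : ℕ → Prog k (ℕ → α)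
  | 0 => pure default
  | n + 1 => do
    let g ← forRange p n
    let x ← p n
    pure (Function.update g n x)

/-- Loop rule. Stability of `Q` under extension of the memory (`hQ`) carries the results of earlier
iterations through the later ones. -/
theorem runs_forRange [Inhabited α] {p : ℕ → Prog k α} {n : ℕ} {μ : List F} {b : ℝ}
    (Q : ℕ → α → List F → Prop) (hQ : ∀ i a μ ν, μ <+: ν → Q i a μ → Q i a ν)
    (hp : ∀ i < n, ∀ ν, μ <+: ν → (p i).Runs ν fun a ν' c => Q i a ν' ∧ (c : ℝ) ≤ b) :
    (forRange p n).Runs μ fun g ν c => (∀ i < n, Q i (g i) ν) ∧ (c : ℝ) ≤ n * b := by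
  induction n with
  | zero => exact runs_pure (by simp)
  | succ n ih =>
    refine (ih fun i hi => hp i (by omega)).bind fun g ν c hν hg => ?_
    refine (hp n (by omega) ν hν).bind fun x ν' c' hν' hx => runs_pure ⟨fun i hi => ?_, ?_⟩
    · by_cases hin : i = n
      · subst hin
        rw [Function.update_self]
        exact hx.1
      · rw [Function.update_of_ne hin]
        exact hQ _ _ _ _ hν' (hg.1 i (by omega))
    · push_cast
      linarith [hg.2, hx.2]

end Prog

/-- The cells with addresses `f i j`, for `i < m` and `j < n`, exist and hold `a i j`. -/
def Stores {F : Type u} (μ : List F) (m n : ℕ) (f : ℕ → ℕ → ℕ) (a : ℕ → ℕ → F) : Prop :=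
  ∀ i < m, ∀ j < n, μ[f i j]? = some (a i j)

theorem Stores.mono {F : Type u} {μ ν : List F} {m n : ℕ} {f : ℕ → ℕ → ℕ}
    {a : ℕ → ℕ → F} (h : Stores μ m n f a) (hν : μ <+: ν) : Stores ν m n f a :=
  fun i hi j hj => Prog.getElem?_of_prefix hν (h i hi j hj)

theorem AddrMatrix.getElem?_eq {F : Type u} [Field F] {m n : ℕ} {X : AddrMatrix m n}
    {μ : List F} (h : X.Valid μ) (i : Fin m) (j : Fin n) :
    μ[X i j]? = some (X.load μ i j) := by
  rw [List.getElem?_eq_getElem (h i j)]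
  simp [AddrMatrix.load, List.getD_eq_getElem?_getD, h i j]

/-- An equation with `some` records at once that a cell exists and what it holds, whereas `load`
silently reads missing cells as `0`. Facts about the memory are therefore propagated in the first
form. -/
theorem AddrMatrix.valid_of_getElem? {F : Type u} [Field F] {m n : ℕ} {X : AddrMatrix m n}
    {μ : List F} {A : Matrix (Fin m) (Fin n) F} (h : ∀ i j, μ[X i j]? = some (A i j)) :
    X.Valid μ ∧ X.load μ = A := by
  constructor
  · exact fun i j => (List.getElem?_eq_some_iff.mp (h i j)).1
  · ext i j
    simp [AddrMatrix.load, List.getD_eq_getElem?_getD, h i j]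

/-! ## Product and triangular systems from fast matrix multiplication -/

/-- A family of programs multiplying `n × n` matrices in at most `C * n ^ ω` operations. -/
def IsMatMul {k : Type u} [Field k] (ω C : ℝ)
    (mm : ∀ n : ℕ, AddrMatrix n n → AddrMatrix n n → Prog k (AddrMatrix n n)) : Prop :=
  ∀ (F : Type u) [Field F] [Algebra k F] (n : ℕ) (X Y : AddrMatrix n n) (μ : List F),
    X.Valid μ → Y.Valid μ →
      ((mm n X Y).val μ).Valid ((mm n X Y).mem μ) ∧
      ((mm n X Y).val μ).load ((mm n X Y).mem μ) = X.load μ * Y.load μ ∧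
      ((mm n X Y).cost μ : ℝ) ≤ C * (n : ℝ) ^ ω

section

variable {k : Type u} [Field k]
  (mm : ∀ n : ℕ, AddrMatrix n n → AddrMatrix n n → Prog k (AddrMatrix n n))

/-- `B - X * Y` for `X` of size `m × r` and `Y` of size `r × n`, by blocks of order `r`. -/
def blockSubMul (m r n : ℕ) (B X Y : ℕ → ℕ → ℕ) : Prog k (ℕ → ℕ → ℕ) :=
  if r = 0 then pure B
  else do
    let z ← Prog.const 0
    let T ← Prog.forRange (fun p => Prog.forRange (fun q => do
      -- The last blocks may stick out of `X` and `Y`; they are padded with the zero cell.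
      let T ← mm r (fun i j => if p * r + i.1 < m then X (p * r + i.1) j.1 else z)
        (fun i j => if q * r + j.1 < n then Y i.1 (q * r + j.1) else z)
      pure fun i j => if h : i < r ∧ j < r then T ⟨i, h.1⟩ ⟨j, h.2⟩ else z) (n / r + 1))
      (m / r + 1)
    Prog.forRange (fun i => Prog.forRange (fun j =>
      Prog.op .sub (B i j) (T (i / r) (j / r) (i % r) (j % r)) pure) n) m

/-- Forward substitution for `r` equations and `n` right-hand sides, by halving. -/
def triSolve (n r : ℕ) (L B : ℕ → ℕ → ℕ) : Prog k (ℕ → ℕ → ℕ) :=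
  if r = 0 then pure B
  else if r = 1 then do
    let X ← Prog.forRange (fun j => Prog.op .div (B 0 j) (L 0 0) pure) n
    pure fun _ => X
  else do
    let X₁ ← triSolve n (r / 2) L B
    let B' ← blockSubMul mm (r - r / 2) (r / 2) n (fun i j => B (r / 2 + i) j)
      (fun i j => L (r / 2 + i) j) X₁
    let X₂ ← triSolve n (r - r / 2) (fun i j => L (r / 2 + i) (r / 2 + j)) B'
    pure fun i j => if i < r / 2 then X₁ i j else X₂ (i - r / 2) j
termination_by r
decreasing_by all_goals omega

variable {mm} {ω C : ℝ} {F : Type u} [Field F] [Algebra k F]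

theorem IsMatMul.runs (h : IsMatMul ω C mm) {n : ℕ} {X Y : AddrMatrix n n}
    {x y : Matrix (Fin n) (Fin n) F} {μ : List F} (hX : ∀ i j, μ[X i j]? = some (x i j))
    (hY : ∀ i j, μ[Y i j]? = some (y i j)) :
    (mm n X Y).Runs μ fun Z ν c =>
      (∀ i j, ν[Z i j]? = some ((x * y) i j)) ∧ (c : ℝ) ≤ C * (n : ℝ) ^ ω := by
  obtain ⟨vX, lX⟩ := AddrMatrix.valid_of_getElem? hX
  obtain ⟨vY, lY⟩ := AddrMatrix.valid_of_getElem? hY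
  obtain ⟨v, l, c⟩ := h F n X Y μ vX vY
  rw [lX, lY] at l
  exact ⟨fun i j => by rw [AddrMatrix.getElem?_eq v, l], c⟩

theorem IsMatMul.nonneg (h : IsMatMul (k := k) ω C mm) : 0 ≤ C := by
  have := (h k 1 (fun _ _ => 0) (fun _ _ => 0) [0] (fun _ _ => by simp)
    (fun _ _ => by simp)).2.2
  simp only [Nat.cast_one, Real.one_rpow, mul_one] at this
  exact (Nat.cast_nonneg _).trans this

theorem natCast_div_succ_mul_le (m r : ℕ) : ((m / r + 1 : ℕ) : ℝ) * r ≤ m + r := by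
  have := Nat.div_mul_le_self m r
  push_cast
  have : ((m / r : ℕ) : ℝ) * r ≤ m := by exact_mod_cast this
  linarith

theorem runs_blockSubMul (h : IsMatMul ω C mm) (hω : 2 < ω) {m r n : ℕ} {B X Y : ℕ → ℕ → ℕ}
    {b x y : ℕ → ℕ → F} {μ : List F} (hB : Stores μ m n B b) (hX : Stores μ m r X x)
    (hY : Stores μ r n Y y) :
    (blockSubMul mm m r n B X Y).Runs μ fun D ν c =>
      Stores ν m n D (fun i j => b i j - ∑ t ∈ Finset.range r, x i t * y t j) ∧
      (c : ℝ) ≤ (C + 1) * (m + r) * (n + r) * (r : ℝ) ^ (ω - 2) := by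
  unfold blockSubMul
  split_ifs with hr
  · subst hr
    refine Prog.runs_pure ⟨by simpa using hB, ?_⟩
    rw [Nat.cast_zero, Real.zero_rpow (by linarith)]
    simp
  have hrpos : 0 < r := Nat.pos_of_ne_zero hr
  refine (Prog.runs_const 0 μ).bind fun z ν₀ c₀ hν₀ hz => ?_
  rw [map_zero] at hz
  refine (Prog.runs_forRange (b := ((n / r + 1 : ℕ) : ℝ) * (C * (r : ℝ) ^ ω))
    (fun p (T : ℕ → ℕ → ℕ → ℕ) ν => ∀ q < n / r + 1, ∀ i < r, ∀ j < r, p * r + i < m → q * r + j < n →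
      ν[T q i j]? = some (∑ t ∈ Finset.range r, x (p * r + i) t * y t (q * r + j)))
    (fun p T μ ν hν hT q hq i hi j hj h1 h2 =>
      Prog.getElem?_of_prefix hν (hT q hq i hi j hj h1 h2)) ?_).bind ?_
  · intro p hp ν hν
    refine Prog.runs_forRange (fun q (T : ℕ → ℕ → ℕ) ν => ∀ i < r, ∀ j < r, p * r + i < m → q * r + j < n →
      ν[T i j]? = some (∑ t ∈ Finset.range r, x (p * r + i) t * y t (q * r + j)))
      (fun q T μ ν hν hT i hi j hj h1 h2 => Prog.getElem?_of_prefix hν (hT i hi j hj h1 h2)) ?_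
    intro q hq ν' hν'
    refine (h.runs (x := Matrix.of fun (i j : Fin r) =>
      if p * r + i.1 < m then x (p * r + i.1) j.1 else 0) (y := Matrix.of fun (i j : Fin r) =>
      if q * r + j.1 < n then y i.1 (q * r + j.1) else 0) ?_ ?_).bind ?_
    · intro i j
      rw [Matrix.of_apply]
      split_ifs with hi
      · exact Prog.getElem?_of_prefix (hν₀.trans (hν.trans hν')) (hX _ hi _ j.2)
      · exact Prog.getElem?_of_prefix (hν.trans hν') hz.1
    · intro i j
      rw [Matrix.of_apply]
      split_ifs with hi
      · exact Prog.getElem?_of_prefix (hν₀.trans (hν.trans hν')) (hY _ i.2 _ hi)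
      · exact Prog.getElem?_of_prefix (hν.trans hν') hz.1
    · intro T ν'' c'' _ hT
      refine Prog.runs_pure ⟨fun i hi j hj h1 h2 => ?_, by simpa using hT.2⟩
      beta_reduce
      rw [dif_pos ⟨hi, hj⟩, hT.1, Matrix.mul_apply, Finset.sum_range]
      simp only [Matrix.of_apply, if_pos h1, if_pos h2]
  · intro T ν c hν hT
    refine (Prog.runs_forRange (b := (n : ℝ) * 1) (fun i (D : ℕ → ℕ) ν => ∀ j < n,
      ν[D j]? = some (b i j - ∑ t ∈ Finset.range r, x i t * y t j))
      (fun i D μ ν hν hD j hj => Prog.getElem?_of_prefix hν (hD j hj)) ?_).mono ?_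
    · intro i hi ν' hν'
      refine Prog.runs_forRange (fun j D ν =>
        ν[D]? = some (b i j - ∑ t ∈ Finset.range r, x i t * y t j))
        (fun j D μ ν hν hD => Prog.getElem?_of_prefix hν hD) ?_
      intro j hj ν'' hν''
      have hTij := hT.1 (i / r) (Nat.lt_succ_of_le (Nat.div_le_div_right hi.le)) (j / r)
        (Nat.lt_succ_of_le (Nat.div_le_div_right hj.le)) (i % r) (Nat.mod_lt _ hrpos) (j % r)
        (Nat.mod_lt _ hrpos) (by rwa [Nat.div_add_mod']) (by rwa [Nat.div_add_mod'])
      rw [Nat.div_add_mod', Nat.div_add_mod'] at hTij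
      refine (Prog.runs_op .sub (Prog.getElem?_of_prefix
        (((hν₀.trans hν).trans hν').trans hν'') (hB i hi j hj))
        (Prog.getElem?_of_prefix (hν'.trans hν'') hTij)).mono ?_
      rintro z ν''' c _ ⟨hz, rfl⟩
      exact ⟨hz, by simp⟩
    · rintro D ν' c' - ⟨hD, hc'⟩
      refine ⟨hD, ?_⟩
      have hr1 : (1 : ℝ) ≤ r := by exact_mod_cast hrpos
      have hpow : (r : ℝ) ^ ω = r * r * (r : ℝ) ^ (ω - 2) := by
        rw [Real.rpow_sub (by linarith), Real.rpow_two]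
        field_simp
      have hpow1 : (1 : ℝ) ≤ (r : ℝ) ^ (ω - 2) := Real.one_le_rpow hr1 (by linarith)
      have hC := h.nonneg
      have e1 := natCast_div_succ_mul_le m r
      have e2 := natCast_div_succ_mul_le n r
      -- Writing `r ^ ω` as `r * r * r ^ (ω - 2)` gives one factor `r` to each of the two block
      -- counts, which then become at most `m + r` and `n + r`.
      have hblocks : ((m / r + 1 : ℕ) : ℝ) * (((n / r + 1 : ℕ) : ℝ) * (C * (r : ℝ) ^ ω)) ≤
          C * ((m + r) * (n + r)) * (r : ℝ) ^ (ω - 2) := by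
        calc _ = C * ((((m / r + 1 : ℕ) : ℝ) * r) * (((n / r + 1 : ℕ) : ℝ) * r)) *
              (r : ℝ) ^ (ω - 2) := by rw [hpow]; ring
          _ ≤ _ := by gcongr
      -- The entrywise subtractions account for the `1` in `C + 1`.
      have hsub : (m : ℝ) * (n * 1) ≤ ((m + r) * (n + r)) * (r : ℝ) ^ (ω - 2) := by
        calc (m : ℝ) * (n * 1) ≤ ((m + r) * (n + r)) * 1 := by
              rw [mul_one, mul_one]
              gcongr <;> linarith
          _ ≤ _ := by gcongr
      have h0 : (c₀ : ℝ) = 0 := by rw [hz.2, Nat.cast_zero]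
      have hT2 := hT.2
      push_cast at hT2 hc' hblocks ⊢
      rw [h0]
      linarith

end

/-- Because of rounding, `1/2` is not enough for the larger part; `2/3` is attained at `r = 3`. -/
theorem natCast_half_le {r : ℕ} (hr : 2 ≤ r) :
    ((r / 2 : ℕ) : ℝ) ≤ 2 / 3 * r ∧ ((r - r / 2 : ℕ) : ℝ) ≤ 2 / 3 * r := by
  have h1 : 3 * (r / 2) ≤ 2 * r := by omega
  have h2 : 3 * (r - r / 2) ≤ 2 * r := by omega
  have h1' : 3 * ((r / 2 : ℕ) : ℝ) ≤ 2 * r := by exact_mod_cast h1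
  have h2' : 3 * ((r - r / 2 : ℕ) : ℝ) ≤ 2 * r := by exact_mod_cast h2
  constructor <;> linarith

theorem natCast_half_add (r : ℕ) : ((r / 2 : ℕ) : ℝ) + ((r - r / 2 : ℕ) : ℝ) = r := by
  have : r / 2 + (r - r / 2) = r := by omega
  exact_mod_cast this

/-- The strict inequality `2 < ω` makes the recursions contract: it is applied with `e = ω - 2`. -/
theorem two_thirds_rpow_lt_one {e : ℝ} (he : 0 < e) : (2 / 3 : ℝ) ^ e < 1 :=
  Real.rpow_lt_one (by norm_num) (by norm_num) he

theorem rpow_sub_one_eq_mul {x ω : ℝ} (hx : 0 ≤ x) (hω : 2 < ω) :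
    x ^ (ω - 1) = x * x ^ (ω - 2) := by
  have : ω - 1 = 1 + (ω - 2) := by ring
  rw [this, Real.rpow_one_add' hx (by linarith)]

/-- One level of the recursion: the blocks of order at most `2 r / 3` cost a fixed fraction. -/
theorem rpow_half_le {h r ω : ℝ} (hω : 2 < ω) (h0 : 0 ≤ h) (hr : h ≤ 2 / 3 * r) :
    h ^ (ω - 2) ≤ (2 / 3) ^ (ω - 2) * r ^ (ω - 2) := by
  rw [← Real.mul_rpow (by norm_num) (by linarith)]
  exact Real.rpow_le_rpow h0 hr (by linarith)

/-! ### Triangular systems: correctness and cost. -/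

section

variable {k : Type u} [Field k]
  {mm : ∀ n : ℕ, AddrMatrix n n → AddrMatrix n n → Prog k (AddrMatrix n n)}
  {ω C : ℝ} {F : Type u} [Field F] [Algebra k F]

/-- Put `δ = (2/3)^(ω-2)`. The orders of the two halves add up to `r` and their powers shrink by
`δ`, so the recursive calls use the fraction `δ` of the bound. The remaining part `K * (1 - δ)` pays
for the product, which is the meaning of `hK`; `1 ≤ K` pays for the divisions when `r = 1`. -/
theorem runs_triSolve (h : IsMatMul ω C mm) (hω : 2 < ω) {K : ℝ} (hK1 : 1 ≤ K)
    (hK : 2 * (C + 1) ≤ K * (1 - (2 / 3) ^ (ω - 2))) (n r : ℕ) {L B : ℕ → ℕ → ℕ}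
    {l b : ℕ → ℕ → F} {μ : List F} (hL : Stores μ r r L l) (hB : Stores μ r n B b)
    (hdiag : ∀ i < r, l i i ≠ 0) (hlow : ∀ i j, i < j → j < r → l i j = 0) :
    (triSolve mm n r L B).Runs μ fun X ν c =>
      ∃ x, Stores ν r n X x ∧
        (∀ i < r, ∀ j < n, ∑ t ∈ Finset.range r, l i t * x t j = b i j) ∧
        (c : ℝ) ≤ K * max (r : ℝ) n * (r : ℝ) ^ (ω - 1) := by
  induction r using Nat.strong_induction_on generalizing L B l b μ with
  | _ r ih =>
  rw [triSolve]
  split_ifs with h0 h1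
  · subst h0
    refine Prog.runs_pure ⟨b, hB, by simp, ?_⟩
    rw [Nat.cast_zero, Real.zero_rpow (by linarith)]
    simp
  · subst h1
    refine (Prog.runs_forRange (b := 1) (fun j (z : ℕ) ν => ν[z]? = some (b 0 j / l 0 0))
      (fun j z μ ν hν hz => Prog.getElem?_of_prefix hν hz) ?_).bind ?_
    · intro j hj ν hν
      refine (Prog.runs_op .div (Prog.getElem?_of_prefix hν (hB 0 one_pos j hj))
        (Prog.getElem?_of_prefix hν (hL 0 one_pos 0 one_pos))).mono ?_
      rintro z ν' c - ⟨hz, rfl⟩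
      exact ⟨hz, by simp⟩
    · intro X ν c hν hX
      refine Prog.runs_pure ⟨fun _ j => b 0 j / l 0 0, fun _ _ j hj => hX.1 j hj, ?_, ?_⟩
      · intro i hi j hj
        obtain rfl : i = 0 := by omega
        rw [Finset.sum_range_one, mul_div_cancel₀ _ (hdiag 0 one_pos)]
      · have hmax : (n : ℝ) ≤ max ((1 : ℕ) : ℝ) n := le_max_right _ _
        have hn : (0 : ℝ) ≤ n := Nat.cast_nonneg n
        have := hX.2
        rw [Nat.cast_one, Real.one_rpow, mul_one]
        push_cast at hmax this ⊢
        nlinarith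
  · have h2 : 2 ≤ r := by omega
    set p := r / 2 with hp
    have hpr : p < r := by omega
    have hqr : r - p < r := by omega
    refine (ih p hpr (fun i hi j hj => hL i (by omega) j (by omega))
      (fun i hi j hj => hB i (by omega) j hj) (fun i hi => hdiag i (by omega))
      (fun i j hij hj => hlow i j hij (by omega))).bind ?_
    rintro X₁ ν₁ c₁ hν₁ ⟨x₁, hX₁, hx₁, hc₁⟩
    refine (runs_blockSubMul h hω (m := r - p) (r := p) (n := n)
      (b := fun i j => b (p + i) j) (x := fun i j => l (p + i) j)
      (fun i hi j hj => (hB.mono hν₁) (p + i) (by omega) j hj)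
      (fun i hi j hj => (hL.mono hν₁) (p + i) (by omega) j (by omega)) hX₁).bind ?_
    rintro B' ν₂ c₂ hν₂ ⟨hB', hc₂⟩
    refine (ih (r - p) hqr (l := fun i j => l (p + i) (p + j))
      (fun i hi j hj => (hL.mono (hν₁.trans hν₂)) (p + i) (by omega) (p + j) (by omega))
      hB' (fun i hi => hdiag (p + i) (by omega))
      (fun i j hij hj => hlow (p + i) (p + j) (by omega) (by omega))).bind ?_
    rintro X₂ ν₃ c₃ hν₃ ⟨x₂, hX₂, hx₂, hc₃⟩
    refine Prog.runs_pure ⟨fun i j => if i < p then x₁ i j else x₂ (i - p) j, ?_, ?_, ?_⟩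
    · intro i hi j hj
      beta_reduce
      split_ifs with hip
      · exact hX₁.mono (hν₂.trans hν₃) i hip j hj
      · exact hX₂ (i - p) (by omega) j hj
    · intro i hi j hj
      have hsplit : ∀ i, ∑ t ∈ Finset.range r, l i t * (if t < p then x₁ t j else x₂ (t - p) j) =
          ∑ t ∈ Finset.range p, l i t * x₁ t j +
          ∑ t ∈ Finset.range (r - p), l i (p + t) * x₂ t j := by
        intro i
        conv_lhs => rw [show r = p + (r - p) by omega, Finset.sum_range_add]
        congr 1
        · exact Finset.sum_congr rfl fun t ht => by rw [if_pos (Finset.mem_range.mp ht)]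
        · exact Finset.sum_congr rfl fun t ht => by
            rw [if_neg (by omega), Nat.add_sub_cancel_left]
      rw [hsplit]
      by_cases hip : i < p
      · rw [hx₁ i hip j hj, Finset.sum_eq_zero, add_zero]
        intro t ht
        rw [hlow i (p + t) (by omega) (by have := Finset.mem_range.mp ht; omega), zero_mul]
      · have := hx₂ (i - p) (by omega) j hj
        simp only [show p + (i - p) = i by omega] at this
        rw [this]
        ring
    · have hp0 : (0 : ℝ) ≤ p := Nat.cast_nonneg p
      have hq0 : (0 : ℝ) ≤ ((r - p : ℕ) : ℝ) := Nat.cast_nonneg _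
      have hr0 : (0 : ℝ) ≤ r := Nat.cast_nonneg r
      have hn0 : (0 : ℝ) ≤ n := Nat.cast_nonneg n
      have hadd := natCast_half_add r
      obtain ⟨hp3, hq3⟩ := natCast_half_le h2
      rw [← hp] at hadd hp3 hq3
      rw [rpow_sub_one_eq_mul (Nat.cast_nonneg _) hω] at hc₁ hc₃ ⊢
      have e1 := rpow_half_le hω hp0 hp3
      have e2 := rpow_half_le hω hq0 hq3
      have hre : 0 ≤ (r : ℝ) ^ (ω - 2) := Real.rpow_nonneg hr0 _
      have hδ : 0 ≤ (2 / 3 : ℝ) ^ (ω - 2) := Real.rpow_nonneg (by norm_num) _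
      have hpe : (p : ℝ) ^ (ω - 2) ≤ (r : ℝ) ^ (ω - 2) :=
        Real.rpow_le_rpow hp0 (by linarith) (by linarith)
      set N := max (r : ℝ) n with hN
      have hrN : (r : ℝ) ≤ N := le_max_left _ _
      have hnN : (n : ℝ) ≤ N := le_max_right _ _
      have hC := h.nonneg
      generalize (r : ℝ) ^ (ω - 2) = R at *
      generalize (2 / 3 : ℝ) ^ (ω - 2) = δ at *
      have f1 : (c₁ : ℝ) ≤ K * N * (p * (δ * R)) := by
        refine hc₁.trans ?_
        gcongr
        exact max_le (by linarith) hnN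
      have f3 : (c₃ : ℝ) ≤ K * N * ((r - p : ℕ) * (δ * R)) := by
        refine hc₃.trans ?_
        gcongr
        exact max_le (by linarith) hnN
      have f2 : (c₂ : ℝ) ≤ (C + 1) * r * (2 * N) * R := by
        refine hc₂.trans ?_
        gcongr <;> linarith
      have hNR : 0 ≤ N * (r * R) := by positivity
      push_cast
      calc (c₁ : ℝ) + (c₂ + (c₃ + 0)) ≤ K * N * (p * (δ * R)) + ((C + 1) * r * (2 * N) * R +
            K * N * ((r - p : ℕ) * (δ * R))) := by linarith
        _ = K * N * ((p + (r - p : ℕ)) * (δ * R)) + 2 * (C + 1) * (N * (r * R)) := by ring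
        _ ≤ K * N * (r * (δ * R)) + K * (1 - δ) * (N * (r * R)) := by
            rw [hadd]
            gcongr
        _ = _ := by ring

end

/-! ## Elimination by halving the set of rows -/

/-- `a = c * u` (size `m × n`, inner dimension `r`) in echelon form: the `t`-th column of `c` starts
at the row `ρ t`, the `t`-th row of `u` starts at the column `γ t`, the rows `ρ t` increase, and
each row of `u` vanishes at the earlier pivot columns. -/
structure IsEchelon {F : Type u} [Field F] (a : ℕ → ℕ → F) (m n r : ℕ) (ρ γ : ℕ → ℕ)
    (c u : ℕ → ℕ → F) : Prop where
  row_lt : ∀ t < r, ρ t < m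
  col_lt : ∀ t < r, γ t < n
  row_mono : ∀ s t, s < t → t < r → ρ s < ρ t
  c_one : ∀ t < r, c (ρ t) t = 1
  c_zero : ∀ t < r, ∀ i < ρ t, c i t = 0
  u_ne : ∀ t < r, u t (γ t) ≠ 0
  u_zero : ∀ t < r, ∀ j < γ t, u t j = 0
  u_pivot : ∀ s t, s < t → t < r → u t (γ s) = 0
  eq_sum : ∀ i < m, ∀ j < n, a i j = ∑ t ∈ Finset.range r, c i t * u t j

/-- The list `f 0, …, f (p - 1), g 0, g 1, …`. -/
def glue {α : Type*} (p : ℕ) (f g : ℕ → α) : ℕ → α := fun i => if i < p then f i else g (i - p)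

theorem glue_of_lt {α : Type*} {p : ℕ} {f g : ℕ → α} {i : ℕ} (h : i < p) : glue p f g i = f i :=
  if_pos h

theorem glue_add {α : Type*} {p : ℕ} {f g : ℕ → α} (i : ℕ) : glue p f g (p + i) = g i := by
  rw [glue, if_neg (by omega), Nat.add_sub_cancel_left]

theorem forall_lt_add {p q : ℕ} {P : ℕ → Prop} (h1 : ∀ i < p, P i) (h2 : ∀ i < q, P (p + i)) :
    ∀ i < p + q, P i := by
  intro i hi
  by_cases hip : i < p
  · exact h1 i hip
  · have := h2 (i - p) (by omega)
    rwa [show p + (i - p) = i by omega] at this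

namespace IsEchelon

variable {F : Type u} [Field F] {a : ℕ → ℕ → F} {m n r : ℕ} {ρ γ : ℕ → ℕ} {c u : ℕ → ℕ → F}

theorem of_eq_zero (ha : ∀ i < m, ∀ j < n, a i j = 0) : IsEchelon a m n 0 ρ γ c u := by
  refine ⟨?_, ?_, ?_, ?_, ?_, ?_, ?_, ?_, fun i hi j hj => by simpa using ha i hi j hj⟩
  all_goals first
    | (intro t ht; exact absurd ht (Nat.not_lt_zero t))
    | (intro s t _ ht; exact absurd ht (Nat.not_lt_zero t))

theorem row_injOn (h : IsEchelon a m n r ρ γ c u) {s t : ℕ} (hs : s < r) (ht : t < r)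
    (hst : ρ s = ρ t) : s = t := by
  rcases lt_trichotomy s t with hlt | heq | hlt
  · exact absurd hst (h.row_mono s t hlt ht).ne
  · exact heq
  · exact absurd hst (h.row_mono t s hlt hs).ne'

/-- Unlike the `ρ t`, the `γ t` need not increase. They are distinct because a later row of `u`
vanishes at an earlier pivot column but not at its own. -/
theorem col_injOn (h : IsEchelon a m n r ρ γ c u) {s t : ℕ} (hs : s < r) (ht : t < r)
    (hst : γ s = γ t) : s = t := by
  rcases lt_trichotomy s t with hlt | heq | hlt
  · exact absurd (h.u_pivot s t hlt ht) (by rw [hst]; exact h.u_ne t ht)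
  · exact heq
  · exact absurd (h.u_pivot t s hlt hs) (by rw [← hst]; exact h.u_ne s hs)

theorem rank_le_rows (h : IsEchelon a m n r ρ γ c u) : r ≤ m := by
  have := Fintype.card_le_of_injective (fun t : Fin r => (⟨ρ t, h.row_lt t t.2⟩ : Fin m))
    fun s t hst => Fin.ext (h.row_injOn s.2 t.2 (by simpa using hst))
  simpa using this

theorem rank_le_cols (h : IsEchelon a m n r ρ γ c u) : r ≤ n := by
  have := Fintype.card_le_of_injective (fun t : Fin r => (⟨γ t, h.col_lt t t.2⟩ : Fin n))
    fun s t hst => Fin.ext (h.col_injOn s.2 t.2 (by simpa using hst))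
  simpa using this

/-- A column at which the product vanishes is a zero column of the right factor. -/
theorem u_eq_zero (h : IsEchelon a m n r ρ γ c u) {j : ℕ} (hj : j < n)
    (ha : ∀ i < m, a i j = 0) : ∀ t < r, u t j = 0 := by
  intro t
  induction t using Nat.strong_induction_on with
  | _ t ih =>
    intro ht
    have hs := h.eq_sum (ρ t) (h.row_lt t ht) j hj
    rw [ha _ (h.row_lt t ht), Finset.sum_eq_single t, h.c_one t ht, one_mul] at hs
    · exact hs.symm
    · intro s hs hne
      rw [Finset.mem_range] at hs
      rcases lt_or_gt_of_ne hne with hlt | hlt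
      · rw [ih s hlt hs, mul_zero]
      · rw [h.c_zero s hs _ (h.row_mono t s hlt hs), zero_mul]
    · exact fun hnot => absurd (Finset.mem_range.mpr ht) hnot

/-- The coefficients `e` are chosen so that the reduced lower part vanishes at the pivot columns of
the upper part. Its factor `u₂` then vanishes there too, which keeps `u_pivot` true for the stacked
factorization. -/
theorem append {p q r₂ : ℕ} {ρ₂ γ₂ : ℕ → ℕ} {c₂ u₂ e : ℕ → ℕ → F}
    (h : IsEchelon a p n r ρ γ c u)
    (he : ∀ i < q, ∀ s < r, ∑ t ∈ Finset.range r, e i t * u t (γ s) = a (p + i) (γ s))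
    (h₂ : IsEchelon (fun i j => a (p + i) j - ∑ t ∈ Finset.range r, e i t * u t j) q n r₂ ρ₂ γ₂
      c₂ u₂) :
    IsEchelon a (p + q) n (r + r₂) (glue r ρ fun t => p + ρ₂ t) (glue r γ γ₂)
      (glue p (fun i => glue r (c i) 0) fun i => glue r (e i) (c₂ i)) (glue r u u₂) := by
  have hu₂ : ∀ s < r, ∀ t < r₂, u₂ t (γ s) = 0 := fun s hs =>
    h₂.u_eq_zero (h.col_lt s hs) fun i hi => by rw [he i hi s hs, sub_self]
  refine ⟨?_, ?_, ?_, ?_, ?_, ?_, ?_, ?_, ?_⟩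
  · refine forall_lt_add (fun t ht => ?_) fun t ht => ?_
    · rw [glue_of_lt ht]
      have := h.row_lt t ht
      omega
    · rw [glue_add]
      have := h₂.row_lt t ht
      omega
  · refine forall_lt_add (fun t ht => ?_) fun t ht => ?_
    · rw [glue_of_lt ht]
      exact h.col_lt t ht
    · rw [glue_add]
      exact h₂.col_lt t ht
  · intro s t hst ht
    by_cases htr : t < r
    · rw [glue_of_lt htr, glue_of_lt (hst.trans htr)]
      exact h.row_mono s t hst htr
    · obtain ⟨t, rfl⟩ := Nat.exists_eq_add_of_le (not_lt.mp htr)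
      rw [glue_add]
      by_cases hsr : s < r
      · rw [glue_of_lt hsr]
        have := h.row_lt s hsr
        omega
      · obtain ⟨s, rfl⟩ := Nat.exists_eq_add_of_le (not_lt.mp hsr)
        rw [glue_add]
        have := h₂.row_mono s t (by omega) (by omega)
        omega
  · refine forall_lt_add (fun t ht => ?_) fun t ht => ?_
    · rw [glue_of_lt ht, glue_of_lt (h.row_lt t ht), glue_of_lt ht]
      exact h.c_one t ht
    · rw [glue_add, glue_add, glue_add]
      exact h₂.c_one t ht
  · refine forall_lt_add (fun t ht i hi => ?_) fun t ht i hi => ?_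
    · rw [glue_of_lt ht] at hi
      rw [glue_of_lt (hi.trans (h.row_lt t ht)), glue_of_lt ht]
      exact h.c_zero t ht i hi
    · rw [glue_add] at hi
      by_cases hip : i < p
      · rw [glue_of_lt hip, glue_add]
        rfl
      · obtain ⟨i, rfl⟩ := Nat.exists_eq_add_of_le (not_lt.mp hip)
        rw [glue_add, glue_add]
        exact h₂.c_zero t ht i (by omega)
  · refine forall_lt_add (fun t ht => ?_) fun t ht => ?_
    · rw [glue_of_lt ht, glue_of_lt ht]
      exact h.u_ne t ht
    · rw [glue_add, glue_add]
      exact h₂.u_ne t ht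
  · refine forall_lt_add (fun t ht j hj => ?_) fun t ht j hj => ?_
    · rw [glue_of_lt ht] at hj ⊢
      exact h.u_zero t ht j hj
    · rw [glue_add] at hj ⊢
      exact h₂.u_zero t ht j hj
  · intro s t hst ht
    by_cases htr : t < r
    · rw [glue_of_lt htr, glue_of_lt (hst.trans htr)]
      exact h.u_pivot s t hst htr
    · obtain ⟨t, rfl⟩ := Nat.exists_eq_add_of_le (not_lt.mp htr)
      rw [glue_add]
      by_cases hsr : s < r
      · rw [glue_of_lt hsr]
        exact hu₂ s hsr t (by omega)
      · obtain ⟨s, rfl⟩ := Nat.exists_eq_add_of_le (not_lt.mp hsr)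
        rw [glue_add]
        exact h₂.u_pivot s t (by omega) (by omega)
  · refine forall_lt_add (fun i hi j hj => ?_) fun i hi j hj => ?_
    · rw [Finset.sum_range_add, glue_of_lt hi, h.eq_sum i hi j hj]
      simp only [glue_add, Pi.zero_apply, zero_mul, Finset.sum_const_zero, add_zero]
      refine Finset.sum_congr rfl fun t ht => ?_
      rw [glue_of_lt (Finset.mem_range.mp ht), glue_of_lt (Finset.mem_range.mp ht)]
    · rw [Finset.sum_range_add]
      simp only [glue_add]
      rw [← h₂.eq_sum i hi j hj, ← sub_eq_iff_eq_add']
      congr 1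
      refine Finset.sum_congr rfl fun t ht => ?_
      rw [glue_of_lt (Finset.mem_range.mp ht), glue_of_lt (Finset.mem_range.mp ht)]

end IsEchelon

/-- The output of the elimination: rank, pivot positions, and the addresses of both factors. -/
structure EchelonData where
  r : ℕ
  ρ : ℕ → ℕ
  γ : ℕ → ℕ
  C : ℕ → ℕ → ℕ
  U : ℕ → ℕ → ℕ

/-! ### The elimination program and its cost. -/

section

variable {k : Type u} [Field k]
  (mm : ∀ n : ℕ, AddrMatrix n n → AddrMatrix n n → Prog k (AddrMatrix n n))

/-- The first of the cells `f s, f (s + 1), …` (`n` of them) that is not zero. -/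
def findNonzero (f : ℕ → ℕ) : ℕ → ℕ → Prog k (Option ℕ)
  | 0, _ => pure none
  | n + 1, s => .test (f s) fun b => if b then findNonzero f n (s + 1) else pure (some s)

/-- Echelon factorization of an `m × n` matrix: factor the upper half, eliminate its pivot columns
from the lower half, factor the rest. -/
def echelonFactor (n m : ℕ) (A : ℕ → ℕ → ℕ) : Prog k EchelonData :=
  if m = 0 then pure ⟨0, 0, 0, A, A⟩
  else if m = 1 then do
    let o ← findNonzero (A 0) n 0
    let z ← Prog.const 1
    pure (match o with
      | none => ⟨0, 0, 0, A, A⟩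
      | some j => ⟨1, 0, fun _ => j, fun _ _ => z, A⟩)
  else do
    let f ← echelonFactor n (m / 2) A
    -- `X` is the transpose of the multipliers `e` of `IsEchelon.append`. Its system is the
    -- transpose of the pivot columns of `U`, lower triangular with nonzero diagonal by `u_pivot`
    -- and `u_ne`.
    let X ← triSolve mm (m - m / 2) f.r (fun i j => f.U j (f.γ i))
      (fun i j => A (m / 2 + j) (f.γ i))
    let A' ← blockSubMul mm (m - m / 2) f.r n (fun i j => A (m / 2 + i) j) (fun i j => X j i) f.U
    let g ← echelonFactor n (m - m / 2) A'
    let z ← Prog.const 0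
    pure ⟨f.r + g.r, glue f.r f.ρ fun t => m / 2 + g.ρ t, glue f.r f.γ g.γ,
      glue (m / 2) (fun i => glue f.r (f.C i) fun _ => z)
        (fun i => glue f.r (fun j => X j i) (g.C i)), glue f.r f.U g.U⟩
termination_by m
decreasing_by all_goals omega

variable {mm} {ω C : ℝ} {F : Type u} [Field F] [Algebra k F]

theorem runs_findNonzero {f : ℕ → ℕ} {a : ℕ → F} {μ : List F} (n s : ℕ)
    (hf : ∀ j, s ≤ j → j < s + n → μ[f j]? = some (a j)) :
    (findNonzero f n s : Prog k (Option ℕ)).Runs μ fun o ν c => ν = μ ∧ c ≤ n ∧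
      (o = none → ∀ j, s ≤ j → j < s + n → a j = 0) ∧
      ∀ j, o = some j → s ≤ j ∧ j < s + n ∧ a j ≠ 0 ∧ ∀ i, s ≤ i → i < j → a i = 0 := by
  induction n generalizing s with
  | zero =>
    exact ⟨rfl, le_rfl, fun _ j h1 h2 => by omega, fun j hj => by cases hj⟩
  | succ n ih =>
    have hs := hf s le_rfl (by omega)
    have hget : μ.getD (f s) 0 = a s := by rw [List.getD_eq_getElem?_getD, hs]; rfl
    by_cases h0 : a s = 0
    · obtain ⟨h1, h2, h3, h4⟩ := ih (s + 1) fun j h1 h2 => hf j (by omega) (by omega)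
      have hrun : (findNonzero f n (s + 1) : Prog k (Option ℕ)).Runs μ fun o ν c =>
          ν = μ ∧ c + 1 ≤ n + 1 ∧ (o = none → ∀ j, s ≤ j → j < s + (n + 1) → a j = 0) ∧
          ∀ j, o = some j → s ≤ j ∧ j < s + (n + 1) ∧ a j ≠ 0 ∧
            ∀ i, s ≤ i → i < j → a i = 0 := by
        refine ⟨h1, by omega, fun ho j hj1 hj2 => ?_, fun j hj => ?_⟩
        · by_cases hjs : j = s
          · rw [hjs, h0]
          · exact h3 ho j (by omega) (by omega)
        · obtain ⟨g1, g2, g3, g4⟩ := h4 j hj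
          refine ⟨by omega, by omega, g3, fun i hi1 hi2 => ?_⟩
          by_cases his : i = s
          · rw [his, h0]
          · exact g4 i (by omega) hi2
      unfold Prog.Runs Prog.val Prog.mem at hrun ⊢
      simpa only [findNonzero, Prog.exec, Prog.cost, hget, h0, decide_true, if_true] using hrun
    · have hrun : (pure (some s) : Prog k (Option ℕ)).Runs μ fun o ν c =>
          ν = μ ∧ c + 1 ≤ n + 1 ∧ (o = none → ∀ j, s ≤ j → j < s + (n + 1) → a j = 0) ∧
          ∀ j, o = some j → s ≤ j ∧ j < s + (n + 1) ∧ a j ≠ 0 ∧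
            ∀ i, s ≤ i → i < j → a i = 0 := by
        refine Prog.runs_pure ⟨rfl, by omega, fun ho => (by cases ho), fun j hj => ?_⟩
        obtain rfl := Option.some.inj hj
        exact ⟨le_rfl, by omega, h0, fun i h1 h2 => by omega⟩
      unfold Prog.Runs Prog.val Prog.mem at hrun ⊢
      simpa only [findNonzero, Prog.exec, Prog.cost, hget, h0, decide_false, if_false,
        Bool.false_eq_true] using hrun

/-- Jensen's inequality with weights `p / m` and `q / m`, both at most `2/3`, bounds the mean of the
two powers by the power of `2/3 * (r + s)`. Concavity of `x ^ (ω - 2)` is where `ω ≤ 3` enters. -/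
theorem weighted_rpow_le {p q m r s ω : ℝ} (hω : 2 < ω) (hω3 : ω ≤ 3) (hp : 0 ≤ p) (hq : 0 ≤ q)
    (hm : 0 < m) (hpq : p + q = m) (hp3 : p ≤ 2 / 3 * m) (hq3 : q ≤ 2 / 3 * m) (hr : 0 ≤ r)
    (hs : 0 ≤ s) :
    p * r ^ (ω - 2) + q * s ^ (ω - 2) ≤ m * ((2 / 3) ^ (ω - 2) * (r + s) ^ (ω - 2)) := by
  have hJ := (Real.concaveOn_rpow (p := ω - 2) (by linarith) (by linarith)).2
    (Set.mem_Ici.mpr hr) (Set.mem_Ici.mpr hs) (div_nonneg hp hm.le) (div_nonneg hq hm.le)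
    (by rw [← add_div, hpq, div_self hm.ne'])
  simp only [smul_eq_mul] at hJ
  have hle : p / m * r + q / m * s ≤ 2 / 3 * (r + s) := by
    have h1 : p / m ≤ 2 / 3 := (div_le_iff₀ hm).mpr hp3
    have h2 : q / m ≤ 2 / 3 := (div_le_iff₀ hm).mpr hq3
    nlinarith
  have h0 : 0 ≤ p / m * r + q / m * s := by positivity
  have hpow := Real.rpow_le_rpow h0 hle (by linarith : (0 : ℝ) ≤ ω - 2)
  rw [Real.mul_rpow (by norm_num) (by linarith)] at hpow
  have := mul_le_mul_of_nonneg_left (hJ.trans hpow) hm.le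
  refine le_trans (le_of_eq ?_) this
  field_simp

/-- The term `m * n` pays for the zero tests and is additive over the two halves. The other term
contracts by `(2/3)^(ω-2)` through `weighted_rpow_le`; what this frees pays for the triangular solve
(`K`) and the product (`2 * (C + 1)`), as `hK₂` requires. -/
theorem runs_echelonFactor (h : IsMatMul ω C mm) (hω : 2 < ω) (hω3 : ω ≤ 3) {K K₂ : ℝ}
    (hK1 : 1 ≤ K) (hK : 2 * (C + 1) ≤ K * (1 - (2 / 3) ^ (ω - 2))) (hK0 : 0 ≤ K₂)
    (hK₂ : K + 2 * (C + 1) ≤ K₂ * (1 - (2 / 3) ^ (ω - 2))) (n m : ℕ) {A : ℕ → ℕ → ℕ}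
    {a : ℕ → ℕ → F} {μ : List F} (hA : Stores μ m n A a) :
    (echelonFactor mm n m A).Runs μ fun f ν t =>
      ∃ c u, Stores ν m f.r f.C c ∧ Stores ν f.r n f.U u ∧ IsEchelon a m n f.r f.ρ f.γ c u ∧
        (t : ℝ) ≤ m * n + K₂ * m * n * (f.r : ℝ) ^ (ω - 2) := by
  induction m using Nat.strong_induction_on generalizing A a μ with
  | _ m ih =>
  rw [echelonFactor]
  split_ifs with h0 h1
  · subst h0
    refine Prog.runs_pure ⟨a, a, ?_, ?_, .of_eq_zero ?_, by simp⟩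
    all_goals exact fun i hi => absurd hi (Nat.not_lt_zero i)
  · subst h1
    refine (runs_findNonzero n 0 (a := a 0) fun j _ hj => hA 0 one_pos j (by omega)).bind ?_
    rintro o ν t - ⟨rfl, ht, hnone, hsome⟩
    refine (Prog.runs_const 1 ν).bind ?_
    rintro z ν' t' hν' ⟨hz, rfl⟩
    rw [map_one] at hz
    have ht' : (t : ℝ) ≤ n := by exact_mod_cast ht
    refine Prog.runs_pure ?_
    rcases o with _ | j
    · refine ⟨a, a, fun _ _ j hj => absurd hj (Nat.not_lt_zero j),
        fun i hi => absurd hi (Nat.not_lt_zero i), .of_eq_zero fun i hi j hj => ?_, ?_⟩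
      · obtain rfl : i = 0 := by omega
        exact hnone rfl j (Nat.zero_le j) (by omega)
      · have : 0 ≤ K₂ * n * (0 : ℝ) ^ (ω - 2) := by positivity
        push_cast
        linarith
    · obtain ⟨-, hj, hne, hzero⟩ := hsome j rfl
      refine ⟨fun _ _ => 1, a, fun _ _ _ _ => hz, hA.mono hν', ⟨?_, ?_, ?_, ?_, ?_, ?_, ?_, ?_, ?_⟩,
        ?_⟩
      · exact fun t ht => one_pos
      · exact fun t ht => by simpa using hj
      · intro s t hst ht
        have : t < 1 := ht
        omega
      · exact fun t ht => rfl
      · exact fun t ht i hi => absurd hi (Nat.not_lt_zero i)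
      · intro t ht
        obtain rfl : t = 0 := by have : t < 1 := ht; omega
        exact hne
      · intro t ht i hi
        obtain rfl : t = 0 := by have : t < 1 := ht; omega
        exact hzero i (Nat.zero_le i) hi
      · intro s t hst ht
        have : t < 1 := ht
        omega
      · intro i hi j hj
        obtain rfl : i = 0 := by omega
        simp
      · have : 0 ≤ K₂ * n := by positivity
        push_cast
        rw [Real.one_rpow]
        linarith
  · have h2 : 2 ≤ m := by omega
    have hp := natCast_half_add m
    obtain ⟨hp3, hq3⟩ := natCast_half_le h2
    obtain ⟨q, hq⟩ : ∃ q, m - m / 2 = q := ⟨_, rfl⟩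
    obtain ⟨p, hp'⟩ : ∃ p, m / 2 = p := ⟨_, rfl⟩
    rw [hq, hp'] at hp ⊢
    rw [hp'] at hp3
    rw [hq] at hq3
    have hpq : m = p + q := by omega
    have hpm : p < m := by omega
    have hqm : q < m := by omega
    refine (ih p hpm fun i hi j hj => hA i (by omega) j hj).bind ?_
    rintro f ν₁ t₁ hν₁ ⟨c, u, hc, hu, hE, ht₁⟩
    refine (runs_triSolve h hω hK1 hK q f.r (l := fun i j => u j (f.γ i))
      (b := fun i j => a (p + j) (f.γ i)) (fun i hi j hj => hu j hj _ (hE.col_lt i hi))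
      (fun i hi j hj => (hA.mono hν₁) (p + j) (by omega) _ (hE.col_lt i hi)) hE.u_ne
      hE.u_pivot).bind ?_
    rintro X ν₂ t₂ hν₂ ⟨x, hX, hx, ht₂⟩
    refine (runs_blockSubMul h hω (m := q) (r := f.r) (n := n) (b := fun i j => a (p + i) j)
      (x := fun i j => x j i)
      (fun i hi j hj => (hA.mono (hν₁.trans hν₂)) (p + i) (by omega) j hj)
      (fun i hi j hj => hX j hj i hi) (hu.mono hν₂)).bind ?_
    rintro A' ν₃ t₃ hν₃ ⟨hA', ht₃⟩
    refine (ih q hqm hA').bind ?_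
    rintro g ν₄ t₄ hν₄ ⟨c₂, u₂, hc₂, hu₂, hE₂, ht₄⟩
    refine (Prog.runs_const 0 ν₄).bind ?_
    rintro z ν₅ t₅ hν₅ ⟨hz, rfl⟩
    rw [map_zero] at hz
    have happ := hE.append (e := fun i t => x t i) (fun i hi s hs => by
      rw [← hx s hs i hi]
      exact Finset.sum_congr rfl fun t _ => mul_comm _ _) hE₂
    rw [← hpq] at happ
    refine Prog.runs_pure ⟨_, _, ?_, ?_, happ, ?_⟩
    · intro i hi t ht
      simp only [glue]
      by_cases hip : i < p <;> by_cases htr : t < f.r <;>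
        simp only [glue, hip, htr, if_true, if_false]
      · exact Prog.getElem?_of_prefix (((hν₂.trans hν₃).trans hν₄).trans hν₅) (hc i hip t htr)
      · exact hz
      · exact Prog.getElem?_of_prefix ((hν₃.trans hν₄).trans hν₅) (hX t htr (i - p) (by omega))
      · have : t < f.r + g.r := ht
        exact Prog.getElem?_of_prefix hν₅ (hc₂ (i - p) (by omega) (t - f.r) (by omega))
    · intro t ht j hj
      simp only [glue]
      split_ifs with htr
      · exact Prog.getElem?_of_prefix (((hν₂.trans hν₃).trans hν₄).trans hν₅) (hu t htr j hj)
      · have : t < f.r + g.r := ht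
        exact Prog.getElem?_of_prefix hν₅ (hu₂ (t - f.r) (by omega) j hj)
    · have hrp : (f.r : ℝ) ≤ p := by exact_mod_cast hE.rank_le_rows
      have hrn : (f.r : ℝ) ≤ n := by exact_mod_cast hE.rank_le_cols
      have hr0 : (0 : ℝ) ≤ f.r := Nat.cast_nonneg _
      have hg0 : (0 : ℝ) ≤ g.r := Nat.cast_nonneg _
      have hp0 : (0 : ℝ) ≤ p := Nat.cast_nonneg p
      have hq0 : (0 : ℝ) ≤ q := Nat.cast_nonneg q
      have hn0 : (0 : ℝ) ≤ n := Nat.cast_nonneg n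
      have hm0 : (0 : ℝ) < m := by exact_mod_cast (by omega : 0 < m)
      have hC := h.nonneg
      have hJ := weighted_rpow_le hω hω3 hp0 hq0 hm0 hp hp3 hq3 hr0 hg0
      rw [rpow_sub_one_eq_mul hr0 hω] at ht₂
      have hR : (f.r : ℝ) ^ (ω - 2) ≤ ((f.r + g.r : ℕ) : ℝ) ^ (ω - 2) :=
        Real.rpow_le_rpow hr0 (by push_cast; linarith) (by linarith)
      have hR0 : 0 ≤ (f.r : ℝ) ^ (ω - 2) := Real.rpow_nonneg hr0 _
      push_cast at hR ⊢
      generalize ((f.r : ℝ) + g.r) ^ (ω - 2) = R at *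
      generalize (f.r : ℝ) ^ (ω - 2) = R₁ at *
      generalize (g.r : ℝ) ^ (ω - 2) = R₂ at *
      generalize (2 / 3 : ℝ) ^ (ω - 2) = δ at *
      have f2 : (t₂ : ℝ) ≤ K * m * (n * R) := by
        refine ht₂.trans ?_
        gcongr
        exact max_le (by linarith) (by linarith)
      have f3 : (t₃ : ℝ) ≤ (C + 1) * m * (2 * n) * R := by
        refine ht₃.trans ?_
        gcongr <;> linarith
      have hnK : 0 ≤ K₂ * n := by positivity
      have f4 := mul_le_mul_of_nonneg_left hJ hnK
      have hmnR : 0 ≤ m * n * R := by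
        have : 0 ≤ R := hR0.trans hR
        positivity
      have f5 := mul_le_mul_of_nonneg_right hK₂ hmnR
      have f6 : (p : ℝ) * n + q * n = m * n := by rw [← hp]; ring
      linarith

end

/-! ## The four subroutines -/

theorem exists_perm_extending {m r : ℕ} (ρ : ℕ → ℕ) (hm : ∀ t < r, ρ t < m)
    (hρ : ∀ s < r, ∀ t < r, ρ s = ρ t → s = t) :
    ∃ σ : Equiv.Perm (Fin m), ∀ i : Fin m, i.1 < r → (σ i).1 = ρ i := by
  classical
  let g : {x : Fin m // x.1 < r} → Fin m := fun x => ⟨ρ x.1, hm _ x.2⟩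
  have hg : Function.Injective g := fun x y h =>
    Subtype.ext (Fin.ext (hρ _ x.2 _ y.2 (by simpa [g] using h)))
  let e : {x : Fin m // x.1 < r} ≃ {y : Fin m // y ∈ Set.range g} := Equiv.ofInjective g hg
  exact ⟨e.extendSubtype, fun i hi => by rw [Equiv.extendSubtype_apply_of_mem e i hi]; rfl⟩

/-- This fixes the conventions: the entry `(t, t)` of the middle factor is moved to the row `P.symm
t` and the column `Q t`. -/
theorem permMatrix_mul_mul_permMatrix_apply {F : Type u} [Field F] {m n : ℕ}
    (P : Equiv.Perm (Fin m)) (M : Matrix (Fin m) (Fin n) F) (Q : Equiv.Perm (Fin n))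
    (i : Fin m) (j : Fin n) :
    (P.permMatrix F * M * Q.permMatrix F) i j = M (P i) (Q.symm j) := by
  rw [PEquiv.mul_toMatrix_toPEquiv, PEquiv.toMatrix_toPEquiv_mul]
  rfl

section

variable {F : Type u} [Field F]

theorem IsEchelon.lrk_eq {a : ℕ → ℕ → F} {m n r : ℕ} {ρ γ : ℕ → ℕ} {c u : ℕ → ℕ → F}
    (h : IsEchelon a m n r ρ γ c u) (p q : ℕ) (hp : p ≤ m) (hq : q ≤ n) :
    lrk a p q = Nat.card {t : Fin r // ρ t < p ∧ γ t < q} :=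
  lrk_of_echelon (τ := Fin r) (m := m) (n := n) (fun i t => c i t) (fun t j => u t j)
    (fun t => ρ t) (fun t => γ t) (fun s t hst => Fin.ext (h.row_injOn s.2 t.2 hst))
    (fun s t hst => Fin.ext (h.col_injOn s.2 t.2 hst)) (fun i t hi => h.c_zero t t.2 i hi)
    (fun t => by rw [h.c_one t t.2]; exact one_ne_zero) (fun t j hj => h.u_zero t t.2 j hj)
    (fun t => h.u_ne t t.2)
    (fun i hi j hj => by rw [h.eq_sum i hi j hj, Finset.sum_range]) p q hp hq

theorem IsEchelon.lrk_full {a : ℕ → ℕ → F} {m n r : ℕ} {ρ γ : ℕ → ℕ} {c u : ℕ → ℕ → F}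
    (h : IsEchelon a m n r ρ γ c u) : lrk a m n = r := by
  rw [h.lrk_eq m n le_rfl le_rfl, Nat.card_congr (Equiv.subtypeUnivEquiv fun t : Fin r =>
    ⟨h.row_lt t t.2, h.col_lt t t.2⟩), Nat.card_eq_fintype_card, Fintype.card_fin]

/-- The pivots of an echelon factorization are the ones of the rank profile matrix. -/
theorem IsEchelon.isRankProfileMatrix {m n r : ℕ} {A : Matrix (Fin m) (Fin n) F} {ρ γ : ℕ → ℕ}
    {c u : ℕ → ℕ → F} (h : IsEchelon (extendZero A) m n r ρ γ c u) (P : Equiv.Perm (Fin m))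
    (Q : Equiv.Perm (Fin n)) (hP : ∀ i : Fin m, i.1 < r → (P.symm i).1 = ρ i)
    (hQ : ∀ j : Fin n, j.1 < r → (Q j).1 = γ j) :
    IsRankProfileMatrix A (P.permMatrix F * idBlock F m n r * Q.permMatrix F) := by
  classical
  have hrm := h.rank_le_rows
  have hrn := h.rank_le_cols
  have happ : ∀ i j, (P.permMatrix F * idBlock F m n r * Q.permMatrix F) i j =
      if (P i).1 = (Q.symm j).1 ∧ (P i).1 < r then 1 else 0 := fun i j => by
    rw [permMatrix_mul_mul_permMatrix_apply, idBlock, Matrix.of_apply]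
  have hone : ∀ i j, (P.permMatrix F * idBlock F m n r * Q.permMatrix F) i j ≠ 0 ↔
      ∃ t < r, ρ t = i.1 ∧ γ t = j.1 := by
    intro i j
    rw [happ, ne_eq, ite_eq_right_iff, Classical.not_imp]
    constructor
    · rintro ⟨⟨heq, hlt⟩, -⟩
      refine ⟨(P i).1, hlt, ?_, ?_⟩
      · rw [← hP (P i) hlt, Equiv.symm_apply_apply]
      · rw [heq, ← hQ (Q.symm j) (heq ▸ hlt), Equiv.apply_symm_apply]
    · rintro ⟨t, ht, hi, hj⟩
      have e1 : P i = ⟨t, by omega⟩ := by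
        rw [← Equiv.eq_symm_apply, Fin.ext_iff, hP _ ht, hi]
      have e2 : Q.symm j = ⟨t, by omega⟩ := by
        rw [Equiv.symm_apply_eq, Fin.ext_iff, hQ _ ht, hj]
      rw [e1, e2]
      exact ⟨⟨rfl, ht⟩, one_ne_zero⟩
  have h01 : ∀ i j, (P.permMatrix F * idBlock F m n r * Q.permMatrix F) i j = 0 ∨
      (P.permMatrix F * idBlock F m n r * Q.permMatrix F) i j = 1 := by
    intro i j
    rw [happ]
    split_ifs <;> simp
  generalize P.permMatrix F * idBlock F m n r * Q.permMatrix F = R at happ hone h01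
  -- The 0-1 matrix is in echelon form with the same `ρ` and `γ`, so its leading ranks count the
  -- same pivots as those of `A`.
  have hR : IsEchelon (extendZero R) m n r ρ γ (fun i t => if i = ρ t then 1 else 0)
      (fun t j => if j = γ t then 1 else 0) := by
    refine ⟨h.row_lt, h.col_lt, h.row_mono, fun _ _ => if_pos rfl, fun _ _ _ hi => if_neg hi.ne,
      fun _ _ => by simp, fun _ _ _ hj => if_neg hj.ne, fun s t hst ht => if_neg fun heq => ?_,
      fun i hi j hj => ?_⟩
    · exact hst.ne (h.col_injOn (hst.trans ht) ht heq)
    · rw [extendZero_apply R hi hj]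
      by_cases hex : ∃ t < r, ρ t = i ∧ γ t = j
      · rw [(h01 _ _).resolve_left ((hone ⟨i, hi⟩ ⟨j, hj⟩).mpr hex)]
        obtain ⟨t, ht, rfl, rfl⟩ := hex
        rw [Finset.sum_eq_single t]
        · simp
        · intro s hs hne
          rw [if_neg fun heq => hne (h.row_injOn (Finset.mem_range.mp hs) ht heq.symm), zero_mul]
        · exact fun hnot => absurd (Finset.mem_range.mpr ht) hnot
      · rw [not_not.mp (mt (hone ⟨i, hi⟩ ⟨j, hj⟩).mp hex), Finset.sum_eq_zero]
        intro t ht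
        by_cases hi' : i = ρ t
        · have hj' : j ≠ γ t := fun hj' => hex ⟨t, Finset.mem_range.mp ht, hi'.symm, hj'.symm⟩
          rw [if_neg hj', mul_zero]
        · rw [if_neg hi', zero_mul]
  refine ⟨h01, fun i j j' h1 h2 => ?_, fun i i' j h1 h2 => ?_, ?_, fun a b ha hb => ?_⟩
  · obtain ⟨t, ht, hi, hj⟩ := (hone i j).mp h1
    obtain ⟨s, hs, hi', hj'⟩ := (hone i j').mp h2
    obtain rfl := h.row_injOn ht hs (hi.trans hi'.symm)
    exact Fin.ext (hj.symm.trans hj')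
  · obtain ⟨t, ht, hi, hj⟩ := (hone i j).mp h1
    obtain ⟨s, hs, hi', hj'⟩ := (hone i' j).mp h2
    obtain rfl := h.col_injOn ht hs (hj.trans hj'.symm)
    exact Fin.ext (hi.symm.trans hi')
  · let g : Fin r → Fin m × Fin n := fun t => (⟨ρ t, h.row_lt t t.2⟩, ⟨γ t, h.col_lt t t.2⟩)
    have hg : Function.Injective g := fun s t hst =>
      Fin.ext (h.row_injOn s.2 t.2 (by simpa [g] using (congrArg (fun p => p.1.1) hst)))
    have hset : {p : Fin m × Fin n | R p.1 p.2 ≠ 0} = Set.range g := by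
      ext ⟨i, j⟩
      rw [Set.mem_ofPred_eq, hone]
      constructor
      · rintro ⟨t, ht, hi, hj⟩
        exact ⟨⟨t, ht⟩, Prod.ext (Fin.ext hi) (Fin.ext hj)⟩
      · rintro ⟨t, ht⟩
        exact ⟨t, t.2, congrArg (fun p => p.1.1) ht, congrArg (fun p => p.2.1) ht⟩
    rw [hset, ← Nat.card_coe_set_eq, Nat.card_range_of_injective hg, Nat.card_eq_fintype_card,
      Fintype.card_fin, rank_eq_lrk, h.lrk_full]
  · rw [leadingRank_eq_lrk R ha hb, leadingRank_eq_lrk A ha hb, hR.lrk_eq a b ha hb,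
      h.lrk_eq a b ha hb]

end

open Classical in
/-- The PLUQ decomposition that an echelon factorization contains. -/
noncomputable def EchelonData.toPLUQ (m n : ℕ) (f : EchelonData) : PLUQ m n :=
  if h : f.r ≤ m ∧ f.r ≤ n ∧ ∃ p : Equiv.Perm (Fin m) × Equiv.Perm (Fin n),
      (∀ i : Fin m, i.1 < f.r → (p.1 i).1 = f.ρ i) ∧
      ∀ j : Fin n, j.1 < f.r → (p.2 j).1 = f.γ j then
    { r := f.r
      r_le_rows := h.1
      r_le_cols := h.2.1
      P := h.2.2.choose.1.symm
      Q := h.2.2.choose.2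
      L := fun i t => f.C (h.2.2.choose.1 i) t
      U := fun t j => f.U t (h.2.2.choose.2 j) }
  else
    -- Junk value: an echelon factorization always satisfies the condition of the `if`.
    { r := 0
      r_le_rows := Nat.zero_le m
      r_le_cols := Nat.zero_le n
      P := 1
      Q := 1
      L := fun _ _ => 0
      U := fun _ _ => 0 }

/-- The addresses of a stored matrix as a doubly infinite array. -/
def AddrMatrix.toFun {m n : ℕ} (X : AddrMatrix m n) : ℕ → ℕ → ℕ := fun i j =>
  if h : i < m ∧ j < n then X ⟨i, h.1⟩ ⟨j, h.2⟩ else 0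

theorem AddrMatrix.stores {F : Type u} [Field F] {m n : ℕ} {X : AddrMatrix m n} {μ : List F}
    (h : X.Valid μ) : Stores μ m n X.toFun (extendZero (X.load μ)) := by
  intro i hi j hj
  rw [extendZero_apply _ hi hj, AddrMatrix.toFun, dif_pos ⟨hi, hj⟩]
  exact AddrMatrix.getElem?_eq h _ _

/-- Once the pivot rows and columns are moved to the front, `L` is unit lower triangular because the
`ρ t` increase and column `t` of `c` starts with a one at `ρ t`; `U` is upper triangular by
`u_pivot`. -/
theorem EchelonData.decomposes {F : Type u} [Field F] {m n : ℕ} {A : Matrix (Fin m) (Fin n) F}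
    {f : EchelonData} {μ : List F} {c u : ℕ → ℕ → F} (hC : Stores μ m f.r f.C c)
    (hU : Stores μ f.r n f.U u) (h : IsEchelon (extendZero A) m n f.r f.ρ f.γ c u) :
    (f.toPLUQ m n).Decomposes μ A := by
  have hex : f.r ≤ m ∧ f.r ≤ n ∧ ∃ p : Equiv.Perm (Fin m) × Equiv.Perm (Fin n),
      (∀ i : Fin m, i.1 < f.r → (p.1 i).1 = f.ρ i) ∧
      ∀ j : Fin n, j.1 < f.r → (p.2 j).1 = f.γ j := by
    obtain ⟨σ, hσ⟩ := exists_perm_extending f.ρ h.row_lt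
      fun s hs t ht => h.row_injOn hs ht
    obtain ⟨τ, hτ⟩ := exists_perm_extending f.γ h.col_lt
      fun s hs t ht => h.col_injOn hs ht
    exact ⟨h.rank_le_rows, h.rank_le_cols, (σ, τ), hσ, hτ⟩
  rw [EchelonData.toPLUQ, dif_pos hex]
  have hσ := hex.2.2.choose_spec.1
  have hτ := hex.2.2.choose_spec.2
  generalize hex.2.2.choose = p at hσ hτ ⊢
  obtain ⟨σ, τ⟩ := p
  dsimp only at hσ hτ ⊢
  obtain ⟨vL, lL⟩ := AddrMatrix.valid_of_getElem? (X := fun i t => f.C (σ i) t)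
    (A := Matrix.of fun (i : Fin m) (t : Fin f.r) => c (σ i) t) fun i t => hC _ (σ i).2 _ t.2
  obtain ⟨vU, lU⟩ := AddrMatrix.valid_of_getElem? (X := fun t j => f.U t (τ j))
    (A := Matrix.of fun (t : Fin f.r) (j : Fin n) => u t (τ j)) fun t j => hU _ t.2 _ (τ j).2
  refine ⟨vL, vU, ?_, ?_, ?_, ?_, ?_, ?_⟩
  · rw [rank_eq_lrk, h.lrk_full]
  · intro i t hit
    dsimp only at t hit ⊢
    rw [lL, Matrix.of_apply, hσ i (hit ▸ t.2), hit]
    exact h.c_one t t.2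
  · intro i t hit
    dsimp only at t hit ⊢
    rw [lL, Matrix.of_apply, hσ i (hit.trans t.2)]
    exact h.c_zero t t.2 _ (h.row_mono _ _ hit t.2)
  · intro t j hjt
    dsimp only at t hjt ⊢
    rw [lU, Matrix.of_apply, hτ j (hjt.trans t.2)]
    exact h.u_pivot _ _ hjt t.2
  · dsimp only
    rw [lL, lU]
    ext i j
    rw [Matrix.mul_assoc (Equiv.Perm.permMatrix F σ.symm), permMatrix_mul_mul_permMatrix_apply,
      Matrix.mul_apply]
    have := h.eq_sum i i.2 j j.2
    rw [extendZero_apply A i.2 j.2, Finset.sum_range] at this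
    simpa using this
  · exact h.isRankProfileMatrix σ.symm τ hσ hτ

/-! ### Assembling the four routines. -/

section

variable {k : Type u} [Field k]
  (mm : ∀ n : ℕ, AddrMatrix n n → AddrMatrix n n → Prog k (AddrMatrix n n))

/-- The subroutines of the algorithm, built on a matrix product. -/
noncomputable def fastSubroutines : Subroutines k where
  pluq m n A := do
    let f ← echelonFactor mm n m A.toFun
    pure (f.toPLUQ m n)
  lowerSolve r n L B := do
    let X ← triSolve mm n r L.toFun B.toFun
    pure fun i j => X i j
  upperSolve m r C U := do
    -- The equation `X * U = C` is solved in transposed form, where the system is lower triangular.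
    let X ← triSolve mm m r (fun i j => U.toFun j i) (fun i j => C.toFun j i)
    pure fun i j => X j i
  subMul m r n B X Y := do
    let D ← blockSubMul mm m r n B.toFun X.toFun Y.toFun
    pure fun i j => D i j

variable {mm} {ω C : ℝ} {F : Type u} [Field F] [Algebra k F]

theorem runs_fast_pluq (h : IsMatMul ω C mm) (hω : 2 < ω) (hω3 : ω ≤ 3) {K : ℝ} (hK1 : 1 ≤ K)
    (hK : 2 * (C + 1) ≤ K * (1 - (2 / 3) ^ (ω - 2))) {K₂ : ℝ} (hK0 : 0 ≤ K₂)
    (hK₂ : K + 2 * (C + 1) ≤ K₂ * (1 - (2 / 3) ^ (ω - 2)))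
    {m n : ℕ} {A : AddrMatrix m n} {μ : List F} (hA : A.Valid μ) :
    ((fastSubroutines mm).pluq m n A).Runs μ fun f ν c => f.Decomposes ν (A.load μ) ∧
      (c : ℝ) ≤ m * n + K₂ * m * n * ((A.load μ).rank : ℝ) ^ (ω - 2) := by
  refine (runs_echelonFactor h hω hω3 hK1 hK hK0 hK₂ n m (AddrMatrix.stores hA)).bind ?_
  rintro f ν c hν ⟨cc, u, hC, hU, hE, hc⟩
  refine Prog.runs_pure ⟨EchelonData.decomposes hC hU hE, ?_⟩
  rw [rank_eq_lrk, hE.lrk_full]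
  simpa using hc

theorem runs_fast_lowerSolve (h : IsMatMul ω C mm) (hω : 2 < ω) {K : ℝ} (hK1 : 1 ≤ K)
    (hK : 2 * (C + 1) ≤ K * (1 - (2 / 3) ^ (ω - 2)))
    {r n : ℕ} {L : AddrMatrix r r} {B : AddrMatrix r n} {μ : List F}
    (hL : L.Valid μ) (hB : B.Valid μ) (h1 : ∀ i, L.load μ i i = 1)
    (h0 : ∀ i j, i < j → L.load μ i j = 0) :
    ((fastSubroutines mm).lowerSolve r n L B).Runs μ fun X ν c =>
      (X.Valid ν ∧ X.load ν = (L.load μ)⁻¹ * B.load μ) ∧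
      (c : ℝ) ≤ K * max (r : ℝ) n * (r : ℝ) ^ (ω - 1) := by
  refine (runs_triSolve h hω hK1 hK n r (AddrMatrix.stores hL) (AddrMatrix.stores hB)
    (fun i hi => ?_) (fun i j hij hj => ?_)).bind ?_
  · rw [extendZero_apply _ hi hi, h1]
    exact one_ne_zero
  · rw [extendZero_apply _ (hij.trans hj) hj]
    exact h0 _ _ hij
  · rintro X ν c hν ⟨x, hX, hx, hc⟩
    obtain ⟨v, l⟩ := AddrMatrix.valid_of_getElem? (X := fun (i : Fin r) (j : Fin n) => X i j)
      (A := Matrix.of fun (i : Fin r) (j : Fin n) => x i j) fun i j => hX i i.2 j j.2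
    refine Prog.runs_pure ⟨⟨v, ?_⟩, by simpa using hc⟩
    have hmul : L.load μ * (Matrix.of fun (i : Fin r) (j : Fin n) => x i j) = B.load μ := by
      ext i j
      have := hx i i.2 j j.2
      rw [extendZero_apply _ i.2 j.2, Finset.sum_range] at this
      rw [Matrix.mul_apply, ← this]
      exact Finset.sum_congr rfl fun t _ => by rw [extendZero_apply _ i.2 t.2]; rfl
    have hdet : IsUnit (L.load μ).det := by
      rw [Matrix.det_of_isLowerTriangular _ fun i j hij => h0 i j hij]
      simp [h1]
    rw [l, ← hmul, Matrix.nonsing_inv_mul_cancel_left _ _ hdet]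

theorem runs_fast_upperSolve (h : IsMatMul ω C mm) (hω : 2 < ω) {K : ℝ} (hK1 : 1 ≤ K)
    (hK : 2 * (C + 1) ≤ K * (1 - (2 / 3) ^ (ω - 2)))
    {m r : ℕ} {B : AddrMatrix m r} {U : AddrMatrix r r} {μ : List F}
    (hB : B.Valid μ) (hU : U.Valid μ) (h1 : ∀ i, U.load μ i i ≠ 0)
    (h0 : ∀ i j, j < i → U.load μ i j = 0) :
    ((fastSubroutines mm).upperSolve m r B U).Runs μ fun X ν c =>
      (X.Valid ν ∧ X.load ν = B.load μ * (U.load μ)⁻¹) ∧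
      (c : ℝ) ≤ K * max (r : ℝ) m * (r : ℝ) ^ (ω - 1) := by
  refine (runs_triSolve h hω hK1 hK m r (l := fun i j => extendZero (U.load μ) j i)
    (b := fun i j => extendZero (B.load μ) j i) (fun i hi j hj => AddrMatrix.stores hU j hj i hi)
    (fun i hi j hj => AddrMatrix.stores hB j hj i hi)
    (fun i hi => ?_) (fun i j hij hj => ?_)).bind ?_
  · rw [extendZero_apply _ hi hi]
    exact h1 _
  · rw [extendZero_apply _ hj (hij.trans hj)]
    exact h0 _ _ hij
  · rintro X ν c hν ⟨x, hX, hx, hc⟩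
    obtain ⟨v, l⟩ := AddrMatrix.valid_of_getElem? (X := fun (i : Fin m) (j : Fin r) => X j i)
      (A := Matrix.of fun (i : Fin m) (j : Fin r) => x j i) fun i j => hX j j.2 i i.2
    refine Prog.runs_pure ⟨⟨v, ?_⟩, by simpa using hc⟩
    have hmul : (Matrix.of fun (i : Fin m) (j : Fin r) => x j i) * U.load μ = B.load μ := by
      ext i j
      have := hx j j.2 i i.2
      rw [extendZero_apply _ i.2 j.2, Finset.sum_range] at this
      rw [Matrix.mul_apply, ← this]
      exact Finset.sum_congr rfl fun t _ => by
        rw [extendZero_apply _ t.2 j.2, mul_comm]; rfl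
    have hdet : IsUnit (U.load μ).det := by
      rw [Matrix.det_of_isUpperTriangular fun i j hij => h0 i j hij, isUnit_iff_ne_zero,
        Finset.prod_ne_zero_iff]
      exact fun i _ => h1 i
    rw [l, ← hmul, Matrix.mul_nonsing_inv_cancel_right _ _ hdet]

theorem runs_fast_subMul (h : IsMatMul ω C mm) (hω : 2 < ω)
    {m r n : ℕ} {B : AddrMatrix m n} {X : AddrMatrix m r}
    {Y : AddrMatrix r n} {μ : List F} (hB : B.Valid μ) (hX : X.Valid μ) (hY : Y.Valid μ) :
    ((fastSubroutines mm).subMul m r n B X Y).Runs μ fun D ν c =>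
      (D.Valid ν ∧ D.load ν = B.load μ - X.load μ * Y.load μ) ∧
      (c : ℝ) ≤ (C + 1) * (m + r) * (n + r) * (r : ℝ) ^ (ω - 2) := by
  refine (runs_blockSubMul h hω (AddrMatrix.stores hB) (AddrMatrix.stores hX)
    (AddrMatrix.stores hY)).bind ?_
  rintro D ν c hν ⟨hD, hc⟩
  refine Prog.runs_pure ⟨AddrMatrix.valid_of_getElem? fun i j => ?_, by simpa using hc⟩
  rw [hD i i.2 j j.2]
  beta_reduce
  rw [extendZero_apply _ i.2 j.2, Finset.sum_range, Matrix.sub_apply, Matrix.mul_apply]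
  congr 2
  exact Finset.sum_congr rfl fun t _ => by
    rw [extendZero_apply _ i.2 t.2, extendZero_apply _ t.2 j.2]

end

/-- The constants `K` and `K₂` solve the inequalities required by the two recursions, by division by
`1 - (2/3)^(ω-2) > 0`. They are chosen before `F`, hence are uniform over all extensions of `k`. -/
theorem exists_subroutines {k : Type u} [Field k] {ω : ℝ} (hω : 2 < ω) (hω3 : ω ≤ 3)
    (hmm : MatMulExponent k ω) :
    ∃ (c : ℝ) (S : Subroutines k), ∀ (F : Type u) [Field F] [Algebra k F],
      S.CorrectOver F ∧ S.CostOver F ω c := by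
  obtain ⟨C, mm, h⟩ := hmm
  have h : IsMatMul ω C mm := h
  have hC := h.nonneg
  have hδ : 0 < 1 - (2 / 3 : ℝ) ^ (ω - 2) := sub_pos.mpr (two_thirds_rpow_lt_one (by linarith))
  obtain ⟨K, hK1, hK⟩ : ∃ K : ℝ, 1 ≤ K ∧ 2 * (C + 1) ≤ K * (1 - (2 / 3) ^ (ω - 2)) :=
    ⟨max 1 (2 * (C + 1) / (1 - (2 / 3) ^ (ω - 2))), le_max_left _ _,
      (div_le_iff₀ hδ).mp (le_max_right _ _)⟩
  obtain ⟨K₂, hK0, hK₂⟩ : ∃ K₂ : ℝ, 0 ≤ K₂ ∧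
      K + 2 * (C + 1) ≤ K₂ * (1 - (2 / 3) ^ (ω - 2)) :=
    ⟨(K + 2 * (C + 1)) / (1 - (2 / 3) ^ (ω - 2)), by positivity, (div_mul_cancel₀ _ hδ.ne').ge⟩
  have hpow : ∀ r : ℕ, (r : ℝ) ^ (ω - 2) ≤ max 1 (r : ℝ) ^ (ω - 2) := fun r =>
    Real.rpow_le_rpow (Nat.cast_nonneg r) (le_max_right _ _) (by linarith)
  have hpow1 : ∀ r : ℕ, 1 ≤ max 1 (r : ℝ) ^ (ω - 2) := fun r =>
    Real.one_le_rpow (le_max_left _ _) (by linarith)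
  refine ⟨1 + K + K₂ + C, fastSubroutines mm, fun F _ _ => ⟨⟨?_, ?_, ?_, ?_⟩, ⟨?_, ?_, ?_, ?_⟩⟩⟩
  · exact fun m n A μ hA => (runs_fast_pluq h hω hω3 hK1 hK hK0 hK₂ hA).1
  · exact fun r n L B μ hL hB h1 h0 => (runs_fast_lowerSolve h hω hK1 hK hL hB h1 h0).1
  · exact fun m r B U μ hB hU h1 h0 => (runs_fast_upperSolve h hω hK1 hK hB hU h1 h0).1
  · exact fun m r n B X Y μ hB hX hY => (runs_fast_subMul h hω hB hX hY).1
  · intro m n A μ hA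
    refine (runs_fast_pluq h hω hω3 hK1 hK hK0 hK₂ hA).2.trans ?_
    have h1 := hpow1 (A.load μ).rank
    have h2 := hpow (A.load μ).rank
    generalize max 1 ((A.load μ).rank : ℝ) ^ (ω - 2) = R at *
    calc _ ≤ (m : ℝ) * n * R + K₂ * m * n * R := by
          have := le_mul_of_one_le_right (by positivity : (0 : ℝ) ≤ m * n) h1
          gcongr
      _ = (1 + K₂) * m * n * R := by ring
      _ ≤ _ := by
          have : 1 + K₂ ≤ 1 + K + K₂ + C := by linarith
          gcongr
  · intro r n L B μ hL hB h1 h0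
    refine (runs_fast_lowerSolve h hω hK1 hK hL hB h1 h0).2.trans ?_
    gcongr
    linarith
  · intro m r B U μ hB hU h1 h0
    refine (runs_fast_upperSolve h hω hK1 hK hB hU h1 h0).2.trans ?_
    gcongr
    linarith
  · intro m r n B X Y μ hB hX hY
    refine (runs_fast_subMul h hω hB hX hY).2.trans ?_
    have : C + 1 ≤ 1 + K + K₂ + C := by linarith
    gcongr
    exact le_max_right _ _

/-! ## One elimination step of LT-RPM -/

section

variable {F : Type u} [Field F]

/-- If a product `x * y` has rank `r` and its pivot rows are `ρ`, the pivot rows of `x` form an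
invertible matrix. -/
theorem det_pivotRows_ne_zero {f : ℕ → ℕ → F} {m d r : ℕ} (ρ : Fin r → ℕ) {x : ℕ → Fin r → F}
    {y : Fin r → ℕ → F} (hρ : ∀ t, ρ t < m)
    (hli : LinearIndependent F (fun (t : Fin r) (j : Fin d) => f (ρ t) j))
    (hxy : ∀ i < m, ∀ j < d, f i j = ∑ t, x i t * y t j) :
    (Matrix.of fun s t => x (ρ s) t).det ≠ 0 := by
  intro hdet
  obtain ⟨v, hv, hv0⟩ := Matrix.exists_vecMul_eq_zero_iff.mpr hdet
  refine hv (funext fun s => Fintype.linearIndependent_iff.mp hli v (funext fun j => ?_) s)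
  have hvx : ∀ t, ∑ s, v s * x (ρ s) t = 0 := fun t => congrFun hv0 t
  simp only [Finset.sum_apply, Pi.smul_apply, smul_eq_mul, Pi.zero_apply]
  calc ∑ s, v s * f (ρ s) j = ∑ s, ∑ t, v s * x (ρ s) t * y t j :=
        Finset.sum_congr rfl fun s _ => by
          rw [hxy _ (hρ s) j j.2, Finset.mul_sum]
          exact Finset.sum_congr rfl fun t _ => by ring
    _ = ∑ t, (∑ s, v s * x (ρ s) t) * y t j := by
        rw [Finset.sum_comm]
        exact Finset.sum_congr rfl fun t _ => by rw [Finset.sum_mul]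
    _ = 0 := by simp [hvx]

/-- Eliminating the block `[A₁ A₂]` with a rank profile revealing factorization `A₁ = x * y`
splits all leading ranks. -/
theorem lrk_eliminate {f h : ℕ → ℕ → F} {m d w r : ℕ} (ρ : Fin r → ℕ) {x : ℕ → Fin r → F}
    {y e : Fin r → ℕ → F} (hρ : ∀ t, ρ t < m) (hr : lrk f m d = r)
    (hf : ∀ i < m, (∀ t, ρ t ≠ i) → lrk f (i + 1) d = lrk f i d)
    (hxy : ∀ i < m, ∀ j < d, f i j = ∑ t, x i t * y t j)
    (he : ∀ s, ∀ j < w, ∑ t, x (ρ s) t * e t j = f (ρ s) (d + j))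
    (hh : ∀ i < m, ∀ j < w, h i j = f i (d + j) - ∑ t, x i t * e t j) (a : ℕ) (ha : a ≤ m)
    (b : ℕ) (hb : b ≤ w) : lrk f a (d + b) = lrk f a d + lrk h a b := by
  obtain ⟨hli, hcomb⟩ := exists_row_combination ρ hρ hr hf
  set T : Matrix (Fin r) (Fin r) F := Matrix.of fun s t => x (ρ s) t with hT
  have hdet : IsUnit T.det := (det_pivotRows_ne_zero ρ hρ hli hxy).isUnit
  -- The factor `x` need not be triangular in the original row order. Normalizing it to the identity
  -- on the pivot rows gives the coefficients of each row in terms of the pivot rows.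
  let c : ℕ → Fin r → F := fun i => Matrix.vecMul (x i) T⁻¹
  have hcT : ∀ i (z : Fin r → F), ∑ t, c i t * (T.mulVec z) t = ∑ t, x i t * z t := by
    intro i z
    change (Matrix.vecMul (x i) T⁻¹) ⬝ᵥ T.mulVec z = x i ⬝ᵥ z
    rw [Matrix.dotProduct_mulVec, Matrix.vecMul_vecMul, Matrix.nonsing_inv_mul _ hdet,
      Matrix.vecMul_one]
  have h1 : ∀ i < m, ∀ j < d, f i j = ∑ t, c i t * f (ρ t) j := by
    intro i hi j hj
    rw [hxy i hi j hj, ← hcT i fun t => y t j]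
    exact Finset.sum_congr rfl fun s _ => by rw [hxy _ (hρ s) j hj]; rfl
  have h2 : ∀ i < m, ∀ j < w, f i (d + j) = ∑ t, c i t * f (ρ t) (d + j) + h i j := by
    intro i hi j hj
    have : ∑ t, c i t * f (ρ t) (d + j) = ∑ t, x i t * e t j := by
      rw [← hcT i fun t => e t j]
      exact Finset.sum_congr rfl fun s _ => by rw [← he s j hj]; rfl
    rw [this, hh i hi j hj, add_sub_cancel]
  -- Coefficients over independent rows are unique, so `c i` agrees with the combination `v`, which
  -- involves no pivot row below `i`.
  have hc : ∀ i < m, ∀ t, i < ρ t → c i t = 0 := by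
    intro i hi t hit
    obtain ⟨v, hv0, hv⟩ := hcomb i hi
    have hz : ∀ s, c i s - v s = 0 := by
      apply Fintype.linearIndependent_iff.mp hli (fun s => c i s - v s)
      funext j
      simp only [Finset.sum_apply, Pi.smul_apply, smul_eq_mul, Pi.zero_apply, sub_mul,
        Finset.sum_sub_distrib]
      rw [← h1 i hi j j.2, ← hv j j.2, sub_self]
    rw [sub_eq_zero.mp (hz t), hv0 t hit]
  have hs := fun b (hb : b ≤ w) => lrk_schur (f := f) (h := h) (a := a) (b := b) ρ c hli
    (fun i hi => hc i (by omega)) (fun i hi => h1 i (by omega))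
    (fun i hi j hj => h2 i (by omega) j (by omega))
  -- With no column on the right, the identity evaluates the number of pivot rows among the first
  -- `a` rows as `lrk f a d`.
  have h0 := hs 0 (Nat.zero_le _)
  rw [lrk_zero_right, add_zero, add_zero] at h0
  rw [hs b hb, h0]

/-- The summands `lrk f i d` and `lrk f (i + 1) d` occur on both sides of the second difference and
cancel. -/
theorem pivotAt_eliminate {f h : ℕ → ℕ → F} {m d w : ℕ}
    (hfh : ∀ a ≤ m, ∀ b ≤ w, lrk f a (d + b) = lrk f a d + lrk h a b) {i j : ℕ} (hi : i < m)
    (hj : j < w) : PivotAt f i (d + j) ↔ PivotAt h i j := by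
  unfold PivotAt
  rw [add_assoc d j 1, hfh (i + 1) hi (j + 1) hj, hfh i hi.le j hj.le,
    hfh i hi.le (j + 1) hj, hfh (i + 1) hi j hj.le]
  omega

/-! ## Rank profile revealing PLUQ decompositions -/

namespace PLUQ

variable {m n : ℕ} (f : PLUQ m n)

/-- The row of the `t`-th pivot. -/
def pivotRow (t : Fin f.r) : Fin m := f.P.symm ⟨t.1, t.2.trans_le f.r_le_rows⟩

/-- The column of the `t`-th pivot. -/
def pivotCol (t : Fin f.r) : Fin n := f.Q ⟨t.1, t.2.trans_le f.r_le_cols⟩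

variable {f}

theorem pivotRow_injective {s t : Fin f.r} (h : (f.pivotRow s).1 = f.pivotRow t) : s = t := by
  simpa [pivotRow, Fin.ext_iff] using f.P.symm.injective (Fin.ext h)

theorem pivotCol_injective {s t : Fin f.r} (h : (f.pivotCol s).1 = f.pivotCol t) : s = t := by
  simpa [pivotCol, Fin.ext_iff] using f.Q.injective (Fin.ext h)

variable {μ : List F} {A : Matrix (Fin m) (Fin n) F}

/-- Only `reveals` matters here: the permuted identity block is a sum of matrix units at the pivot
positions, hence in echelon form. -/
theorem Decomposes.lrk_eq (h : f.Decomposes μ A) (p : ℕ) (hp : p ≤ m) (q : ℕ) (hq : q ≤ n) :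
    lrk (extendZero A) p q =
      Nat.card {t : Fin f.r // (f.pivotRow t).1 < p ∧ (f.pivotCol t).1 < q} := by
  rw [← leadingRank_eq_lrk A hp hq, ← h.reveals.leading_eq p q hp hq,
    leadingRank_eq_lrk _ hp hq]
  refine lrk_of_echelon (m := m) (n := n) (fun i t => if i = (f.pivotRow t).1 then 1 else 0)
    (fun t j => if j = (f.pivotCol t).1 then 1 else 0) (fun t => (f.pivotRow t).1)
    (fun t => (f.pivotCol t).1) (fun _ _ => pivotRow_injective) (fun _ _ => pivotCol_injective)
    (fun i t hi => if_neg hi.ne) (fun t => by simp) (fun t j hj => if_neg hj.ne)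
    (fun t => by simp) (fun i hi j hj => ?_) p q hp hq
  rw [extendZero_apply _ hi hj, permMatrix_mul_mul_permMatrix_apply, idBlock, Matrix.of_apply]
  have hrow : ∀ t : Fin f.r, i = (f.pivotRow t).1 ↔ (f.P ⟨i, hi⟩).1 = t := by
    intro t
    rw [← Fin.ext_iff (a := f.P ⟨i, hi⟩) (b := ⟨t.1, t.2.trans_le f.r_le_rows⟩),
      ← Equiv.eq_symm_apply, Fin.ext_iff]
    rfl
  have hcol : ∀ t : Fin f.r, j = (f.pivotCol t).1 ↔ (f.Q.symm ⟨j, hj⟩).1 = t := by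
    intro t
    rw [← Fin.ext_iff (a := f.Q.symm ⟨j, hj⟩) (b := ⟨t.1, t.2.trans_le f.r_le_cols⟩),
      Equiv.symm_apply_eq, Fin.ext_iff]
    rfl
  simp only [hrow, hcol]
  by_cases hlt : (f.P ⟨i, hi⟩).1 < f.r
  · rw [Finset.sum_eq_single ⟨_, hlt⟩]
    · simp only [hlt, and_true, if_true, one_mul]
      exact if_congr eq_comm rfl rfl
    · intro t _ hne
      rw [if_neg fun heq => hne (Fin.ext heq.symm), zero_mul]
    · simp
  · rw [if_neg fun h => hlt h.2, Finset.sum_eq_zero]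
    intro t _
    rw [if_neg fun heq : (f.P ⟨i, hi⟩).1 = t.1 => hlt (heq ▸ t.2), zero_mul]

theorem Decomposes.lrk_full (h : f.Decomposes μ A) : lrk (extendZero A) m n = f.r := by
  rw [h.r_eq_rank, rank_eq_lrk]

theorem Decomposes.lrk_row_succ (h : f.Decomposes μ A) {i : ℕ} (hi : i < m)
    (hne : ∀ t, (f.pivotRow t).1 ≠ i) :
    lrk (extendZero A) (i + 1) n = lrk (extendZero A) i n := by
  rw [h.lrk_eq _ hi _ le_rfl, h.lrk_eq _ hi.le _ le_rfl]
  refine Nat.card_congr (Equiv.subtypeEquivRight fun t => ?_)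
  have := hne t
  omega

theorem Decomposes.lrk_col_succ (h : f.Decomposes μ A) {j : ℕ} (hj : j < n)
    (hne : ∀ t, (f.pivotCol t).1 ≠ j) :
    lrk (extendZero A) m (j + 1) = lrk (extendZero A) m j := by
  rw [h.lrk_eq _ le_rfl _ hj, h.lrk_eq _ le_rfl _ hj.le]
  refine Nat.card_congr (Equiv.subtypeEquivRight fun t => ?_)
  have := hne t
  omega

theorem Decomposes.apply_eq (h : f.Decomposes μ A) (i : Fin m) (j : Fin n) :
    A i j = ∑ t, f.L.load μ (f.P i) t * f.U.load μ t (f.Q.symm j) := by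
  conv_lhs => rw [h.eq_mul]
  rw [Matrix.mul_assoc (f.P.permMatrix F), permMatrix_mul_mul_permMatrix_apply, Matrix.mul_apply]

end PLUQ

end

/-- The top left `m × d` block lies entirely in the left triangle, since `m + d = n`, and the bottom
right one entirely outside. In the other two blocks, the shift turns the antidiagonal bound for `n`
into the one for `m` or for `d`. -/
theorem nodup_and_mem_of_blocks {m d n : ℕ} (hn : m + d = n)
    {R₁ R₂ R₃ : List (ℕ × ℕ)} {P P₂ P₃ : ℕ → ℕ → Prop} (n₁ : R₁.Nodup) (n₂ : R₂.Nodup)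
    (n₃ : R₃.Nodup) (h₁ : ∀ p, p ∈ R₁ ↔ p.1 < m ∧ p.2 < d ∧ P p.1 p.2)
    (h₂ : ∀ p, p ∈ R₂ ↔ p.1 + p.2 + 2 ≤ m ∧ P₂ p.1 p.2)
    (h₃ : ∀ p, p ∈ R₃ ↔ p.1 + p.2 + 2 ≤ d ∧ P₃ p.1 p.2)
    (hP₂ : ∀ i < m, ∀ j < m, P i (d + j) ↔ P₂ i j)
    (hP₃ : ∀ i < d, ∀ j < d, P (m + i) j ↔ P₃ i j) :
    (R₁ ++ R₂.map (fun p => (p.1, d + p.2)) ++ R₃.map (fun p => (m + p.1, p.2))).Nodup ∧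
    ∀ p, p ∈ R₁ ++ R₂.map (fun p => (p.1, d + p.2)) ++ R₃.map (fun p => (m + p.1, p.2)) ↔
      p.1 + p.2 + 2 ≤ n ∧ P p.1 p.2 := by
  have m₂ : ∀ i j, (i, j) ∈ R₂.map (fun p => (p.1, d + p.2)) ↔ ∃ b, j = d + b ∧ (i, b) ∈ R₂ := by
    intro i j
    simp only [List.mem_map, Prod.mk.injEq, Prod.exists]
    constructor
    · rintro ⟨a, b, h, rfl, rfl⟩
      exact ⟨b, rfl, h⟩
    · rintro ⟨b, rfl, h⟩
      exact ⟨i, b, h, rfl, rfl⟩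
  have m₃ : ∀ i j, (i, j) ∈ R₃.map (fun p => (m + p.1, p.2)) ↔ ∃ a, i = m + a ∧ (a, j) ∈ R₃ := by
    intro i j
    simp only [List.mem_map, Prod.mk.injEq, Prod.exists]
    constructor
    · rintro ⟨a, b, h, rfl, rfl⟩
      exact ⟨a, rfl, h⟩
    · rintro ⟨a, rfl, h⟩
      exact ⟨a, j, h, rfl, rfl⟩
  constructor
  · rw [List.nodup_append', List.nodup_append']
    refine ⟨⟨n₁, n₂.map fun p q h => ?_, ?_⟩, n₃.map fun p q h => ?_, ?_⟩
    · simpa [Prod.ext_iff] using h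
    · rintro ⟨i, j⟩ h1 h2
      obtain ⟨b, rfl, -⟩ := (m₂ i j).mp h2
      have := ((h₁ _).mp h1).2.1
      dsimp only at this
      omega
    · simpa [Prod.ext_iff] using h
    · rintro ⟨i, j⟩ h12 h3
      obtain ⟨a, rfl, -⟩ := (m₃ i j).mp h3
      rcases List.mem_append.mp h12 with h1 | h2
      · have := ((h₁ _).mp h1).1
        dsimp only at this
        omega
      · obtain ⟨b, rfl, hb⟩ := (m₂ _ j).mp h2
        have := ((h₂ _).mp hb).1
        dsimp only at this
        omega
  · rintro ⟨i, j⟩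
    rw [List.mem_append, List.mem_append, m₂, m₃, h₁]
    dsimp only
    constructor
    · rintro ((⟨hi, hj, hP⟩ | ⟨b, rfl, hb⟩) | ⟨a, rfl, ha⟩)
      · exact ⟨by omega, hP⟩
      · obtain ⟨hle, hP⟩ := (h₂ _).mp hb
        dsimp only at hle hP
        exact ⟨by omega, (hP₂ i (by omega) b (by omega)).mpr hP⟩
      · obtain ⟨hle, hP⟩ := (h₃ _).mp ha
        dsimp only at hle hP
        exact ⟨by omega, (hP₃ a (by omega) j (by omega)).mpr hP⟩
    · rintro ⟨hle, hP⟩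
      by_cases hi : i < m
      · by_cases hj : j < d
        · exact Or.inl (Or.inl ⟨hi, hj, hP⟩)
        · obtain ⟨b, rfl⟩ := Nat.exists_eq_add_of_le (not_lt.mp hj)
          refine Or.inl (Or.inr ⟨b, rfl, (h₂ _).mpr ⟨?_, ?_⟩⟩)
          · dsimp only
            omega
          · exact (hP₂ i hi b (by omega)).mp hP
      · obtain ⟨a, rfl⟩ := Nat.exists_eq_add_of_le (not_lt.mp hi)
        refine Or.inr ⟨a, rfl, (h₃ _).mpr ⟨?_, ?_⟩⟩
        · dsimp only
          omega
        · exact (hP₃ a (by omega) j (by omega)).mp hP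

section

variable {F : Type u} [Field F]

theorem lrk_le_leftQSOrder {n : ℕ} (A : Matrix (Fin n) (Fin n) F) {p q : ℕ} (hp : 1 ≤ p)
    (hq : 1 ≤ q) (hpq : p + q = n) : lrk (extendZero A) p q ≤ leftQSOrder A := by
  have h := Finset.le_sup (f := fun p => leadingRank A p (n - p))
    (Finset.mem_Icc.mpr ⟨hp, (by omega : p ≤ n - 1)⟩)
  rw [show n - p = q by omega, leadingRank_eq_lrk A (by omega) (by omega)] at h
  exact h

theorem leftQSOrder_le {n s : ℕ} (A : Matrix (Fin n) (Fin n) F)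
    (h : ∀ p q, 1 ≤ p → 1 ≤ q → p + q = n → lrk (extendZero A) p q ≤ s) :
    leftQSOrder A ≤ s := by
  refine Finset.sup_le fun p hp => ?_
  rw [Finset.mem_Icc] at hp
  rw [leadingRank_eq_lrk A (by omega) (by omega)]
  exact h p (n - p) hp.1 (by omega) (by omega)

end

theorem AddrMatrix.Valid.mono {F : Type u} {m n : ℕ} {X : AddrMatrix m n} {μ ν : List F} (h : X.Valid μ)
    (hν : μ <+: ν) : X.Valid ν := fun i j => (h i j).trans_le hν.length_le

section

variable {F : Type u} [Field F]

theorem AddrMatrix.Valid.load_eq {m n : ℕ} {X : AddrMatrix m n} {μ ν : List F} (h : X.Valid μ)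
    (hν : μ <+: ν) : X.load ν = X.load μ :=
  (AddrMatrix.valid_of_getElem? fun i j =>
    Prog.getElem?_of_prefix hν (AddrMatrix.getElem?_eq h i j)).2

namespace PLUQ.Decomposes

variable {m d : ℕ} {f : PLUQ m d} {μ : List F} {A₁ : Matrix (Fin m) (Fin d) F}

/-- The upper solver needs an invertible `U₁`, while `Decomposes` only asks for triangularity. The
pivot columns of `A₁` are independent, so the leading block of `U` has nonzero determinant, the
product of its diagonal. -/
theorem U_diag_ne_zero (h : f.Decomposes μ A₁) (t : Fin f.r) :
    f.U.load μ t ⟨t.1, t.2.trans_le f.r_le_cols⟩ ≠ 0 := by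
  have hli := (exists_row_combination (f := fun i j => extendZero A₁ j i) (m := d) (n := m)
    (fun t => (f.pivotCol t).1) (fun t => (f.pivotCol t).2)
    ((lrk_swap (extendZero A₁) d m).trans h.lrk_full)
    fun i hi hne => by
      rw [lrk_swap (extendZero A₁), lrk_swap (extendZero A₁), h.lrk_col_succ hi hne]).1
  have hdet := det_pivotRows_ne_zero (f := fun i j => extendZero A₁ j i) (m := d) (d := m)
    (fun t => (f.pivotCol t).1)
    (x := fun i t => if hi : i < d then f.U.load μ t (f.Q.symm ⟨i, hi⟩) else 0)
    (y := fun t j => if hj : j < m then f.L.load μ (f.P ⟨j, hj⟩) t else 0)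
    (fun t => (f.pivotCol t).2) hli fun i hi j hj => by
      rw [extendZero_apply _ hj hi, h.apply_eq]
      exact Finset.sum_congr rfl fun t _ => by rw [dif_pos hi, dif_pos hj, mul_comm]
  have hT : (Matrix.of fun s t : Fin f.r => if hi : (f.pivotCol s).1 < d then
      f.U.load μ t (f.Q.symm ⟨(f.pivotCol s).1, hi⟩) else 0) =
      Matrix.of fun s t : Fin f.r => f.U.load μ t ⟨s.1, s.2.trans_le f.r_le_cols⟩ := by
    ext s t
    simp [pivotCol]
  have hlow : (Matrix.of fun s t : Fin f.r =>
      f.U.load μ t ⟨s.1, s.2.trans_le f.r_le_cols⟩).IsLowerTriangular :=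
    fun s t hst => h.U_lower _ _ hst
  rw [hT, Matrix.det_of_isLowerTriangular _ hlow, Finset.prod_ne_zero_iff] at hdet
  exact hdet t (Finset.mem_univ t)

variable {n : ℕ} {a : ℕ → ℕ → F}

/-- The leading ranks to the right of a decomposed block. -/
theorem lrk_right (h : f.Decomposes μ A₁) (ha : ∀ i j, A₁ i j = a i j) {w : ℕ}
    {D : Matrix (Fin f.r) (Fin w) F} {H : Matrix (Fin m) (Fin w) F}
    (hD : ∀ (s : Fin f.r) (j : Fin w), ∑ t, f.L.load μ ⟨s.1, s.2.trans_le f.r_le_rows⟩ t * D t j =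
      a (f.pivotRow s) (d + j))
    (hH : ∀ i j, H i j = a i (d + j) - ∑ t, f.L.load μ (f.P i) t * D t j) (p : ℕ) (hp : p ≤ m)
    (q : ℕ) (hq : q ≤ w) : lrk a p (d + q) = lrk a p d + lrk (extendZero H) p q := by
  have hlrk : ∀ p ≤ m, lrk a p d = lrk (extendZero A₁) p d := fun p hp =>
    lrk_congr fun i hi j hj => by rw [extendZero_apply A₁ (by omega) hj, ha]
  refine lrk_eliminate (m := m) (w := w) (fun t => (f.pivotRow t).1)
    (x := fun i t => if hi : i < m then f.L.load μ (f.P ⟨i, hi⟩) t else 0)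
    (y := fun t j => if hj : j < d then f.U.load μ t (f.Q.symm ⟨j, hj⟩) else 0)
    (e := fun t j => if hj : j < w then D t ⟨j, hj⟩ else 0)
    (fun t => (f.pivotRow t).2) (by rw [hlrk m le_rfl, h.lrk_full])
    (fun i hi hne => by rw [hlrk _ hi, hlrk _ hi.le, h.lrk_row_succ hi hne])
    (fun i hi j hj => ?_) (fun s j hj => ?_) (fun i hi j hj => ?_) p hp q hq
  · have := h.apply_eq ⟨i, hi⟩ ⟨j, hj⟩
    rw [ha] at this
    rw [this]
    exact Finset.sum_congr rfl fun t _ => by rw [dif_pos hi, dif_pos hj]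
  · rw [← hD s ⟨j, hj⟩]
    exact Finset.sum_congr rfl fun t _ => by
      rw [dif_pos (f.pivotRow s).2, dif_pos hj, Fin.eta, pivotRow, Equiv.apply_symm_apply]
  · rw [extendZero_apply H hi hj, hH]
    congr 1
    exact Finset.sum_congr rfl fun t _ => by rw [dif_pos hi, dif_pos hj]

/-- The leading ranks below a decomposed block. -/
theorem lrk_below (h : f.Decomposes μ A₁) (ha : ∀ i j, A₁ i j = a i j) {w : ℕ}
    {E : Matrix (Fin w) (Fin f.r) F} {I : Matrix (Fin w) (Fin d) F}
    (hE : ∀ (i : Fin w) (s : Fin f.r), ∑ t, E i t * f.U.load μ t ⟨s.1, s.2.trans_le f.r_le_cols⟩ =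
      a (m + i) (f.pivotCol s))
    (hI : ∀ i j, I i j = a (m + i) j - ∑ t, E i t * f.U.load μ t (f.Q.symm j)) (p : ℕ)
    (hp : p ≤ w) (q : ℕ) (hq : q ≤ d) :
    lrk a (m + p) q = lrk a m q + lrk (extendZero I) p q := by
  have hlrk : ∀ q ≤ d, lrk (fun i j => a j i) q m = lrk (extendZero A₁) m q := fun q hq => by
    rw [lrk_swap a]
    exact lrk_congr fun i hi j hj => by rw [extendZero_apply A₁ hi (by omega), ha]
  have := lrk_eliminate (f := fun i j => a j i) (h := fun i j => extendZero I j i) (m := d)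
    (d := m) (w := w) (fun t => (f.pivotCol t).1)
    (x := fun i t => if hi : i < d then f.U.load μ t (f.Q.symm ⟨i, hi⟩) else 0)
    (y := fun t j => if hj : j < m then f.L.load μ (f.P ⟨j, hj⟩) t else 0)
    (e := fun t j => if hj : j < w then E ⟨j, hj⟩ t else 0)
    (fun t => (f.pivotCol t).2) (by rw [hlrk d le_rfl, h.lrk_full])
    (fun i hi hne => by rw [hlrk _ hi, hlrk _ hi.le, h.lrk_col_succ hi hne])
    (fun i hi j hj => ?_) (fun s j hj => ?_) (fun i hi j hj => ?_) q hq p hp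
  · rwa [lrk_swap a, lrk_swap a, lrk_swap (extendZero I)] at this
  · have := h.apply_eq ⟨j, hj⟩ ⟨i, hi⟩
    rw [ha] at this
    rw [this]
    exact Finset.sum_congr rfl fun t _ => by rw [dif_pos hi, dif_pos hj, mul_comm]
  · rw [← hE ⟨j, hj⟩ s]
    exact Finset.sum_congr rfl fun t _ => by
      rw [dif_pos (f.pivotCol s).2, dif_pos hj, Fin.eta, pivotCol, Equiv.symm_apply_apply,
        mul_comm]
  · rw [extendZero_apply I hj hi, hI]
    congr 1
    exact Finset.sum_congr rfl fun t _ => by rw [dif_pos hi, dif_pos hj, mul_comm]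

theorem mem_pivots_iff (h : f.Decomposes μ A₁) (ha : ∀ i j, A₁ i j = a i j) (p : ℕ × ℕ) :
    p ∈ List.ofFn (fun t : Fin f.r => ((f.pivotRow t).1, (f.pivotCol t).1)) ↔
      p.1 < m ∧ p.2 < d ∧ PivotAt a p.1 p.2 := by
  obtain ⟨i, j⟩ := p
  have hiff : ∀ {i j}, i < m → j < d → (PivotAt a i j ↔
      ∃ t : Fin f.r, (f.pivotRow t).1 = i ∧ (f.pivotCol t).1 = j) := fun {i j} hi hj =>
    pivotAt_iff_of_card (fun t : Fin f.r => (f.pivotRow t).1) (fun t => (f.pivotCol t).1)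
      (fun _ _ => pivotRow_injective) (fun p hp q hq => (lrk_congr fun i hi j hj => by
        rw [extendZero_apply A₁ (by omega) (by omega), ha]).trans (h.lrk_eq p hp q hq)) hi hj
  rw [List.mem_ofFn]
  simp only [Prod.mk.injEq]
  constructor
  · rintro ⟨t, rfl, rfl⟩
    exact ⟨(f.pivotRow t).2, (f.pivotCol t).2,
      (hiff (f.pivotRow t).2 (f.pivotCol t).2).mpr ⟨t, rfl, rfl⟩⟩
  · exact fun ⟨hi, hj, hP⟩ => (hiff hi hj).mp hP

end PLUQ.Decomposes

theorem PLUQ.nodup_pivots {m d : ℕ} (f : PLUQ m d) :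
    (List.ofFn (fun t : Fin f.r => ((f.pivotRow t).1, (f.pivotCol t).1))).Nodup :=
  List.nodup_ofFn.mpr fun _ _ h => pivotRow_injective (Prod.ext_iff.mp h).1

theorem Subroutines.CostOver.nonneg {k : Type u} [Field k] [Algebra k F] {S : Subroutines k}
    {ω c : ℝ} (h : S.CostOver F ω c) : 0 ≤ c := by
  have h1 := h.pluq_cost 1 1 (fun _ _ => 0) [0] (fun _ _ => by simp)
  have h2 := (Nat.cast_nonneg (α := ℝ) _).trans h1
  rw [Nat.cast_one, mul_one, mul_one] at h2
  exact nonneg_of_mul_nonneg_left h2 (Real.rpow_pos_of_pos (lt_max_of_lt_left one_pos) _)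

end

/-! ### Correctness and cost of LT-RPM. -/

section

variable {k F : Type u} [Field k] [Field F] [Algebra k F]

/-- Correctness and cost are proved in one induction, since both need the contents of the memory
between the calls. The exponent and the constant are quantified inside the conclusion, so that
correctness does not depend on any cost assumption. -/
theorem runs_ltRPM {S : Subroutines k} (hS : S.CorrectOver F) (n : ℕ) {A : AddrMatrix n n}
    {μ : List F} (hA : A.Valid μ) :
    (ltRPM S n A).Runs μ fun l _ t =>
      (l.Nodup ∧ ∀ p, p ∈ l ↔ p.1 + p.2 + 2 ≤ n ∧ PivotAt (extendZero (A.load μ)) p.1 p.2) ∧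
      ∀ ω c : ℝ, 2 < ω → S.CostOver F ω c →
        (t : ℝ) ≤ 15 * c * n ^ 2 * max 1 (leftQSOrder (A.load μ) : ℝ) ^ (ω - 2) := by
  induction n using Nat.strong_induction_on generalizing μ with
  | _ n ih =>
  rw [ltRPM]
  split_ifs with hn
  · refine Prog.runs_pure ⟨⟨List.nodup_nil, fun p => ?_⟩, fun ω c hω hc => ?_⟩
    · simp only [List.not_mem_nil, false_iff]
      omega
    · have := hc.nonneg
      rw [Nat.cast_zero]
      positivity
  have hdm : n / 2 ≤ n - n / 2 := by omega
  have hmd : n - n / 2 + n / 2 = n := by omega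
  set a := extendZero (A.load μ) with ha
  have hAa : ∀ i j (hi : i < n) (hj : j < n), μ[A ⟨i, hi⟩ ⟨j, hj⟩]? = some (a i j) :=
    fun i j hi hj => by
      rw [ha, extendZero_apply _ hi hj]
      exact AddrMatrix.getElem?_eq hA _ _
  let A₁ : AddrMatrix (n - n / 2) (n / 2) := fun i j => A ⟨i.1, by omega⟩ ⟨j.1, by omega⟩
  obtain ⟨vA₁, lA₁⟩ := AddrMatrix.valid_of_getElem? (X := A₁)
    (A := Matrix.of fun (i : Fin (n - n / 2)) (j : Fin (n / 2)) => a i j)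
    fun i j => hAa _ _ _ _
  have hpluq : (S.pluq _ _ A₁).Runs μ fun f ν t => f.Decomposes ν (A₁.load μ) ∧
      ∀ ω c, S.CostOver F ω c → (t : ℝ) ≤ c * (n - n / 2 : ℕ) * (n / 2 : ℕ) *
        max 1 ((A₁.load μ).rank : ℝ) ^ (ω - 2) :=
    ⟨hS.pluq_spec _ _ _ _ vA₁, fun ω c hc => hc.pluq_cost _ _ _ _ vA₁⟩
  refine Prog.Runs.bind hpluq ?_
  rintro f ν₁ t₁ hν₁ ⟨hf, ht₁⟩
  have hA₁ : ∀ i j, A₁.load μ i j = a i j := fun i j => by rw [lA₁]; rfl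
  have hr := f.r_le_rows
  have hrd := f.r_le_cols
  -- `D = L₁⁻¹ B₁`
  let L₁ : AddrMatrix f.r f.r := fun i j => f.L ⟨i.1, by omega⟩ j
  let B₁ : AddrMatrix f.r (n - n / 2) := fun t j =>
    A ⟨(f.pivotRow t).1, by omega⟩ ⟨n / 2 + j.1, by omega⟩
  have vL₁ : L₁.Valid ν₁ := fun i j => hf.valid_L _ _
  obtain ⟨vB₁, lB₁⟩ := AddrMatrix.valid_of_getElem? (X := B₁) (μ := ν₁)
    (A := Matrix.of fun (t : Fin f.r) (j : Fin (n - n / 2)) => a (f.pivotRow t) (n / 2 + j))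
    fun i j => Prog.getElem?_of_prefix hν₁ (hAa _ _ _ _)
  have hL1 : ∀ i, L₁.load ν₁ i i = 1 := fun i => hf.L_diag _ _ rfl
  have hL0 : ∀ i j, i < j → L₁.load ν₁ i j = 0 := fun i j hij => hf.L_upper _ _ hij
  have hDrun : (S.lowerSolve _ _ L₁ B₁).Runs ν₁ fun D ν t =>
      (D.Valid ν ∧ D.load ν = (L₁.load ν₁)⁻¹ * B₁.load ν₁) ∧ ∀ ω c, S.CostOver F ω c →
        (t : ℝ) ≤ c * max (f.r : ℝ) (n - n / 2 : ℕ) * (f.r : ℝ) ^ (ω - 1) :=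
    ⟨hS.lowerSolve_spec _ _ _ _ _ vL₁ vB₁ hL1 hL0,
      fun ω c hc => hc.lowerSolve_cost _ _ _ _ _ vL₁ vB₁ hL1 hL0⟩
  refine Prog.Runs.bind hDrun ?_
  rintro D ν₂ t₂ hν₂ ⟨⟨vD, lD⟩, ht₂⟩
  have hD : ∀ (s : Fin f.r) (j : Fin (n - n / 2)),
      ∑ t, f.L.load ν₁ ⟨s.1, s.2.trans_le f.r_le_rows⟩ t * D.load ν₂ t j =
        a (f.pivotRow s) (n / 2 + j) := by
    intro s j
    have hdet : IsUnit (L₁.load ν₁).det := by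
      rw [Matrix.det_of_isLowerTriangular _ fun i j hij => hL0 i j hij]
      simp [hL1]
    have := congrFun (congrFun (Matrix.mul_nonsing_inv_cancel_left _ (B₁.load ν₁) hdet) s) j
    rw [← lD, Matrix.mul_apply] at this
    rw [lB₁] at this
    exact this
  -- `E = C₁ U₁⁻¹`
  let U₁ : AddrMatrix f.r f.r := fun i j => f.U i ⟨j.1, by omega⟩
  let C₁ : AddrMatrix (n / 2) f.r := fun i t =>
    A ⟨n - n / 2 + i.1, by omega⟩ ⟨(f.pivotCol t).1, by omega⟩
  have vU₁' : U₁.Valid ν₁ := fun i j => hf.valid_U _ _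
  have vU₁ : U₁.Valid ν₂ := vU₁'.mono hν₂
  have lU₁ : U₁.load ν₂ = U₁.load ν₁ := vU₁'.load_eq hν₂
  obtain ⟨vC₁, lC₁⟩ := AddrMatrix.valid_of_getElem? (X := C₁) (μ := ν₂)
    (A := Matrix.of fun (i : Fin (n / 2)) (t : Fin f.r) => a (n - n / 2 + i) (f.pivotCol t))
    fun i j => Prog.getElem?_of_prefix (hν₁.trans hν₂) (hAa _ _ _ _)
  have hU1 : ∀ i, U₁.load ν₂ i i ≠ 0 := fun i => by rw [lU₁]; exact hf.U_diag_ne_zero i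
  have hU0 : ∀ i j, j < i → U₁.load ν₂ i j = 0 := fun i j hij => by
    rw [lU₁]
    exact hf.U_lower _ _ hij
  have hErun : (S.upperSolve _ _ C₁ U₁).Runs ν₂ fun E ν t =>
      (E.Valid ν ∧ E.load ν = C₁.load ν₂ * (U₁.load ν₂)⁻¹) ∧ ∀ ω c, S.CostOver F ω c →
        (t : ℝ) ≤ c * max (f.r : ℝ) (n / 2 : ℕ) * (f.r : ℝ) ^ (ω - 1) :=
    ⟨hS.upperSolve_spec _ _ _ _ _ vC₁ vU₁ hU1 hU0,
      fun ω c hc => hc.upperSolve_cost _ _ _ _ _ vC₁ vU₁ hU1 hU0⟩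
  refine Prog.Runs.bind hErun ?_
  rintro E ν₃ t₃ hν₃ ⟨⟨vE, lE⟩, ht₃⟩
  have hE : ∀ (i : Fin (n / 2)) (s : Fin f.r),
      ∑ t, E.load ν₃ i t * f.U.load ν₁ t ⟨s.1, s.2.trans_le f.r_le_cols⟩ =
        a (n - n / 2 + i) (f.pivotCol s) := by
    intro i s
    have hdet : IsUnit (U₁.load ν₂).det := by
      rw [Matrix.det_of_isUpperTriangular fun i j hij => hU0 i j hij, isUnit_iff_ne_zero,
        Finset.prod_ne_zero_iff]
      exact fun i _ => hU1 i
    have := congrFun (congrFun (Matrix.nonsing_inv_mul_cancel_right _ (C₁.load ν₂) hdet) i) s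
    rw [← lE, Matrix.mul_apply] at this
    rw [lU₁, lC₁] at this
    exact this
  -- `F = B₂ - M₁ D`
  let M₁ : AddrMatrix (n - n / 2 - f.r) f.r := fun i j => f.L ⟨f.r + i.1, by omega⟩ j
  let B₂ : AddrMatrix (n - n / 2 - f.r) (n - n / 2) := fun t j =>
    A ⟨(f.P.symm ⟨f.r + t.1, by omega⟩).1, by omega⟩ ⟨n / 2 + j.1, by omega⟩
  have vM₁' : M₁.Valid ν₁ := fun i j => hf.valid_L _ _
  obtain ⟨vB₂, lB₂⟩ := AddrMatrix.valid_of_getElem? (X := B₂) (μ := ν₃)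
    (A := Matrix.of fun (t : Fin (n - n / 2 - f.r)) (j : Fin (n - n / 2)) =>
      a (f.P.symm ⟨f.r + t.1, by omega⟩) (n / 2 + j))
    fun i j => Prog.getElem?_of_prefix ((hν₁.trans hν₂).trans hν₃) (hAa _ _ _ _)
  have hGrun : (S.subMul _ _ _ B₂ M₁ D).Runs ν₃ fun Z ν t =>
      (Z.Valid ν ∧ Z.load ν = B₂.load ν₃ - M₁.load ν₃ * D.load ν₃) ∧ ∀ ω c, S.CostOver F ω c →
        (t : ℝ) ≤ c * ((n - n / 2 - f.r : ℕ) + f.r) * ((n - n / 2 : ℕ) + f.r) *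
          max 1 (f.r : ℝ) ^ (ω - 2) :=
    ⟨hS.subMul_spec _ _ _ _ _ _ _ vB₂ (vM₁'.mono (hν₂.trans hν₃)) (vD.mono hν₃),
      fun ω c hc => hc.subMul_cost _ _ _ _ _ _ _ vB₂ (vM₁'.mono (hν₂.trans hν₃)) (vD.mono hν₃)⟩
  refine Prog.Runs.bind hGrun ?_
  rintro Z ν₄ t₄ hν₄ ⟨⟨vZ, lZ⟩, ht₄⟩
  rw [lB₂, vM₁'.load_eq (hν₂.trans hν₃), vD.load_eq hν₃] at lZ
  -- `G = C₂ - E V₁`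
  let V₁ : AddrMatrix f.r (n / 2 - f.r) := fun i j => f.U i ⟨f.r + j.1, by omega⟩
  let C₂ : AddrMatrix (n / 2) (n / 2 - f.r) := fun i t =>
    A ⟨n - n / 2 + i.1, by omega⟩ ⟨(f.Q ⟨f.r + t.1, by omega⟩).1, by omega⟩
  have vV₁' : V₁.Valid ν₁ := fun i j => hf.valid_U _ _
  have h14 := (hν₂.trans hν₃).trans hν₄
  obtain ⟨vC₂, lC₂⟩ := AddrMatrix.valid_of_getElem? (X := C₂) (μ := ν₄)
    (A := Matrix.of fun (i : Fin (n / 2)) (t : Fin (n / 2 - f.r)) =>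
      a (n - n / 2 + i) (f.Q ⟨f.r + t.1, by omega⟩))
    fun i j => Prog.getElem?_of_prefix (hν₁.trans h14) (hAa _ _ _ _)
  have hWrun : (S.subMul _ _ _ C₂ E V₁).Runs ν₄ fun W ν t =>
      (W.Valid ν ∧ W.load ν = C₂.load ν₄ - E.load ν₄ * V₁.load ν₄) ∧ ∀ ω c, S.CostOver F ω c →
        (t : ℝ) ≤ c * ((n / 2 : ℕ) + f.r) * ((n / 2 - f.r : ℕ) + f.r) *
          max 1 (f.r : ℝ) ^ (ω - 2) :=
    ⟨hS.subMul_spec _ _ _ _ _ _ _ vC₂ (vE.mono hν₄) (vV₁'.mono h14),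
      fun ω c hc => hc.subMul_cost _ _ _ _ _ _ _ vC₂ (vE.mono hν₄) (vV₁'.mono h14)⟩
  refine Prog.Runs.bind hWrun ?_
  rintro W ν₅ t₅ hν₅ ⟨⟨vW, lW⟩, ht₅⟩
  rw [lC₂, vV₁'.load_eq h14, vE.load_eq hν₄] at lW
  refine Prog.Runs.bind (Prog.runs_const 0 ν₅) ?_
  rintro z ν₆ t₆ hν₆ ⟨hz, rfl⟩
  rw [map_zero] at hz
  -- the two recursive calls
  let H : AddrMatrix (n - n / 2) (n - n / 2) := fun i j =>
    if h : f.r ≤ (f.P i).1 then Z ⟨(f.P i).1 - f.r, by omega⟩ j else z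
  -- One formula describes every row of `H`: at the pivot rows the difference is zero because `L₁ *
  -- D = B₁`, in agreement with the zero cell stored there. The same holds for the pivot columns of
  -- `I`.
  obtain ⟨vH, lH⟩ := AddrMatrix.valid_of_getElem? (X := H) (μ := ν₆)
    (A := Matrix.of fun i j : Fin (n - n / 2) =>
      a i (n / 2 + j) - ∑ t, f.L.load ν₁ (f.P i) t * D.load ν₂ t j) (fun i j => by
    by_cases h : f.r ≤ (f.P i).1
    · have hZ := AddrMatrix.getElem?_eq vZ ⟨(f.P i).1 - f.r, by omega⟩ j
      have hi : (⟨f.r + ((f.P i).1 - f.r), by omega⟩ : Fin (n - n / 2)) = f.P i :=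
        Fin.ext (by dsimp only; omega)
      rw [lZ, Matrix.sub_apply, Matrix.mul_apply, Matrix.of_apply, hi,
        Equiv.symm_apply_apply] at hZ
      have hM : ∀ t, M₁.load ν₁ ⟨(f.P i).1 - f.r, by omega⟩ t = f.L.load ν₁ (f.P i) t :=
        fun t => congrArg (fun x => f.L.load ν₁ x t) hi
      simp only [hM] at hZ
      simp only [H, dif_pos h, Matrix.of_apply]
      exact Prog.getElem?_of_prefix (hν₅.trans hν₆) hZ
    · have hi := hD ⟨(f.P i).1, by omega⟩ j
      simp only [PLUQ.pivotRow, Fin.eta, Equiv.symm_apply_apply] at hi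
      simp only [H, dif_neg h, Matrix.of_apply, hi, sub_self]
      exact hz)
  let I : AddrMatrix (n / 2) (n / 2) := fun i j =>
    if h : f.r ≤ (f.Q.symm j).1 then W i ⟨(f.Q.symm j).1 - f.r, by omega⟩ else z
  obtain ⟨vI, lI⟩ := AddrMatrix.valid_of_getElem? (X := I) (μ := ν₆)
    (A := Matrix.of fun i j : Fin (n / 2) =>
      a (n - n / 2 + i) j - ∑ t, E.load ν₃ i t * f.U.load ν₁ t (f.Q.symm j)) (fun i j => by
    by_cases h : f.r ≤ (f.Q.symm j).1
    · have hW := AddrMatrix.getElem?_eq vW i ⟨(f.Q.symm j).1 - f.r, by omega⟩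
      have hj : (⟨f.r + ((f.Q.symm j).1 - f.r), by omega⟩ : Fin (n / 2)) = f.Q.symm j :=
        Fin.ext (by dsimp only; omega)
      rw [lW, Matrix.sub_apply, Matrix.mul_apply, Matrix.of_apply, hj,
        Equiv.apply_symm_apply] at hW
      have hV : ∀ t, V₁.load ν₁ t ⟨(f.Q.symm j).1 - f.r, by omega⟩ =
          f.U.load ν₁ t (f.Q.symm j) := fun t => congrArg (fun x => f.U.load ν₁ t x) hj
      simp only [hV] at hW
      simp only [I, dif_pos h, Matrix.of_apply]
      exact Prog.getElem?_of_prefix hν₆ hW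
    · have hj := hE i ⟨(f.Q.symm j).1, by omega⟩
      simp only [PLUQ.pivotCol, Fin.eta, Equiv.apply_symm_apply] at hj
      simp only [I, dif_neg h, Matrix.of_apply, hj, sub_self]
      exact hz)
  have hright := hf.lrk_right hA₁ hD (H := H.load ν₆) fun i j => by rw [lH]; rfl
  have hbelow := hf.lrk_below hA₁ hE (I := I.load ν₆) fun i j => by rw [lI]; rfl
  refine Prog.Runs.bind (ih (n - n / 2) (by omega) vH) ?_
  rintro R₂ ν₇ t₇ hν₇ ⟨⟨nd₂, mem₂⟩, ht₇⟩
  refine Prog.Runs.bind (ih (n / 2) (by omega) (vI.mono hν₇)) ?_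
  rintro R₃ ν₈ t₈ hν₈ ⟨⟨nd₃, mem₃⟩, ht₈⟩
  rw [vI.load_eq hν₇] at mem₃ ht₈
  refine Prog.runs_pure ⟨?_, ?_⟩
  · exact nodup_and_mem_of_blocks hmd f.nodup_pivots nd₂ nd₃ (hf.mem_pivots_iff hA₁) mem₂ mem₃
      (fun i hi j hj => pivotAt_eliminate hright hi hj)
      fun i hi j hj => by
        rw [← pivotAt_swap (f := a), ← pivotAt_swap (f := extendZero (I.load ν₆))]
        refine pivotAt_eliminate (m := n / 2) (w := n / 2) (fun p hp q hq => ?_) hj hi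
        rw [lrk_swap a, lrk_swap a, lrk_swap (extendZero (I.load ν₆))]
        exact hbelow q hq p hp
  · intro ω c hω hc
    have hc0 := hc.nonneg
    set s := leftQSOrder (A.load μ) with hs
    have hsle : ∀ p q, 1 ≤ p → 1 ≤ q → p + q = n → lrk a p q ≤ s := fun p q hp hq hpq =>
      lrk_le_leftQSOrder (A.load μ) hp hq hpq
    have hrank : (A₁.load μ).rank = f.r := hf.r_eq_rank.symm
    -- `A₁` is the leading `m × d` block with `m + d = n`, one of those whose rank `s` bounds.
    have hrs : f.r ≤ s := by
      refine le_of_eq_of_le ?_ (hsle (n - n / 2) (n / 2) (by omega) (by omega) hmd)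
      rw [← hf.lrk_full]
      exact lrk_congr fun i hi j hj => by rw [extendZero_apply _ hi hj, hA₁]
    -- A `p × q` block of `H` with `p + q = m` has rank at most that of the `p × (d + q)` block of
    -- `A`, and `p + (d + q) = n`.
    have hHs : leftQSOrder (H.load ν₆) ≤ s := leftQSOrder_le _ fun p q hp hq hpq => by
      have h1 := hright p (by omega) q (by omega)
      have h2 := hsle p (n / 2 + q) hp (by omega) (by omega)
      omega
    have hIs : leftQSOrder (I.load ν₆) ≤ s := leftQSOrder_le _ fun p q hp hq hpq => by
      have h1 := hbelow p (by omega) q (by omega)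
      have h2 := hsle (n - n / 2 + p) q (by omega) hq (by omega)
      omega
    have hpow : ∀ q ≤ s, max 1 (q : ℝ) ^ (ω - 2) ≤ max 1 (s : ℝ) ^ (ω - 2) := fun q hq =>
      Real.rpow_le_rpow (le_max_of_le_left zero_le_one)
        (max_le_max le_rfl (Nat.cast_le.mpr hq)) (by linarith)
    have hpowr : (f.r : ℝ) ^ (ω - 2) ≤ max 1 (s : ℝ) ^ (ω - 2) :=
      (Real.rpow_le_rpow (Nat.cast_nonneg _) (le_max_right _ _) (by linarith)).trans
        (hpow _ hrs)
    have hR0 : 0 ≤ max 1 (s : ℝ) ^ (ω - 2) := by positivity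
    have g1 := ht₁ ω c hc
    have g2 := ht₂ ω c hc
    have g3 := ht₃ ω c hc
    have g4 := ht₄ ω c hc
    have g5 := ht₅ ω c hc
    have g7 := ht₇ ω c hω hc
    have g8 := ht₈ ω c hω hc
    rw [rpow_sub_one_eq_mul (Nat.cast_nonneg _) hω] at g2 g3
    have hrm' : (f.r : ℝ) ≤ (n - n / 2 : ℕ) := Nat.cast_le.mpr hr
    have hrd' : (f.r : ℝ) ≤ (n / 2 : ℕ) := Nat.cast_le.mpr hrd
    have e4 : ((n - n / 2 - f.r : ℕ) : ℝ) + f.r = (n - n / 2 : ℕ) := by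
      rw [← Nat.cast_add, Nat.sub_add_cancel hr]
    have e5 : ((n / 2 - f.r : ℕ) : ℝ) + f.r = (n / 2 : ℕ) := by
      rw [← Nat.cast_add, Nat.sub_add_cancel hrd]
    rw [max_eq_right hrm'] at g2
    rw [max_eq_right hrd'] at g3
    rw [e4] at g4
    rw [e5] at g5
    rw [hrank] at g1
    have hadd := natCast_half_add n
    obtain ⟨hd3, hm3⟩ := natCast_half_le (by omega : 2 ≤ n)
    have hr0 : (0 : ℝ) ≤ f.r := Nat.cast_nonneg _
    have hd0 : (0 : ℝ) ≤ (n / 2 : ℕ) := Nat.cast_nonneg _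
    have hm0 : (0 : ℝ) ≤ (n - n / 2 : ℕ) := Nat.cast_nonneg _
    have p1 := hpow _ hrs
    have p2 := hpow _ hHs
    have p3 := hpow _ hIs
    push_cast
    generalize ((n - n / 2 : ℕ) : ℝ) = m at *
    generalize ((n / 2 : ℕ) : ℝ) = d at *
    generalize max 1 (s : ℝ) ^ (ω - 2) = R at *
    -- Each of the five calls costs at most `c * n * n * R`. As `m² + d² ≤ 2/3 * n * (m + d)`, the
    -- constant `15` solves `5 + 2/3 * 15 = 15`.
    have key : ∀ x y X : ℝ, 0 ≤ x → x ≤ n → 0 ≤ y → y ≤ n → 0 ≤ X → X ≤ R →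
        c * x * y * X ≤ c * n * n * R := fun x y X _ _ _ _ _ _ => by gcongr
    have hX0 : 0 ≤ max 1 (f.r : ℝ) ^ (ω - 2) := by positivity
    have hx0 : 0 ≤ (f.r : ℝ) ^ (ω - 2) := by positivity
    have b1 := key m d _ hm0 (by linarith) hd0 (by linarith) hX0 p1
    have b2 := key m f.r _ hm0 (by linarith) hr0 (by linarith) hx0 hpowr
    have b3 := key d f.r _ hd0 (by linarith) hr0 (by linarith) hx0 hpowr
    have b4 := key m (m + f.r) _ hm0 (by linarith) (by linarith) (by linarith) hX0 p1
    have b5 := key (d + f.r) d _ (by linarith) (by linarith) hd0 (by linarith) hX0 p1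
    have hcR : 0 ≤ 15 * c * R := by positivity
    have b7 : 15 * c * m ^ 2 * max 1 (leftQSOrder (H.load ν₆) : ℝ) ^ (ω - 2) ≤
        15 * c * R * (2 / 3 * n * m) := by
      calc _ ≤ 15 * c * m ^ 2 * R := by gcongr
        _ = 15 * c * R * (m * m) := by ring
        _ ≤ _ := by gcongr
    have b8 : 15 * c * d ^ 2 * max 1 (leftQSOrder (I.load ν₆) : ℝ) ^ (ω - 2) ≤
        15 * c * R * (2 / 3 * n * d) := by
      calc _ ≤ 15 * c * d ^ 2 * R := by gcongr
        _ = 15 * c * R * (d * d) := by ring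
        _ ≤ _ := by gcongr
    have b78 : 15 * c * R * (2 / 3 * n * m) + 15 * c * R * (2 / 3 * n * d) =
        10 * (c * n * n * R) := by
      rw [← hadd]
      ring
    linarith

end

/-! ## The scan of QS-order -/

/-- The number of pivots in the leading `p × (n - p)` block. -/
def leadingCount (n : ℕ) (l : List (ℕ × ℕ)) (p : ℕ) : ℕ :=
  (l.toFinset.filter fun x => x.1 < p ∧ x.2 < n - p).card

theorem foldl_scanMark (l : List (ℕ × ℕ)) (st : ScanState) :
    (l.foldl scanMark st).s = st.s ∧ (l.foldl scanMark st).r = st.r ∧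
    (l.foldl scanMark st).steps = st.steps + 2 * l.length ∧
    (∀ i, (l.foldl scanMark st).rows i = true ↔ st.rows i = true ∨ ∃ p ∈ l, p.1 = i) ∧
    ∀ j, (l.foldl scanMark st).cols j = true ↔ st.cols j = true ∨ ∃ p ∈ l, p.2 = j := by
  induction l generalizing st with
  | nil => simp
  | cons p l ih =>
    obtain ⟨h1, h2, h3, h4, h5⟩ := ih (scanMark st p)
    rw [List.foldl_cons]
    refine ⟨h1, h2, ?_, fun i => ?_, fun j => ?_⟩
    · rw [h3, List.length_cons, scanMark]
      ring
    · rw [h4, scanMark]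
      by_cases hi : i = p.1
      · simp [hi]
      · simp [Function.update_of_ne hi, Ne.symm hi]
    · rw [h5, scanMark]
      by_cases hj : j = p.2
      · simp [hj]
      · simp [Function.update_of_ne hj, Ne.symm hj]

theorem sum_ite_eq_of_unique {l : List (ℕ × ℕ)} (g : ℕ × ℕ → ℕ)
    (hg : ∀ p ∈ l, ∀ q ∈ l, g p = g q → p = q) (i : ℕ) {b : Bool}
    (hb : b = true ↔ ∃ p ∈ l, g p = i) :
    ∑ x ∈ l.toFinset, (if g x = i then 1 else 0) = if b then 1 else 0 := by
  cases b with
  | false =>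
    rw [if_neg (by simp), Finset.sum_eq_zero]
    intro x hx
    refine if_neg fun h => ?_
    have := hb.mpr ⟨x, List.mem_toFinset.mp hx, h⟩
    cases this
  | true =>
    obtain ⟨p, hp, rfl⟩ := hb.mp rfl
    rw [Finset.sum_eq_single p]
    · simp
    · exact fun q hq hne => if_neg fun h => hne (hg q (List.mem_toFinset.mp hq) p hp h)
    · exact fun h => absurd (List.mem_toFinset.mpr hp) h

/-- All pivots lie in the left triangle: one in row `m` already has its column among the first `n -
(m + 1)`, and one in column `n - 1 - m` has its row above `m`. So the block gains exactly the pivot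
of that row and loses exactly the pivot of that column. -/
theorem leadingCount_succ {n m : ℕ} {l : List (ℕ × ℕ)} (hlt : ∀ p ∈ l, p.1 + p.2 + 2 ≤ n)
    (hm : m < n - 1) :
    leadingCount n l (m + 1) + ∑ x ∈ l.toFinset, (if x.2 = n - 1 - m then 1 else 0) =
      leadingCount n l m + ∑ x ∈ l.toFinset, (if x.1 = m then 1 else 0) := by
  unfold leadingCount
  rw [Finset.card_filter, Finset.card_filter, ← Finset.sum_add_distrib, ← Finset.sum_add_distrib]
  refine Finset.sum_congr rfl fun x hx => ?_
  have := hlt x (List.mem_toFinset.mp hx)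
  split_ifs <;> omega

theorem scan_eq {n : ℕ} {l : List (ℕ × ℕ)} (hrow : ∀ p ∈ l, ∀ q ∈ l, p.1 = q.1 → p = q)
    (hcol : ∀ p ∈ l, ∀ q ∈ l, p.2 = q.2 → p = q) (hlt : ∀ p ∈ l, p.1 + p.2 + 2 ≤ n) :
    (scan n l).s = ((Finset.Icc 1 (n - 1)).sup (leadingCount n l) : ℕ) ∧
    (scan n l).steps = 2 * n + 2 + 2 * l.length + 5 * (n - 1) := by
  obtain ⟨h1, h2, h3, h4, h5⟩ := foldl_scanMark l (scanInit n)
  unfold scan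
  generalize l.foldl scanMark (scanInit n) = st at *
  have hinv : ∀ m ≤ n - 1,
      ((List.range m).foldl (scanStep n) st).rows = st.rows ∧
      ((List.range m).foldl (scanStep n) st).cols = st.cols ∧
      ((List.range m).foldl (scanStep n) st).r = leadingCount n l m ∧
      ((List.range m).foldl (scanStep n) st).s =
        ((Finset.Icc 1 m).sup (leadingCount n l) : ℕ) ∧
      ((List.range m).foldl (scanStep n) st).steps = st.steps + 5 * m := by
    intro m
    induction m with
    | zero =>
      intro _
      simp [h1, h2, scanInit, leadingCount]
    | succ m ih =>
      intro hm
      obtain ⟨i1, i2, i3, i4, i5⟩ := ih (by omega)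
      rw [List.range_succ, List.foldl_append, List.foldl_cons, List.foldl_nil]
      generalize (List.range m).foldl (scanStep n) st = st' at *
      have hr : (scanStep n st' m).r = leadingCount n l (m + 1) := by
        have hs := leadingCount_succ hlt (by omega : m < n - 1)
        rw [sum_ite_eq_of_unique Prod.snd hcol (n - 1 - m) (b := st.cols (n - 1 - m))
            (by simpa [scanInit] using h5 (n - 1 - m)),
          sum_ite_eq_of_unique Prod.fst hrow m (b := st.rows m)
            (by simpa [scanInit] using h4 m)] at hs
        simp only [scanStep, i1, i2, i3]
        split_ifs at hs ⊢ <;> omega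
      refine ⟨i1, i2, hr, ?_, ?_⟩
      · have : (scanStep n st' m).s = max st'.s (scanStep n st' m).r := rfl
        rw [this, hr, i4, ← Finset.insert_Icc_right_eq_Icc_add_one (by omega), Finset.sup_insert,
          max_comm, Nat.cast_max]
      · have : (scanStep n st' m).steps = st'.steps + 5 := rfl
        rw [this, i5]
        ring
  obtain ⟨-, -, -, h6, h7⟩ := hinv (n - 1) le_rfl
  refine ⟨h6, ?_⟩
  rw [h7, h3]
  simp [scanInit]

theorem length_le_of_rows {n : ℕ} {l : List (ℕ × ℕ)} (hl : l.Nodup)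
    (hrow : ∀ p ∈ l, ∀ q ∈ l, p.1 = q.1 → p = q) (hlt : ∀ p ∈ l, p.1 + p.2 + 2 ≤ n) :
    l.length ≤ n := by
  rw [← List.toFinset_card_of_nodup hl, ← Finset.card_range n]
  refine Finset.card_le_card_of_injOn Prod.fst (fun p hp => ?_) fun p hp q hq => ?_
  · have := hlt p (List.mem_toFinset.mp hp)
    simp only [Finset.coe_range, Set.mem_Iio]
    omega
  · exact hrow p (List.mem_toFinset.mp hp) q (List.mem_toFinset.mp hq)

/-! ## Correctness of both algorithms -/

section

variable {k F : Type u} [Field k] [Field F] [Algebra k F]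

theorem ltRPM_isPivotList {S : Subroutines k} (hS : S.CorrectOver F) {n : ℕ} {A : AddrMatrix n n}
    {μ : List F} (hA : A.Valid μ) {R : Matrix (Fin n) (Fin n) F}
    (hR : IsRankProfileMatrix (A.load μ) R) :
    IsPivotList ((ltRPM S n A).val μ) (leftPart R) := by
  classical
  obtain ⟨⟨hnd, hmem⟩, -⟩ := runs_ltRPM hS n hA
  refine ⟨hnd, fun p hp => ?_, fun i j => ?_⟩
  · have := ((hmem p).mp hp).1
    omega
  · rw [leftPart, Matrix.of_apply, hR.apply_eq, ← ite_and]
    refine if_congr ?_ rfl rfl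
    rw [hmem]
    exact and_congr_left fun _ => by dsimp only; omega

theorem scan_ltRPM {S : Subroutines k} (hS : S.CorrectOver F) {n : ℕ} {A : AddrMatrix n n}
    {μ : List F} (hA : A.Valid μ) :
    (scan n ((ltRPM S n A).val μ)).s = (leftQSOrder (A.load μ) : ℤ) ∧
    (scan n ((ltRPM S n A).val μ)).steps ≤ 9 * (n + 1) := by
  classical
  obtain ⟨⟨hnd, hmem⟩, -⟩ := runs_ltRPM hS n hA
  -- A decomposition of the whole matrix is used only in the proof: it shows that pivots lie in
  -- distinct rows and columns and that leading ranks count them.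
  have hd := hS.pluq_spec n n A μ hA
  generalize (ltRPM S n A).val μ = l at *
  generalize (S.pluq n n A).val μ = f at *
  have hpiv : ∀ p, p ∈ l ↔ p.1 + p.2 + 2 ≤ n ∧
      ∃ t : Fin f.r, ((f.pivotRow t).1, (f.pivotCol t).1) = p := by
    intro p
    rw [hmem, ← List.mem_ofFn, hd.mem_pivots_iff (a := extendZero (A.load μ)) fun i j =>
      (extendZero_apply _ i.2 j.2).symm]
    refine and_congr_right fun h => ?_
    have h1 : p.1 < n := by omega
    have h2 : p.2 < n := by omega
    simp [h1, h2]
  have hrow : ∀ p ∈ l, ∀ q ∈ l, p.1 = q.1 → p = q := by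
    intro p hp q hq hpq
    obtain ⟨-, s, rfl⟩ := (hpiv p).mp hp
    obtain ⟨-, t, rfl⟩ := (hpiv q).mp hq
    rw [PLUQ.pivotRow_injective hpq]
  have hcol : ∀ p ∈ l, ∀ q ∈ l, p.2 = q.2 → p = q := by
    intro p hp q hq hpq
    obtain ⟨-, s, rfl⟩ := (hpiv p).mp hp
    obtain ⟨-, t, rfl⟩ := (hpiv q).mp hq
    rw [PLUQ.pivotCol_injective hpq]
  have hlt : ∀ p ∈ l, p.1 + p.2 + 2 ≤ n := fun p hp => ((hpiv p).mp hp).1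
  obtain ⟨h1, h2⟩ := scan_eq hrow hcol hlt
  constructor
  · rw [h1, leftQSOrder]
    congr 1
    refine Finset.sup_congr rfl fun p hp => ?_
    rw [Finset.mem_Icc] at hp
    rw [leadingRank_eq_lrk _ (by omega) (by omega), hd.lrk_eq p (by omega) (n - p) (by omega),
      Nat.card_eq_fintype_card, Fintype.card_subtype, leadingCount]
    symm
    refine Finset.card_bij (fun t _ => ((f.pivotRow t).1, (f.pivotCol t).1)) ?_ ?_ ?_
    · intro t ht
      rw [Finset.mem_filter] at ht ⊢
      exact ⟨List.mem_toFinset.mpr ((hpiv _).mpr ⟨by dsimp only; omega, t, rfl⟩), ht.2⟩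
    · exact fun s _ t _ hst => PLUQ.pivotRow_injective (Prod.ext_iff.mp hst).1
    · intro q hq
      rw [Finset.mem_filter] at hq
      obtain ⟨-, t, rfl⟩ := (hpiv q).mp (List.mem_toFinset.mp hq.1)
      exact ⟨t, Finset.mem_filter.mpr ⟨Finset.mem_univ t, hq.2⟩, rfl⟩
  · have := length_le_of_rows hnd hrow hlt
    omega

theorem qsOrder_val (S : Subroutines k) {n : ℕ} (A : AddrMatrix n n) (μ : List F) :
    (qsOrder S n A).val μ =
      ((scan n ((ltRPM S n A).val μ)).s, (scan n ((ltRPM S n A).val μ)).steps) := by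
  rw [qsOrder, Prog.val, Prog.exec_bind]
  rfl

theorem qsOrder_cost (S : Subroutines k) {n : ℕ} (A : AddrMatrix n n) (μ : List F) :
    (qsOrder S n A).cost μ = (ltRPM S n A).cost μ := by
  rw [qsOrder, Prog.cost_bind]
  rfl

end

/-! ## Quasiseparable orders -/

section

variable {F : Type u} [Field F]

/-- Reversal maps the first `p` indices to the last `p` ones. -/
def revSubtypeEquiv {n p q : ℕ} (h : p + q = n) :
    {x : Fin n // x.1 < p} ≃ {x : Fin n // q ≤ x.1} where
  toFun x := ⟨Fin.rev x.1, by have := x.2; rw [Fin.val_rev]; omega⟩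
  invFun x := ⟨Fin.rev x.1, by have := x.2; have := x.1.2; rw [Fin.val_rev]; omega⟩
  left_inv x := Subtype.ext (Fin.rev_rev _)
  right_inv x := Subtype.ext (Fin.rev_rev _)

theorem antidiag_mul_apply {n : ℕ} (L : Matrix (Fin n) (Fin n) F) (i j : Fin n) :
    (antidiag F n * L) i j = L (Fin.rev i) j := by
  simp [antidiag, Matrix.mul_apply]

theorem mul_antidiag_apply {n : ℕ} (U : Matrix (Fin n) (Fin n) F) (i j : Fin n) :
    (U * antidiag F n) i j = U i (Fin.rev j) := by
  simp [antidiag, Matrix.mul_apply, ← Fin.rev_eq_iff]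

/-- Reversing the rows turns the last `p` rows and first `q` columns, with `p + q = n`, into a
leading block. It lies strictly below the diagonal, so the diagonal of `L` is irrelevant. The two
maxima correspond under `p ↦ n - p`. -/
theorem leftQSOrder_antidiag_mul {n : ℕ} {M L : Matrix (Fin n) (Fin n) F}
    (hL : ∀ i j, j < i → L i j = M i j) : leftQSOrder (antidiag F n * L) = lowerQSOrder M := by
  have key : ∀ p q, p + q = n → leadingRank (antidiag F n * L) p q =
      (M.submatrix (fun x : {x : Fin n // q ≤ x.1} => x.1)
        (fun y : {y : Fin n // y.1 < q} => y.1)).rank := by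
    intro p q h
    rw [leadingRank, ← Matrix.rank_submatrix (M.submatrix _ _) (revSubtypeEquiv h)
      (Equiv.refl _)]
    congr 1
    ext i j
    have hi := i.2
    have hj := j.2
    simp only [Matrix.submatrix_apply, antidiag_mul_apply, Equiv.refl_apply]
    exact hL _ _ (by rw [Fin.lt_def, Fin.val_rev]; omega)
  unfold leftQSOrder lowerQSOrder
  apply le_antisymm <;> refine Finset.sup_le fun p hp => ?_ <;> rw [Finset.mem_Icc] at hp
  · rw [key p (n - p) (by omega)]
    exact Finset.le_sup (f := fun p => (M.submatrix (fun x : {x : Fin n // p ≤ x.1} => x.1)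
      (fun y : {y : Fin n // y.1 < p} => y.1)).rank) (Finset.mem_Icc.mpr (by omega))
  · rw [← key (n - p) p (by omega)]
    have := Finset.le_sup (f := fun p => leadingRank (antidiag F n * L) p (n - p))
      (Finset.mem_Icc.mpr (by omega : 1 ≤ n - p ∧ n - p ≤ n - 1))
    rwa [show n - (n - p) = p by omega] at this

theorem leftQSOrder_mul_antidiag {n : ℕ} {M U : Matrix (Fin n) (Fin n) F}
    (hU : ∀ i j, i < j → U i j = M i j) : leftQSOrder (U * antidiag F n) = upperQSOrder M := by
  unfold leftQSOrder upperQSOrder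
  refine Finset.sup_congr rfl fun p hp => ?_
  rw [Finset.mem_Icc] at hp
  rw [leadingRank, ← Matrix.rank_submatrix (M.submatrix _ _) (Equiv.refl _)
    (revSubtypeEquiv (by omega : n - p + p = n))]
  congr 1
  ext i j
  have hi := i.2
  have hj := j.2
  simp only [Matrix.submatrix_apply, mul_antidiag_apply, Equiv.refl_apply]
  exact hU _ _ (by rw [Fin.lt_def]; simp only [Fin.val_rev]; omega)

end

/-! ### The theorem. -/

theorem mainTheorem1 {k : Type u} [Field k] {ω : ℝ} (hω2 : 2 < ω) (hω3 : ω ≤ 3)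
    (hmm : MatMulExponent k ω) :
    -- correctness of LT-RPM, for every choice of correct subroutines
    (∀ (F : Type u) [Field F] [Algebra k F] (S : Subroutines k), S.CorrectOver F →
      ∀ (n : ℕ) (A : AddrMatrix n n) (μ : List F), A.Valid μ →
        ∃ R : Matrix (Fin n) (Fin n) F,
          IsRankProfileMatrix (A.load μ) R ∧
          (∀ R', IsRankProfileMatrix (A.load μ) R' → R' = R) ∧
          IsPivotList ((ltRPM S n A).val μ) (leftPart R)) ∧
    -- cost of LT-RPM with subroutines of the standard costs
    (∀ c : ℝ, ∃ C : ℝ, ∀ (F : Type u) [Field F] [Algebra k F] (S : Subroutines k),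
      S.CorrectOver F → S.CostOver F ω c →
      ∀ (n : ℕ) (A : AddrMatrix n n) (μ : List F), A.Valid μ →
        ((ltRPM S n A).cost μ : ℝ) ≤
          C * (n : ℝ) ^ 2 * (max 1 (leftQSOrder (A.load μ) : ℝ)) ^ (ω - 2)) ∧
    -- fast matrix multiplication provides such subroutines
    (∃ (c : ℝ) (S : Subroutines k), ∀ (F : Type u) [Field F] [Algebra k F],
      S.CorrectOver F ∧ S.CostOver F ω c) ∧
    -- QS-order computes the left quasiseparable order, with a scan of linear length and
    -- no further field operations
    (∃ c : ℕ, ∀ (F : Type u) [Field F] [Algebra k F] (S : Subroutines k), S.CorrectOver F →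
      ∀ (n : ℕ) (A : AddrMatrix n n) (μ : List F), A.Valid μ →
        ((qsOrder S n A).val μ).1 = (leftQSOrder (A.load μ) : ℤ) ∧
        ((qsOrder S n A).val μ).2 ≤ c * (n + 1) ∧
        (qsOrder S n A).cost μ = (ltRPM S n A).cost μ) ∧
    -- on `J_n L` and `U J_n` it returns the quasiseparable orders of `M`, and these are also the
    -- left quasiseparable orders of the two inputs, which govern the cost
    (∀ (F : Type u) [Field F] [Algebra k F] (S : Subroutines k), S.CorrectOver F →
      ∀ (n : ℕ) (M L U : Matrix (Fin n) (Fin n) F),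
        (∀ i j, j < i → L i j = M i j) → (∀ i j, i < j → L i j = 0) →
        (∀ i j, i < j → U i j = M i j) → (∀ i j, j < i → U i j = 0) →
        ∀ (X Y : AddrMatrix n n) (μ ν : List F), X.Valid μ → Y.Valid ν →
          X.load μ = antidiag F n * L → Y.load ν = U * antidiag F n →
            ((qsOrder S n X).val μ).1 = (lowerQSOrder M : ℤ) ∧
            ((qsOrder S n Y).val ν).1 = (upperQSOrder M : ℤ) ∧
            leftQSOrder (X.load μ) = lowerQSOrder M ∧
            leftQSOrder (Y.load ν) = upperQSOrder M) := by
  refine ⟨?_, ?_, exists_subroutines hω2 hω3 hmm, ⟨9, ?_⟩, ?_⟩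
  · intro F _ _ S hS n A μ hA
    -- Existence of the rank profile matrix is read off from the PLUQ routine applied to the whole
    -- matrix.
    have hR := (hS.pluq_spec n n A μ hA).reveals
    exact ⟨_, hR, fun R' hR' => hR.unique hR', ltRPM_isPivotList hS hA hR⟩
  · intro c
    refine ⟨15 * c, fun F _ _ S hS hc n A μ hA => ?_⟩
    exact (runs_ltRPM hS n hA).2 ω c hω2 hc
  · intro F _ _ S hS n A μ hA
    rw [qsOrder_val, qsOrder_cost]
    exact ⟨(scan_ltRPM hS hA).1, (scan_ltRPM hS hA).2, rfl⟩
  · intro F _ _ S hS n M L U hL _ hU _ X Y μ ν hX hY lX lY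
    have h1 : leftQSOrder (X.load μ) = lowerQSOrder M := by
      rw [lX, leftQSOrder_antidiag_mul hL]
    have h2 : leftQSOrder (Y.load ν) = upperQSOrder M := by
      rw [lY, leftQSOrder_mul_antidiag hU]
    rw [qsOrder_val, qsOrder_val, ← h1, ← h2]
    exact ⟨(scan_ltRPM hS hX).1, (scan_ltRPM hS hY).1, rfl, rfl⟩
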